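/- Conventions. Let $I=[0,1]$, $S^1=\mathbb R/\mathbb Z$, and let $D^2$ be the closed unit disk. A (transversely) measured PL foliation of a 3-dimensional space $P$ is an atlas of charts with values in open subsets of $I\times[0,\infty)\times\mathbb R$, foliated by the lines in the first coordinate $t$ and oriented by increasing $t$, such that every change of charts is PL and is locally of the form $(t,x)\mapsto(a(t,x),b(x))$, where $a$ is increasing in $t$ and $b$ preserves two-dimensional Lebesgue measure. The points with $t=0$ (respectively $t=1$) form the entry region $F_-$ (respectively the exit region $F_+$), and those whose second coordinate is $0$ form the parallel boundary; together they form $\partial P$. A leaf is finite if it is a compact arc from $F_-$ to $F_+$, infinite if it is not compact, and closed if it is a circle (compact, without endpoints). A measured PL flow bordism is such a foliation with $P$ compact and Hausdorff, all of whose leaves in the parallel boundary are finite. A plug with base $F$ is a flow bordism with an infinite leaf having an endpoint in $F_-$, together with homeomorphisms $\alpha_\pm:F\to F_\pm$ such that $p=q$ whenever $\alpha_+(p)$ and $\alpha_-(q)$ are endpoints of a common leaf. Let $F=S^1\times I$. An attaching map is a PL homeomorphism $\alpha$ from an open neighborhood of $\partial(F\times I)$ in $F\times I$ onto an open neighborhood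 of $\partial P$ in $P$, which takes the fibers (of the projection to $F$) to leaves, preserving orientation, and satisfies $\alpha(p,0)=\alpha_-(p)$ and $\alpha(p,1)=\alpha_+(p)$. Let $m=\{\mathrm{pt}\}\times\partial(I\times I)$ and $l=S^1\times\{0\}\times\{0\}$ be the standard curves on $\partial(F\times I)=S^1\times\partial(I\times I)$. The plug is integrally Dehn-twisted if $P$ is homeomorphic to the solid torus $S^1\times D^2$ and, for an attaching map $\alpha$, the class $\alpha(m+l)$ or $\alpha(m-l)$ is that of a meridian of $P$, i.e. is represented by a closed curve homotopic in $\partial P$ to a circle corresponding to $\{\mathrm{pt}\}\times\partial D^2$. Lemma. There exists a measured PL, integrally Dehn-twisted plug with base $S^1\times I$ that has exactly two closed leaves. -/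

import Mathlib

open Set Filter Topology MeasureTheory

noncomputable section

namespace PLPlug

/-! ### Piecewise-linear maps, read in coordinates -/

/-- A closed convex polyhedron: a finite intersection of closed half-spaces. -/
def IsPolyhedron {E : Type*} [AddCommGroup E] [Module ℝ E] (C : Set E) : Prop :=
  ∃ s : Finset (E →ᵃ[ℝ] ℝ), C = {v | ∀ l ∈ s, 0 ≤ l v}

/-- Near `x`, the function `f` is a piecewise-linear function of the coordinates `c`: a
neighbourhood of `x` is covered by finitely many polyhedra (in the coordinates `c`), and on each of
them `f` is an affine function of `c`. -/
def PLAt {X E E' : Type*} [TopologicalSpace X] [AddCommGroup E] [Module ℝ E]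
    [AddCommGroup E'] [Module ℝ E'] (c : X → E) (f : X → E') (x : X) : Prop :=
  ∃ (n : ℕ) (C : Fin n → Set E) (A : Fin n → (E →ᵃ[ℝ] E')),
    (∀ i, IsPolyhedron (C i)) ∧
      ∀ᶠ y in 𝓝 x, (∃ i, c y ∈ C i) ∧ ∀ i, c y ∈ C i → f y = A i (c y)

/-- Coordinate space: a leaf coordinate and two transverse coordinates. -/
abbrev Coord : Type := ℝ × (ℝ × ℝ)

/-- Near `x`, the change of coordinates from `c` to `c'` is piecewise linear and takes the
foliation by oriented lines in the first coordinate to itself, preserving orientation. -/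
structure FoliatedPLAt {X : Type*} [TopologicalSpace X] (c c' : X → Coord) (x : X) : Prop where
  pl : PLAt c c' x
  transverse : ∃ b : ℝ × ℝ → ℝ × ℝ, ∀ᶠ y in 𝓝 x, (c' y).2 = b (c y).2
  oriented : ∃ U ∈ 𝓝 x, ∀ y ∈ U, ∀ z ∈ U, (c y).2 = (c z).2 → (c y).1 < (c z).1 →
    (c' y).1 < (c' z).1

/-- Near `x`, the transverse part of the change of coordinates from `c` to `c'` depends only on the
transverse coordinates and preserves Lebesgue measure. -/
def TransverselyMeasuredAt {X : Type*} [TopologicalSpace X] (c c' : X → Coord) (x : X) : Prop :=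
  ∃ b : ℝ × ℝ → ℝ × ℝ, ∃ U ∈ 𝓝 x, (∀ y ∈ U, (c' y).2 = b (c y).2) ∧
    ∀ S ⊆ (fun y => (c y).2) '' U, MeasurableSet S → volume (b '' S) = volume S

/-! ### Measured PL foliations with transverse boundary, parallel boundary and corner separation -/

/-- The local model `[0,1] × ([0,∞) × ℝ)`, foliated by the lines in the first coordinate, oriented
upwards. The face where the first coordinate is `0` (`1`) is transverse boundary oriented inward
(outward), the face where the second coordinate is `0` is parallel boundary, and the faces meet
in corner separation. -/
abbrev Model : Type := unitInterval × (Ici (0 : ℝ) × ℝ)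

/-- The three real coordinates of a chart. -/
def coords {P : Type*} [TopologicalSpace P] (e : OpenPartialHomeomorph P Model) (p : P) : Coord :=
  ((e p).1, ((e p).2.1, (e p).2.2))

/-- A transversely measured, oriented, one-dimensional PL foliation of a three-dimensional space
with boundary: an atlas of charts in the model whose changes of coordinates are PL, preserve the
oriented foliation of the model, and transversely preserve Lebesgue measure. -/
structure MeasuredPLFoliation (P : Type*) [TopologicalSpace P] where
  atlas : Set (OpenPartialHomeomorph P Model)
  cover : ∀ p : P, ∃ e ∈ atlas, p ∈ e.source
  foliated : ∀ e ∈ atlas, ∀ e' ∈ atlas, ∀ p ∈ e.source ∩ e'.source,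
    FoliatedPLAt (coords e) (coords e') p
  measured : ∀ e ∈ atlas, ∀ e' ∈ atlas, ∀ p ∈ e.source ∩ e'.source,
    TransverselyMeasuredAt (coords e) (coords e') p

namespace MeasuredPLFoliation

variable {P : Type*} [TopologicalSpace P] (𝓕 : MeasuredPLFoliation P)

/-- The entry region: the transverse boundary oriented inward, with its corners. -/
def entry : Set P := {p | ∃ e ∈ 𝓕.atlas, p ∈ e.source ∧ (coords e p).1 = 0}

/-- The exit region: the transverse boundary oriented outward, with its corners. -/
def exit : Set P := {p | ∃ e ∈ 𝓕.atlas, p ∈ e.source ∧ (coords e p).1 = 1}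

/-- The parallel boundary, with its corners. -/
def parallel : Set P := {p | ∃ e ∈ 𝓕.atlas, p ∈ e.source ∧ (coords e p).2.1 = 0}

/-- The boundary of the support. -/
def boundary : Set P := 𝓕.entry ∪ 𝓕.exit ∪ 𝓕.parallel

/-- `p` and `q` are joined by a leaf segment that lies in one chart. -/
def SamePlaque (p q : P) : Prop :=
  ∃ e ∈ 𝓕.atlas, p ∈ e.source ∧ q ∈ e.source ∧ (e p).2 = (e q).2 ∧
    ∀ t ∈ uIcc (e p).1 (e q).1, (t, (e p).2) ∈ e.target

/-- `p` and `q` are on the same leaf. -/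
def SameLeaf (p q : P) : Prop := Relation.EqvGen 𝓕.SamePlaque p q

/-- The leaf through `p`. -/
def leaf (p : P) : Set P := {q | 𝓕.SameLeaf p q}

/-- A finite leaf: a compact arc from the entry region to the exit region. -/
def IsFiniteLeaf (L : Set P) : Prop :=
  (∃ p, L = 𝓕.leaf p) ∧ IsCompact L ∧ (L ∩ 𝓕.entry).Nonempty ∧ (L ∩ 𝓕.exit).Nonempty

/-- An infinite leaf: one that is not compact. -/
def IsInfiniteLeaf (L : Set P) : Prop :=
  (∃ p, L = 𝓕.leaf p) ∧ ¬ IsCompact L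

/-- A closed leaf (a circle): one that is compact and has no endpoints. -/
def IsClosedLeaf (L : Set P) : Prop :=
  (∃ p, L = 𝓕.leaf p) ∧ IsCompact L ∧ L ∩ 𝓕.entry = ∅ ∧ L ∩ 𝓕.exit = ∅

/-- A flow bordism: a foliation of a compact Hausdorff support, all of whose boundary is transverse
boundary, parallel boundary or corner separation (as the model prescribes), such that all
leaves in the parallel boundary are finite. -/
structure IsFlowBordism : Prop where
  t2 : T2Space P
  compact : CompactSpace P
  parallel_finite : ∀ p ∈ 𝓕.parallel, 𝓕.IsFiniteLeaf (𝓕.leaf p)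

/-- Matched ends with base `F`: homeomorphisms from `F` to the entry and the exit region such
that the two endpoints of a leaf always correspond to the same point of `F`. -/
structure MatchedEnds (F : Type*) [TopologicalSpace F] where
  toEntry : F ≃ₜ 𝓕.entry
  toExit : F ≃ₜ 𝓕.exit
  matched : ∀ p q : F, 𝓕.SameLeaf (toExit p) (toEntry q) → p = q

/-- A plug with base `F`: a flow bordism with an infinite leaf that has an endpoint in the entry
region, and with matched ends. -/
structure Plug (F : Type*) [TopologicalSpace F] extends 𝓕.MatchedEnds F where
  flowBordism : 𝓕.IsFlowBordism
  infinite : ∃ p ∈ 𝓕.entry, 𝓕.IsInfiniteLeaf (𝓕.leaf p)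

end MeasuredPLFoliation

/-! ### Dehn-twisted plugs -/

/-- The annulus `S¹ × I`, with `S¹ = ℝ/ℤ`. -/
abbrev Annulus : Type := UnitAddCircle × unitInterval

/-- The boundary of the square `I × I`. -/
def squareBoundary : Set (unitInterval × unitInterval) :=
  {w | w.1 = 0 ∨ w.1 = 1 ∨ w.2 = 0 ∨ w.2 = 1}

/-- The boundary of the thickened annulus `(S¹ × I) × I`. -/
def thickBoundary : Set (Annulus × unitInterval) :=
  {b | (b.1.2, b.2) ∈ squareBoundary}

/-- The covering of the thickened annulus by `I × (I × ℝ)`, the first factor being the fiber. It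
gives the thickened annulus its PL structure and its foliation by fibers. -/
def thickCover (y : unitInterval × (unitInterval × ℝ)) : Annulus × unitInterval :=
  (((y.2.2 : UnitAddCircle), y.2.1), y.1)

/-- The three real coordinates on the covering of the thickened annulus. -/
def thickCoords (y : unitInterval × (unitInterval × ℝ)) : Coord :=
  (y.1, (y.2.1, y.2.2))

/-- The solid torus `S¹ × D²`. -/
abbrev SolidTorus : Type := UnitAddCircle × Metric.closedBall (0 : ℂ) 1

/-- An attaching map for a plug with base the annulus `F`: a PL homeomorphism from an open
neighbourhood of the boundary of `F × I` to an open neighbourhood of the boundary of the support,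
which takes the oriented fibers to the oriented leaves, and agrees at the two
ends with the identifications of `F` with the entry and the exit region. -/
structure AttachingMap {P : Type*} [TopologicalSpace P] (𝓕 : MeasuredPLFoliation P)
    (D : 𝓕.Plug Annulus) where
  toMap : OpenPartialHomeomorph (Annulus × unitInterval) P
  boundary_source : thickBoundary ⊆ toMap.source
  boundary_target : 𝓕.boundary ⊆ toMap.target
  map_zero : ∀ p, toMap (p, 0) = D.toEntry p
  map_one : ∀ p, toMap (p, 1) = D.toExit p
  foliated : ∀ y, thickCover y ∈ toMap.source →
    ∀ e ∈ 𝓕.atlas, toMap (thickCover y) ∈ e.source →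
      FoliatedPLAt thickCoords (fun z => coords e (toMap (thickCover z))) y

/-- The closed curve `c` in the boundary of `P ≅ S¹ × D²` is a meridian: for some such
homeomorphism it is homotopic, inside the boundary of `P`, to the circle `{0} × ∂D²`. -/
def IsMeridian {P : Type*} [TopologicalSpace P] (𝓕 : MeasuredPLFoliation P)
    (c : UnitAddCircle → P) : Prop :=
  ∃ (h : P ≃ₜ SolidTorus) (H : C(unitInterval × UnitAddCircle, P)),
    (∀ t, H (0, t) = c t) ∧
    (∀ t, (h (H (1, t))).1 = 0 ∧ ((h (H (1, t))).2 : ℂ) = AddCircle.toCircle t) ∧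
    ∀ z, H z ∈ 𝓕.boundary

/-- A plug with base the annulus is integrally Dehn-twisted if its support is a solid torus and, for
an attaching map `α`, the image under `α` of the class `m + l` or `m - l` is a meridian of the
support. Here `m` is `{pt} × ∂(I × I)`, parametrised by `γ`, and `l` is the longitude `S¹ × {pt}`;
the curve `t ↦ (± t, γ t)` on the torus `S¹ × ∂(I × I)` represents `m ± l`. -/
def IsIntegrallyDehnTwisted {P : Type*} [TopologicalSpace P] (𝓕 : MeasuredPLFoliation P)
    (D : 𝓕.Plug Annulus) : Prop :=
  ∃ (α : AttachingMap 𝓕 D) (γ : UnitAddCircle ≃ₜ squareBoundary) (ε : ℤ),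
    (ε = 1 ∨ ε = -1) ∧
      IsMeridian 𝓕 (fun t => α.toMap ((ε • t, (γ t).1.1), (γ t).1.2))

end PLPlug

end

noncomputable section

namespace PLPlug

section

/-! ### Piecewise-linear calculus -/

section PL

variable {X Y E E' E'' : Type*} [TopologicalSpace X] [TopologicalSpace Y]
  [AddCommGroup E] [Module ℝ E] [AddCommGroup E'] [Module ℝ E'] [AddCommGroup E''] [Module ℝ E'']

/-! A closed leaf is obtained by suspending a hyperbolic, area-preserving PL map of the plane. Each
side of the vertical axis is a quadrant with labels `A, B ≥ 0`, and the return map sends `(A, B)` to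
`(A / 2, 2 B)`. Its fixed point, the origin, becomes a closed leaf. Leaves through the rest of the
axis spiral onto it, and all other leaves pass by it in finite time. The function `plog` is a PL
logarithm that satisfies `plog (2 y) = plog y + 1` exactly. In the unrolled suspension the leaf with
labels `A, B` therefore starts on the transverse boundary at time `plog A` and crosses an interface
at time `1 - plog B`, and both events are invariant under the deck transformations.

Two such pieces, `false` at the entry and `true` at the exit, are glued along their interfaces by
`switch`, which reverses time: the plug is a suspension followed by a mirror image. A leaf that
enters with `B = 0` never reaches the interface, so it is infinite. Leaves off the axis cross from
entry to exit and are compact, while leaves on the axis other than the cores accumulate on a core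
and cannot be compact. Hence exactly the two cores are closed (`not_isCompact_leaf`,
`leaf_meets_entry`, `isClosedLeaf_iff`). Off the axis, `leafInv` and the class of `plog A` modulo 1
are constant along a leaf, and together they determine its endpoint in the base; this matches the
ends (`sameLeaf_endMap`).

The twist comes from the widths. The right half-plane is stretched by 1 in the entry piece and by 2
in the exit piece, so the gluing must halve `A` there to preserve area. Halving `A` amounts to one
extra deck transformation (`switchMap_baseMap`). A leaf in the parallel boundary therefore has
length 3 on the right and 2 on the left (`leafLength`), and relative to its starting angle it makes
one extra turn on one side only. Along the curve `m + l` this turn cancels the turn of the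
longitude, so the angle becomes a null-homotopic loop and the curve contracts to the boundary of a
disk (`twistedAngle_zero_eq_one`, `meridianHomotopy_mem`).

The topology is made explicit by taking `S¹ × [-1, 1]²` as the support. Its coordinates are the time
modulo 1, `leafInv`, and a height computed from `nearEnd` and `nearMid`. The map `pieceMap` presents
it as the quotient of the two pieces by deck transformations and `switch` (`deck_of_pieceMap_eq`,
`deck_switch_of_halfMap_eq`, `exists_halfMap_eq`, `isOpen_image_pieceMap`). The PL structure is not
that of the product: it is transported from the pieces, whose symmetries translate the leaves and
act on the plane by area-preserving PL maps. Exponentials enter only through the topology. In charts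
and in the attaching map only `plog`, `pexp` and PL combinations of them survive. -/

theorem IsPolyhedron.inter {C D : Set E} (hC : IsPolyhedron C) (hD : IsPolyhedron D) :
    IsPolyhedron (C ∩ D) := by
  classical
  obtain ⟨s, rfl⟩ := hC
  obtain ⟨t, rfl⟩ := hD
  refine ⟨s ∪ t, ?_⟩
  ext v
  simp only [mem_inter_iff, mem_ofPred_eq, Finset.mem_union]
  exact ⟨fun h l hl => hl.elim (h.1 l) (h.2 l), fun h => ⟨fun l hl => h l (.inl hl),
    fun l hl => h l (.inr hl)⟩⟩

theorem IsPolyhedron.preimage {C : Set E'} (hC : IsPolyhedron C) (A : E →ᵃ[ℝ] E') :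
    IsPolyhedron (A ⁻¹' C) := by
  classical
  obtain ⟨s, rfl⟩ := hC
  refine ⟨s.image (fun l => l.comp A), ?_⟩
  ext v
  simp

theorem isPolyhedron_univ : IsPolyhedron (univ : Set E) := ⟨∅, by simp⟩

theorem isPolyhedron_halfSpace (l : E →ᵃ[ℝ] ℝ) : IsPolyhedron {v | 0 ≤ l v} := ⟨{l}, by simp⟩

theorem IsPolyhedron.isClosed {E : Type*} [NormedAddCommGroup E] [NormedSpace ℝ E]
    [FiniteDimensional ℝ E] {C : Set E} (hC : IsPolyhedron C) :
    IsClosed C := by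
  obtain ⟨s, rfl⟩ := hC
  simp only [ofPred_forall]
  exact isClosed_biInter fun l _ =>
    isClosed_le continuous_const (AffineMap.continuous_of_finiteDimensional l)

/-- Near `x`, the function `f` is a piecewise-linear function of `c`, all of whose affine pieces
satisfy `Q`. -/
def PLWith (Q : (E →ᵃ[ℝ] E') → Prop) (c : X → E) (f : X → E') (x : X) : Prop :=
  ∃ (ι : Type) (_ : Finite ι) (C : ι → Set E) (A : ι → (E →ᵃ[ℝ] E')),
    (∀ i, IsPolyhedron (C i)) ∧ (∀ i, Q (A i)) ∧
      ∀ᶠ y in 𝓝 x, (∃ i, c y ∈ C i) ∧ ∀ i, c y ∈ C i → f y = A i (c y)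

theorem PLWith.plAt {Q : (E →ᵃ[ℝ] E') → Prop} {c : X → E} {f : X → E'} {x : X}
    (h : PLWith Q c f x) : PLAt c f x := by
  obtain ⟨ι, hι, C, A, hC, -, h⟩ := h
  obtain ⟨n, ⟨e⟩⟩ := Finite.exists_equiv_fin ι
  refine ⟨n, C ∘ e.symm, A ∘ e.symm, fun i => hC _, h.mono fun y hy => ⟨?_, fun i hi => hy.2 _ hi⟩⟩
  obtain ⟨i, hi⟩ := hy.1
  exact ⟨e i, by simpa using hi⟩

theorem PLWith.mono {Q Q' : (E →ᵃ[ℝ] E') → Prop} (hQ : ∀ A, Q A → Q' A) {c : X → E} {f : X → E'}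
    {x : X} (h : PLWith Q c f x) : PLWith Q' c f x := by
  obtain ⟨ι, hι, C, A, hC, hA, h⟩ := h
  exact ⟨ι, hι, C, A, hC, fun i => hQ _ (hA i), h⟩

theorem PLWith.congr {Q : (E →ᵃ[ℝ] E') → Prop} {c : X → E} {f f' : X → E'} {x : X}
    (h : PLWith Q c f x) (hf : ∀ᶠ y in 𝓝 x, f' y = f y) : PLWith Q c f' x := by
  obtain ⟨ι, hι, C, A, hC, hA, h⟩ := h
  refine ⟨ι, hι, C, A, hC, hA, ?_⟩
  filter_upwards [h, hf] with y hy e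
  rw [e]
  exact hy

theorem PLWith.comap {Q : (E →ᵃ[ℝ] E') → Prop} {c : X → E} {f : X → E'} {u : Y → X} {y : Y}
    (h : PLWith Q c f (u y)) (hu : ContinuousAt u y) : PLWith Q (c ∘ u) (f ∘ u) y := by
  obtain ⟨ι, hι, C, A, hC, hA, h⟩ := h
  exact ⟨ι, hι, C, A, hC, hA, hu.eventually h⟩

/-- Pairing and composing two piecewise-linear functions through an arbitrary operation on affine
maps. -/
theorem PLWith.trans {Q : (E →ᵃ[ℝ] E') → Prop} {Q' : (E' →ᵃ[ℝ] E'') → Prop}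
    {Q'' : (E →ᵃ[ℝ] E'') → Prop} (hQ : ∀ A B, Q A → Q' B → Q'' (B.comp A))
    {c : X → E} {f : X → E'} {g : X → E''} {x : X}
    (h : PLWith Q c f x) (h' : PLWith Q' f g x) : PLWith Q'' c g x := by
  obtain ⟨ι, hι, C, A, hC, hA, h⟩ := h
  obtain ⟨κ, hκ, D, B, hD, hB, h'⟩ := h'
  refine ⟨ι × κ, inferInstance, fun p => C p.1 ∩ A p.1 ⁻¹' D p.2, fun p => (B p.2).comp (A p.1),
    fun p => (hC _).inter ((hD _).preimage _), fun p => hQ _ _ (hA _) (hB _), ?_⟩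
  filter_upwards [h, h'] with y hy hy'
  constructor
  · obtain ⟨i, hi⟩ := hy.1
    obtain ⟨j, hj⟩ := hy'.1
    refine ⟨(i, j), hi, ?_⟩
    rw [mem_preimage, ← hy.2 i hi]
    exact hj
  · rintro ⟨i, j⟩ ⟨hi, hj⟩
    have e := hy.2 i hi
    rw [mem_preimage, ← e] at hj
    rw [hy'.2 j hj, e]
    rfl

/-- Near `x`, the function `f` is piecewise linear in `c`. -/
abbrev PL (c : X → E) (f : X → E') (x : X) : Prop := PLWith (fun _ => True) c f x

theorem PL.comp {c : X → E} {f : X → E'} {g : X → E''} {x : X} (h : PL c f x) (h' : PL f g x) :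
    PL c g x :=
  PLWith.trans (fun _ _ _ _ => trivial) h h'

theorem PLWith.affine {Q : (E →ᵃ[ℝ] E') → Prop} {c : X → E} {x : X} (A : E →ᵃ[ℝ] E') (hA : Q A) :
    PLWith Q c (fun y => A (c y)) x :=
  ⟨Unit, inferInstance, fun _ => univ, fun _ => A, fun _ => isPolyhedron_univ, fun _ => hA,
    .of_forall fun _ => ⟨⟨(), trivial⟩, fun _ _ => rfl⟩⟩

theorem PLWith.prodMk {Q : (E →ᵃ[ℝ] E') → Prop} {Q' : (E →ᵃ[ℝ] E'') → Prop}
    {Q'' : (E →ᵃ[ℝ] E' × E'') → Prop} (hQ : ∀ A B, Q A → Q' B → Q'' (A.prod B))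
    {c : X → E} {f : X → E'} {g : X → E''} {x : X}
    (h : PLWith Q c f x) (h' : PLWith Q' c g x) : PLWith Q'' c (fun y => (f y, g y)) x := by
  obtain ⟨ι, hι, C, A, hC, hA, h⟩ := h
  obtain ⟨κ, hκ, D, B, hD, hB, h'⟩ := h'
  refine ⟨ι × κ, inferInstance, fun p => C p.1 ∩ D p.2, fun p => (A p.1).prod (B p.2),
    fun p => (hC _).inter (hD _), fun p => hQ _ _ (hA _) (hB _), ?_⟩
  filter_upwards [h, h'] with y hy hy'
  constructor
  · obtain ⟨i, hi⟩ := hy.1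
    obtain ⟨j, hj⟩ := hy'.1
    exact ⟨(i, j), hi, hj⟩
  · rintro ⟨i, j⟩ ⟨hi, hj⟩
    rw [hy.2 i hi, hy'.2 j hj]
    rfl

/-- A function that agrees with one piecewise-linear function where the affine function `l` is
nonnegative and with another one where `l` is nonpositive. -/
theorem PLWith.piecewise {Q : (E →ᵃ[ℝ] E') → Prop} {c : X → E} {f f₁ f₂ : X → E'} {x : X}
    (l : E →ᵃ[ℝ] ℝ) (h₁ : PLWith Q c f₁ x) (h₂ : PLWith Q c f₂ x)
    (hf₁ : ∀ᶠ y in 𝓝 x, 0 ≤ l (c y) → f y = f₁ y)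
    (hf₂ : ∀ᶠ y in 𝓝 x, l (c y) ≤ 0 → f y = f₂ y) : PLWith Q c f x := by
  obtain ⟨ι, hι, C, A, hC, hA, h₁⟩ := h₁
  obtain ⟨κ, hκ, D, B, hD, hB, h₂⟩ := h₂
  refine ⟨ι ⊕ κ, inferInstance, Sum.elim (fun i => C i ∩ {v | 0 ≤ l v})
    (fun j => D j ∩ {v | 0 ≤ (-l) v}), Sum.elim A B, ?_, ?_, ?_⟩
  · rintro (i | j)
    · exact (hC i).inter (isPolyhedron_halfSpace l)
    · exact (hD j).inter (isPolyhedron_halfSpace (-l))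
  · rintro (i | j)
    · exact hA i
    · exact hB j
  · filter_upwards [h₁, h₂, hf₁, hf₂] with y hy₁ hy₂ e₁ e₂
    constructor
    · rcases le_total 0 (l (c y)) with hl | hl
      · obtain ⟨i, hi⟩ := hy₁.1
        exact ⟨.inl i, hi, hl⟩
      · obtain ⟨j, hj⟩ := hy₂.1
        exact ⟨.inr j, hj, by simpa using hl⟩
    · rintro (i | j)
      · rintro ⟨hi, hl⟩
        rw [e₁ hl]
        exact hy₁.2 i hi
      · rintro ⟨hj, hl⟩
        rw [e₂ (by simpa using hl)]
        exact hy₂.2 j hj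

theorem PL.refl {c : X → E} {x : X} : PL c c x := PLWith.affine (AffineMap.id ℝ E) trivial

theorem PL.const {c : X → E} {x : X} (a : E') : PL c (fun _ => a) x :=
  PLWith.affine (AffineMap.const ℝ E a) trivial

theorem PL.pair {c : X → E} {f : X → E'} {g : X → E''} {x : X} (h : PL c f x) (h' : PL c g x) :
    PL c (fun y => (f y, g y)) x :=
  PLWith.prodMk (fun _ _ _ _ => trivial) h h'

theorem PL.fst {c : X → E} {f : X → E' × E''} {x : X} (h : PL c f x) :
    PL c (fun y => (f y).1) x :=
  h.comp (PLWith.affine (LinearMap.fst ℝ E' E'').toAffineMap trivial)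

theorem PL.snd {c : X → E} {f : X → E' × E''} {x : X} (h : PL c f x) :
    PL c (fun y => (f y).2) x :=
  h.comp (PLWith.affine (LinearMap.snd ℝ E' E'').toAffineMap trivial)

theorem PL.add {c : X → E} {f g : X → E'} {x : X} (h : PL c f x) (h' : PL c g x) :
    PL c (fun y => f y + g y) x :=
  (h.pair h').comp (PLWith.affine
    (LinearMap.fst ℝ E' E' + LinearMap.snd ℝ E' E').toAffineMap trivial)

theorem PL.smul {c : X → E} {f : X → E'} {x : X} (r : ℝ) (h : PL c f x) :
    PL c (fun y => r • f y) x :=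
  h.comp (PLWith.affine (r • LinearMap.id (R := ℝ) (M := E')).toAffineMap trivial)

theorem PL.mul {c : X → E} {f : X → ℝ} {x : X} (r : ℝ) (h : PL c f x) :
    PL c (fun y => r * f y) x := h.smul r

theorem PL.neg {c : X → E} {f : X → E'} {x : X} (h : PL c f x) :
    PL c (fun y => -f y) x :=
  h.comp (PLWith.affine (-LinearMap.id (R := ℝ) (M := E')).toAffineMap trivial)

theorem PL.sub {c : X → E} {f g : X → E'} {x : X} (h : PL c f x) (h' : PL c g x) :
    PL c (fun y => f y - g y) x :=
  (h.pair h').comp (PLWith.affine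
    (LinearMap.fst ℝ E' E' - LinearMap.snd ℝ E' E').toAffineMap trivial)

theorem PL.max {c : X → E} {f g : X → ℝ} {x : X} (h : PL c f x) (h' : PL c g x) :
    PL c (fun y => max (f y) (g y)) x := by
  refine (h.pair h').comp (PLWith.piecewise
    (LinearMap.fst ℝ ℝ ℝ - LinearMap.snd ℝ ℝ ℝ).toAffineMap PL.refl.fst PL.refl.snd ?_ ?_)
  · exact .of_forall fun y hy => max_eq_left (by simpa using hy)
  · exact .of_forall fun y hy => max_eq_right (by simpa using hy)

theorem PL.min {c : X → E} {f g : X → ℝ} {x : X} (h : PL c f x) (h' : PL c g x) :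
    PL c (fun y => min (f y) (g y)) x :=
  ((h.neg.max h'.neg).neg).congr (.of_forall fun y => by simp [max_neg_neg])

/-- The finitely many polyhedra are closed, so near `x` only those that contain `c x` matter, and
the affine pieces on these all take the value `f x` at `c x`. -/
theorem PLWith.continuousAt {E E' : Type*} [NormedAddCommGroup E] [NormedSpace ℝ E]
    [FiniteDimensional ℝ E] [NormedAddCommGroup E'] [NormedSpace ℝ E'] {Q : (E →ᵃ[ℝ] E') → Prop}
    {c : X → E} {f : X → E'} {x : X} (h : PLWith Q c f x) (hc : ContinuousAt c x) :
    ContinuousAt f x := by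
  obtain ⟨ι, hι, C, A, hC, -, h⟩ := h
  have h1 : ∀ᶠ y in 𝓝 x, ∀ i, c y ∈ C i → c x ∈ C i := by
    rw [eventually_all]
    intro i
    by_cases hx : c x ∈ C i
    · exact .of_forall fun _ _ => hx
    · filter_upwards [hc.eventually ((hC i).isClosed.isOpen_compl.mem_nhds hx)] with y hy hy'
      exact absurd hy' hy
  intro V hV
  have h2 : ∀ᶠ y in 𝓝 x, ∀ i, c x ∈ C i → A i (c y) ∈ V := by
    rw [eventually_all]
    intro i
    by_cases hx : c x ∈ C i
    · have hA : ContinuousAt (fun y => A i (c y)) x :=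
        ContinuousAt.comp (g := A i)
          (AffineMap.continuous_of_finiteDimensional (A i)).continuousAt hc
      have := h.self_of_nhds.2 i hx
      have hV' : V ∈ 𝓝 (A i (c x)) := this ▸ hV
      exact (hA.eventually hV').mono fun _ hy _ => hy
    · exact .of_forall fun _ hx' => absurd hx' hx
  rw [Filter.mem_map]
  filter_upwards [h, h1, h2] with y hy hy1 hy2
  obtain ⟨i, hi⟩ := hy.1
  rw [mem_preimage, hy.2 i hi]
  exact hy2 i (hy1 i hi)

end PL

/-! ### Area-preserving piecewise-linear maps of the plane -/

/-- The affine map of the plane multiplies area by `d`. -/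
def AreaFactor (d : ℝ) (A : (ℝ × ℝ) →ᵃ[ℝ] (ℝ × ℝ)) : Prop := |LinearMap.det A.linear| = d

theorem AreaFactor.comp {d e f : ℝ} (hf : f = e * d) (A B : (ℝ × ℝ) →ᵃ[ℝ] (ℝ × ℝ))
    (hA : AreaFactor d A) (hB : AreaFactor e B) : AreaFactor f (B.comp A) := by
  unfold AreaFactor at *
  rw [AffineMap.comp_linear, LinearMap.det_comp, abs_mul, hA, hB, hf]

/-- The affine map `(x, z) ↦ (a x + b z + e, c x + d z + f)`. -/
def planeMap (a b c d e f : ℝ) : (ℝ × ℝ) →ᵃ[ℝ] (ℝ × ℝ) :=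
  ((a • LinearMap.fst ℝ ℝ ℝ + b • LinearMap.snd ℝ ℝ ℝ).prod
    (c • LinearMap.fst ℝ ℝ ℝ + d • LinearMap.snd ℝ ℝ ℝ)).toAffineMap +
      AffineMap.const ℝ (ℝ × ℝ) (e, f)

@[simp]
theorem planeMap_apply (a b c d e f : ℝ) (v : ℝ × ℝ) :
    planeMap a b c d e f v = (a * v.1 + b * v.2 + e, c * v.1 + d * v.2 + f) := by
  simp [planeMap]

theorem areaFactor_planeMap (a b c d e f : ℝ) :
    AreaFactor |a * d - b * c| (planeMap a b c d e f) := by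
  unfold AreaFactor planeMap
  congr 1
  rw [← LinearMap.det_toMatrix (Module.Basis.finTwoProd ℝ), Matrix.det_fin_two]
  simp [LinearMap.toMatrix_apply, Module.Basis.finTwoProd]

theorem PLWith.planeMap {X : Type*} [TopologicalSpace X] {c : X → ℝ × ℝ} {f : X → ℝ × ℝ} {x : X}
    (a₁ a₂ b₁ b₂ e₁ e₂ : ℝ) {d : ℝ} (hd : |a₁ * b₂ - a₂ * b₁| = d)
    (hf : ∀ᶠ y in 𝓝 x,
      f y = (a₁ * (c y).1 + a₂ * (c y).2 + e₁, b₁ * (c y).1 + b₂ * (c y).2 + e₂)) :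
    PLWith (AreaFactor d) c f x :=
  (PLWith.affine (PLPlug.planeMap a₁ a₂ b₁ b₂ e₁ e₂)
    (hd ▸ areaFactor_planeMap a₁ a₂ b₁ b₂ e₁ e₂)).congr (hf.mono fun y hy => by
      rw [hy, planeMap_apply])

theorem AreaFactor.injective {A : (ℝ × ℝ) →ᵃ[ℝ] (ℝ × ℝ)} (hA : AreaFactor 1 A) :
    Function.Injective A := by
  rw [← AffineMap.linear_injective_iff]
  have : LinearMap.det A.linear ≠ 0 := by
    intro h
    simp [AreaFactor, h] at hA
  exact (LinearMap.equivOfDetNeZero A.linear this).injective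

theorem AreaFactor.measurableSet_image {A : (ℝ × ℝ) →ᵃ[ℝ] (ℝ × ℝ)} (hA : AreaFactor 1 A)
    {S : Set (ℝ × ℝ)} (hS : MeasurableSet S) : MeasurableSet (A '' S) :=
  hS.image_of_continuousOn_injOn (AffineMap.continuous_of_finiteDimensional A).continuousOn
    hA.injective.injOn

theorem AreaFactor.volume_image {A : (ℝ × ℝ) →ᵃ[ℝ] (ℝ × ℝ)} (hA : AreaFactor 1 A)
    (S : Set (ℝ × ℝ)) : volume (A '' S) = volume S := by
  have h : (A : ℝ × ℝ → ℝ × ℝ) = (fun v => A 0 + v) ∘ A.linear := by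
    ext1 v
    have := congrFun A.decomp v
    simpa [add_comm] using this
  rw [h, image_comp, image_add_left, measure_preimage_add, Measure.addHaar_image_linearMap]
  unfold AreaFactor at hA
  simp [hA]

/-- Images of a set under an injective map that is given by finitely many area-preserving affine
maps have the same measure. -/
theorem volume_image_of_pieces {ι : Type} [Finite ι] {C : ι → Set (ℝ × ℝ)}
    {A : ι → ((ℝ × ℝ) →ᵃ[ℝ] (ℝ × ℝ))} (hC : ∀ i, MeasurableSet (C i)) (hA : ∀ i, AreaFactor 1 (A i))
    {b : ℝ × ℝ → ℝ × ℝ} {S : Set (ℝ × ℝ)} (hb : InjOn b S) (hS : MeasurableSet S)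
    (hcov : ∀ v ∈ S, ∃ i, v ∈ C i) (hbA : ∀ v ∈ S, ∀ i, v ∈ C i → b v = A i v) :
    volume (b '' S) = volume S := by
  obtain ⟨n, ⟨e⟩⟩ := Finite.exists_equiv_fin ι
  -- Each point is assigned to the first polyhedron that contains it. The resulting parts are
  -- disjoint, and injectivity of `b` keeps their images disjoint, so the measures add up.
  set D : Fin n → Set (ℝ × ℝ) := fun i => S ∩ (C (e.symm i) \ ⋃ j : Fin n, ⋃ _ : j < i, C (e.symm
      j))
    with hD
  have hDm : ∀ i, MeasurableSet (D i) := fun i =>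
    hS.inter ((hC _).diff (.iUnion fun j => .iUnion fun _ => hC _))
  have hDd : Pairwise (Function.onFun Disjoint D) := by
    intro i j hij
    rw [Function.onFun, Set.disjoint_left]
    rintro v ⟨hv, hvi, hvi'⟩ ⟨-, hvj, hvj'⟩
    simp only [mem_iUnion, not_exists] at hvi' hvj'
    rcases lt_or_gt_of_ne hij with h | h
    · exact hvj' i h hvi
    · exact hvi' j h hvj
  have hDS : S = ⋃ i, D i := by
    ext v
    simp only [mem_iUnion]
    constructor
    · intro hv
      obtain ⟨i, hi⟩ := hcov v hv
      have hne : ∃ k : ℕ, ∃ h : k < n, v ∈ C (e.symm ⟨k, h⟩) := ⟨e i, (e i).2, by simpa using hi⟩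
      classical
      obtain ⟨h, hv'⟩ := Nat.find_spec hne
      refine ⟨⟨Nat.find hne, h⟩, hv, hv', ?_⟩
      simp only [mem_iUnion, not_exists]
      intro j hj hvj
      exact Nat.find_min hne hj ⟨j.2, hvj⟩
    · rintro ⟨i, hi, -⟩
      exact hi
  have hbD : ∀ i, b '' D i = A (e.symm i) '' D i := fun i =>
    image_congr fun v hv => hbA v hv.1 _ hv.2.1
  conv_lhs => rw [hDS, image_iUnion]
  conv_rhs => rw [hDS]
  rw [measure_iUnion hDd hDm, measure_iUnion]
  · exact tsum_congr fun i => by rw [hbD, (hA _).volume_image]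
  · intro i j hij
    rw [Function.onFun, Set.disjoint_left]
    rintro _ ⟨v, hv, rfl⟩ ⟨v', hv', e⟩
    exact Set.disjoint_left.1 (hDd hij) hv (hb hv'.1 hv.1 e ▸ hv')
  · intro i
    rw [hbD]
    exact (hA _).measurableSet_image (hDm i)

end

section

/-! ### Changes of coordinates of translation type -/

section Transition

variable {X Y : Type*} [TopologicalSpace X] [TopologicalSpace Y]

/-- Near `x`, the change of coordinates from `c` to `c'` is given by finitely many affine maps,
translates the leaves, and acts on the transverse coordinates injectively, preserving area. -/
structure Transition (c c' : X → Coord) (x : X) : Prop where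
  pl : PLWith (fun A : (ℝ × ℝ) →ᵃ[ℝ] (ℝ × (ℝ × ℝ)) =>
      AreaFactor 1 ((LinearMap.snd ℝ ℝ (ℝ × ℝ)).toAffineMap.comp A))
    (fun y => (c y).2) (fun y => ((c' y).1 - (c y).1, (c' y).2)) x
  inj : ∃ U ∈ 𝓝 x, ∀ y ∈ U, ∀ z ∈ U, (c' y).2 = (c' z).2 → (c y).2 = (c z).2

theorem PLWith.exists_fun {E E' : Type*} [AddCommGroup E] [Module ℝ E] [AddCommGroup E']
    [Module ℝ E'] {Q : (E →ᵃ[ℝ] E') → Prop} {c : X → E} {f : X → E'} {x : X}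
    (h : PLWith Q c f x) : ∃ b : E → E', ∀ᶠ y in 𝓝 x, f y = b (c y) := by
  obtain ⟨ι, hι, C, A, hC, hA, h⟩ := h
  classical
  refine ⟨fun v => if h : ∃ i, v ∈ C i then A h.choose v else 0, h.mono fun y hy => ?_⟩
  change f y = dite _ _ _
  rw [dif_pos hy.1]
  exact hy.2 _ hy.1.choose_spec

/-- The leaf coordinate changes by an amount that depends only on the transverse coordinates, so the
order along a leaf cannot change. -/
theorem Transition.foliatedPLAt {c c' : X → Coord} {x : X} (h : Transition c c' x) :
    FoliatedPLAt c c' x := by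
  obtain ⟨b, hb⟩ := h.pl.exists_fun
  refine ⟨?_, ⟨fun v => (b v).2, hb.mono fun y hy => (Prod.ext_iff.1 hy).2⟩, ⟨_, hb, ?_⟩⟩
  · have h1 : PL c (fun y => ((c' y).1 - (c y).1, (c' y).2)) x :=
      PL.refl.snd.comp (h.pl.mono fun _ _ => trivial)
    refine (((h1.fst.add PL.refl.fst).pair h1.snd).congr (.of_forall fun y => ?_)).plAt
    simp
  · intro y hy z hz e hlt
    simp only [mem_ofPred_eq] at hy hz
    have h1 := congrArg Prod.fst hy
    have h2 := congrArg Prod.fst hz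
    rw [e] at h1
    simp only at h1 h2
    linarith

theorem Transition.transverselyMeasuredAt {c c' : X → Coord} {x : X} (h : Transition c c' x) :
    TransverselyMeasuredAt c c' x := by
  obtain ⟨b, hb⟩ := h.pl.exists_fun
  obtain ⟨U, hU, hinj⟩ := h.inj
  obtain ⟨ι, hι, C, A, hC, hA, hp⟩ := h.pl
  refine ⟨fun v => (b v).2, _, inter_mem (inter_mem hb hp) hU, fun y hy => (Prod.ext_iff.1
      hy.1.1).2, ?_⟩
  · intro S hS hSm
    have key : ∀ v ∈ S, ∀ i, v ∈ C i →
        (b v).2 = ((LinearMap.snd ℝ ℝ (ℝ × ℝ)).toAffineMap.comp (A i)) v := by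
      intro v hv i hi
      obtain ⟨y, ⟨⟨hy1, hy2⟩, hy3⟩, rfl⟩ := hS hv
      simp only [mem_ofPred_eq] at hy1 hy2
      rw [← hy1, hy2.2 i hi]
      rfl
    refine volume_image_of_pieces (fun i => (hC i).isClosed.measurableSet) hA ?_ hSm ?_ key
    · intro v hv v' hv' e
      obtain ⟨y, ⟨⟨hy1, hy2⟩, hy3⟩, rfl⟩ := hS hv
      obtain ⟨z, ⟨⟨hz1, hz2⟩, hz3⟩, rfl⟩ := hS hv'
      simp only [mem_ofPred_eq] at hy1 hz1 e
      rw [← hy1, ← hz1] at e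
      exact hinj y hy3 z hz3 e
    · intro v hv
      obtain ⟨y, ⟨⟨hy1, hy2⟩, hy3⟩, rfl⟩ := hS hv
      exact hy2.1

theorem Transition.trans {c c' c'' : X → Coord} {x : X} (h : Transition c c' x)
    (h' : Transition c' c'' x) : Transition c c'' x := by
  constructor
  · obtain ⟨ι, hι, C, A, hC, hA, hp⟩ := h.pl
    obtain ⟨κ, hκ, D, B, hD, hB, hq⟩ := h'.pl
    set pr := (LinearMap.snd ℝ ℝ (ℝ × ℝ)).toAffineMap
    set pl := (LinearMap.fst ℝ ℝ (ℝ × ℝ)).toAffineMap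
    refine ⟨ι × κ, inferInstance, fun p => C p.1 ∩ (pr.comp (A p.1)) ⁻¹' D p.2,
      fun p => (pl.comp (A p.1) + pl.comp ((B p.2).comp (pr.comp (A p.1)))).prod
        (pr.comp ((B p.2).comp (pr.comp (A p.1)))),
      fun p => (hC _).inter ((hD _).preimage _),
      fun p => AreaFactor.comp (by norm_num) _ _ (hA p.1) (hB p.2), ?_⟩
    filter_upwards [hp, hq] with y hy hy'
    have e2 : ∀ i, (c y).2 ∈ C i → (c' y).2 = pr.comp (A i) (c y).2 := fun i hi =>
      (Prod.ext_iff.1 (hy.2 i hi)).2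
    have e1 : ∀ i, (c y).2 ∈ C i → (c' y).1 - (c y).1 = (A i (c y).2).1 := fun i hi =>
      (Prod.ext_iff.1 (hy.2 i hi)).1
    constructor
    · obtain ⟨i, hi⟩ := hy.1
      obtain ⟨j, hj⟩ := hy'.1
      refine ⟨(i, j), hi, ?_⟩
      rw [mem_preimage, ← e2 i hi]
      exact hj
    · rintro ⟨i, j⟩ ⟨hi, hj⟩
      have e := e2 i hi
      rw [mem_preimage, ← e] at hj
      have f := hy'.2 j hj
      have f1 := congrArg Prod.fst f
      have f2 := congrArg Prod.snd f
      simp only at f1 f2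
      have := e1 i hi
      refine Prod.ext ?_ ?_
      · change _ = (A i (c y).2).1 + (B j (pr.comp (A i) (c y).2)).1
        rw [← e]
        linarith
      · rw [AffineMap.prod_apply, AffineMap.comp_apply, AffineMap.comp_apply, ← e]
        exact f2
  · obtain ⟨U, hU, hUi⟩ := h.inj
    obtain ⟨V, hV, hVi⟩ := h'.inj
    exact ⟨_, inter_mem hU hV, fun y hy z hz e => hUi y hy.1 z hz.1 (hVi y hy.2 z hz.2 e)⟩

/-- The map `(t, v) ↦ (t + g v, b v)` is a local isomorphism of foliated measured piecewise-linear
structures along the leaf of `v₀`. -/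
structure IsLeafShift (g : ℝ × ℝ → ℝ) (b : ℝ × ℝ → ℝ × ℝ) (v₀ : ℝ × ℝ) : Prop where
  shift : PL id g v₀
  area : PLWith (AreaFactor 1) id b v₀
  inj : ∃ N ∈ 𝓝 v₀, InjOn b N

variable {g : ℝ × ℝ → ℝ} {b : ℝ × ℝ → ℝ × ℝ} {c c' : X → Coord} {x : X}

theorem IsLeafShift.transition (h : IsLeafShift g b (c x).2) (hc : ContinuousAt c x)
    (hc' : ∀ᶠ y in 𝓝 x, c' y = ((c y).1 + g (c y).2, b (c y).2)) : Transition c c' x := by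
  have hc2 : ContinuousAt (fun y => (c y).2) x := hc.snd
  constructor
  · refine (PLWith.prodMk (Q'' := fun A => AreaFactor 1
      ((LinearMap.snd ℝ ℝ (ℝ × ℝ)).toAffineMap.comp A)) (fun A B _ hB => ?_)
      (PLWith.comap (u := fun y => (c y).2) h.shift hc2)
      (PLWith.comap (u := fun y => (c y).2) h.area hc2)).congr ?_
    · have : (LinearMap.snd ℝ ℝ (ℝ × ℝ)).toAffineMap.comp (A.prod B) = B := by ext v <;> rfl
      rwa [this]
    · filter_upwards [hc'] with y hy
      simp [hy]
  · obtain ⟨N, hN, hi⟩ := h.inj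
    refine ⟨_, inter_mem (hc2 hN) hc', fun y hy z hz e => ?_⟩
    have h1 := hy.2
    have h2 := hz.2
    simp only [mem_ofPred_eq] at h1 h2
    rw [h1, h2] at e
    exact hi hy.1 hz.1 e

/-- The inverse of an area-preserving affine map of the plane. -/
theorem AreaFactor.exists_inverse {A : (ℝ × ℝ) →ᵃ[ℝ] (ℝ × ℝ)} (hA : AreaFactor 1 A) :
    ∃ B : (ℝ × ℝ) →ᵃ[ℝ] (ℝ × ℝ), AreaFactor 1 B ∧ (∀ v, B (A v) = v) ∧ ∀ v, A (B v) = v := by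
  have hs : Function.Surjective A := by
    rw [← AffineMap.linear_surjective_iff]
    exact LinearMap.injective_iff_surjective.1 ((AffineMap.linear_injective_iff _).2 hA.injective)
  set e := AffineEquiv.ofBijective (φ := A) ⟨hA.injective, hs⟩
  have h1 : ∀ v, e.symm (A v) = v := fun v => e.symm_apply_apply v
  refine ⟨e.symm.toAffineMap, ?_, h1, fun v => e.apply_symm_apply v⟩
  have h2 : (e.symm.toAffineMap.comp A) = AffineMap.id ℝ (ℝ × ℝ) := by
    ext1 v
    exact h1 v
  have h3 := congrArg (fun B : (ℝ × ℝ) →ᵃ[ℝ] (ℝ × ℝ) => |LinearMap.det B.linear|) h2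
  simp only [AffineMap.comp_linear, LinearMap.det_comp, abs_mul, AffineMap.id_linear,
    LinearMap.det_id, abs_one] at h3
  unfold AreaFactor at hA ⊢
  rw [hA, mul_one] at h3
  exact h3

/-- The inverse of an injective PL map is PL: each affine piece that is active at the base point is
inverted, and its polyhedron is carried along. -/
theorem IsLeafShift.transition_symm (h : IsLeafShift g b (c x).2) (hc : ContinuousAt c x)
    (hc' : ∀ᶠ y in 𝓝 x, c' y = ((c y).1 + g (c y).2, b (c y).2)) : Transition c' c x := by
  have hc2 : ContinuousAt (fun y => (c y).2) x := hc.snd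
  have hbc : ContinuousAt b (c x).2 := h.area.continuousAt continuousAt_id
  obtain ⟨N, hN, hi⟩ := h.inj
  obtain ⟨κ, hκ, D, G, hD, -, hG⟩ := h.shift
  obtain ⟨ι, hι, C, A, hC, hA, hp⟩ := h.area
  simp only [id] at hG hp
  choose B hB hBA hAB using fun i => (hA i).exists_inverse
  constructor
  -- Only pieces active at `x` are kept. For these `B i (b ·)` stays close to `(c x).2`, hence
  -- inside the neighbourhood where `b` is injective; an inactive piece would give no such control.
  · refine ⟨{i // (c x).2 ∈ C i} × κ, inferInstance,
      fun p => B p.1 ⁻¹' (C p.1 ∩ D p.2), fun p => (-(G p.2).comp (B p.1)).prod (B p.1),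
      fun p => ((hC _).inter (hD _)).preimage _, fun p => ?_, ?_⟩
    · have : (LinearMap.snd ℝ ℝ (ℝ × ℝ)).toAffineMap.comp
        ((-(G p.2).comp (B p.1)).prod (B p.1)) = B p.1 := by ext v <;> rfl
      change AreaFactor 1 _
      rw [this]
      exact hB p.1
    · have hnear : ∀ᶠ v in 𝓝 (c x).2, v ∈ N ∧ ((∃ i, v ∈ C i) ∧ ∀ i, v ∈ C i → b v = A i v) ∧
          ((∃ i, v ∈ D i) ∧ ∀ i, v ∈ D i → g v = G i v) :=
        (eventually_mem_set.2 hN).and (hp.and hG)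
      have h1 : ∀ᶠ y in 𝓝 x, ∀ i, (c y).2 ∈ C i → (c x).2 ∈ C i := by
        rw [eventually_all]
        intro i
        by_cases hx : (c x).2 ∈ C i
        · exact .of_forall fun _ _ => hx
        · filter_upwards [hc2.eventually ((hC i).isClosed.isOpen_compl.mem_nhds hx)] with y hy hy'
          exact absurd hy' hy
      have h2 : ∀ᶠ y in 𝓝 x, ∀ i : {i // (c x).2 ∈ C i}, B i (b (c y).2) ∈
          {v | v ∈ N ∧ ((∃ i, v ∈ C i) ∧ ∀ i, v ∈ C i → b v = A i v) ∧
          ((∃ i, v ∈ D i) ∧ ∀ i, v ∈ D i → g v = G i v)} := by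
        rw [eventually_all]
        intro i
        have e : B i (b (c x).2) = (c x).2 := by
          rw [hp.self_of_nhds.2 i i.2, hBA]
        have hcont : ContinuousAt (fun y => B i (b (c y).2)) x :=
          ContinuousAt.comp (g := B i)
            (AffineMap.continuous_of_finiteDimensional (B i)).continuousAt
            (ContinuousAt.comp (g := b) hbc hc2)
        have := hcont.eventually (p := fun v => v ∈ N ∧ ((∃ i, v ∈ C i) ∧
          ∀ i, v ∈ C i → b v = A i v) ∧ ((∃ i, v ∈ D i) ∧ ∀ i, v ∈ D i → g v = G i v))
        refine this ?_
        simp only [e]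
        exact hnear
      filter_upwards [hc', h1, h2, hc2.eventually hnear] with y hy hy1 hy2 hy3
      rw [hy]
      simp only
      constructor
      · obtain ⟨i, hi'⟩ := hy3.2.1.1
        obtain ⟨k, hk⟩ := hy3.2.2.1
        refine ⟨(⟨i, hy1 i hi'⟩, k), ?_⟩
        rw [mem_preimage, hy3.2.1.2 i hi', hBA]
        exact ⟨hi', hk⟩
      · rintro ⟨i, k⟩ ⟨hi', hk⟩
        obtain ⟨hN', ⟨-, hC'⟩, -⟩ := hy2 i
        -- The point recovered through the piece `i` has the same image under `b` as the true one,
        -- so injectivity identifies them.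
        have e : B i (b (c y).2) = (c y).2 := by
          refine hi hN' hy3.1 ?_
          rw [hC' i hi', hAB]
        simp only [AffineMap.prod_apply, e]
        refine Prod.ext ?_ rfl
        change _ = -(G k (B i (b (c y).2)))
        simp only at hk
        rw [e] at hk ⊢
        rw [hy3.2.2.2 k hk]
        ring
  · refine ⟨_, hc', fun y hy z hz e => ?_⟩
    simp only [mem_ofPred_eq] at hy hz
    rw [hy, hz, e]

theorem FoliatedPLAt.trans {c c' c'' : X → Coord} {x : X} (h : FoliatedPLAt c c' x)
    (h' : FoliatedPLAt c' c'' x) : FoliatedPLAt c c'' x := by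
  obtain ⟨b, hb⟩ := h.transverse
  obtain ⟨b', hb'⟩ := h'.transverse
  obtain ⟨U, hU, ho⟩ := h.oriented
  obtain ⟨U', hU', ho'⟩ := h'.oriented
  refine ⟨?_, ⟨b' ∘ b, ?_⟩, ⟨_, inter_mem hb (inter_mem hU hU'), ?_⟩⟩
  · obtain ⟨n, C, A, hC, hA⟩ := h.pl
    obtain ⟨m, D, B, hD, hB⟩ := h'.pl
    have h1 : PL c c' x := ⟨Fin n, inferInstance, C, A, hC, fun _ => trivial, hA⟩
    have h2 : PL c' c'' x := ⟨Fin m, inferInstance, D, B, hD, fun _ => trivial, hB⟩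
    exact (h1.comp h2).plAt
  · filter_upwards [hb, hb'] with y e e'
    rw [e', e, Function.comp_apply]
  · rintro y ⟨hy, hy1, hy2⟩ z ⟨hz, hz1, hz2⟩ e hlt
    simp only [mem_ofPred_eq] at hy hz
    exact ho' y hy2 z hz2 (by rw [hy, hz, e]) (ho y hy1 z hz1 e hlt)

end Transition

end

section

/-! ### The piecewise-linear logarithm -/

/-- The function that is equal to the binary logarithm at the powers of two and affine between
consecutive ones. -/
def plog (y : ℝ) : ℝ := Int.log 2 y + (y / 2 ^ Int.log 2 y - 1)

/-- The inverse of `plog`. -/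
def pexp (u : ℝ) : ℝ := 2 ^ ⌊u⌋ * (1 + Int.fract u)

theorem two_zpow_pos (n : ℤ) : (0 : ℝ) < 2 ^ n := by positivity

theorem plog_eq {y : ℝ} {n : ℤ} (h : (2 : ℝ) ^ n ≤ y) (h' : y ≤ 2 ^ (n + 1)) :
    plog y = n + (y / 2 ^ n - 1) := by
  have hn := two_zpow_pos n
  rcases h'.lt_or_eq with h1 | h1
  · have : Int.log 2 y = n := by
      have hy : 0 < y := hn.trans_le h
      refine le_antisymm ?_ ?_
      · exact Int.lt_add_one_iff.1 ((Int.lt_zpow_iff_log_lt (by norm_num) hy).1 (by exact_mod_cast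
          h1))
      · exact (Int.zpow_le_iff_le_log (by norm_num) hy).1 (by exact_mod_cast h)
    rw [plog, this]
  · have : Int.log 2 y = n + 1 := by
      rw [h1]
      exact_mod_cast Int.log_zpow (R := ℝ) (b := 2) (by norm_num) (n + 1)
    rw [plog, this, h1, zpow_add_one₀ (by norm_num)]
    push_cast
    field_simp
    norm_num

theorem exists_zpow_bounds {y : ℝ} (hy : 0 < y) : ∃ n : ℤ, (2 : ℝ) ^ n ≤ y ∧ y < 2 ^ (n + 1) :=
  ⟨Int.log 2 y, by exact_mod_cast Int.zpow_log_le_self (b := 2) (by norm_num) hy,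
    by exact_mod_cast Int.lt_zpow_succ_log_self (b := 2) (by norm_num) y⟩

/-- Multiplication by a power of two moves breakpoints to breakpoints. This is all that remains of
the law of the logarithm, and it is why the return map and the widths use only powers of two. -/
theorem plog_zpow_mul (n : ℤ) {y : ℝ} (hy : 0 < y) : plog (2 ^ n * y) = plog y + n := by
  obtain ⟨m, h1, h2⟩ := exists_zpow_bounds hy
  have hn := two_zpow_pos n
  rw [plog_eq h1 h2.le, plog_eq (n := n + m) (y := 2 ^ n * y)]
  · rw [zpow_add₀ (by norm_num)]
    push_cast
    field_simp
    ring
  · rw [zpow_add₀ (by norm_num)]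
    gcongr
  · rw [add_assoc, zpow_add₀ (by norm_num)]
    gcongr

theorem plog_two_mul {y : ℝ} (hy : 0 < y) : plog (2 * y) = plog y + 1 := by
  simpa using plog_zpow_mul 1 hy

theorem plog_half {y : ℝ} (hy : 0 < y) : plog (y / 2) = plog y - 1 := by
  have := plog_two_mul (y := y / 2) (by positivity)
  rw [mul_div_cancel₀ y two_ne_zero] at this
  linarith

theorem pexp_pos (u : ℝ) : 0 < pexp u := by
  have := Int.fract_nonneg u
  unfold pexp
  positivity

theorem plog_pexp (u : ℝ) : plog (pexp u) = u := by
  have h0 := Int.fract_nonneg u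
  have h1 := (Int.fract_lt_one u).le
  have hn := two_zpow_pos ⌊u⌋
  rw [plog_eq (n := ⌊u⌋), pexp, mul_div_cancel_left₀ _ hn.ne']
  · have := Int.floor_add_fract u
    linarith
  · unfold pexp
    nlinarith
  · unfold pexp
    rw [zpow_add_one₀ (by norm_num)]
    nlinarith

theorem plog_strictMono {y y' : ℝ} (hy : 0 < y) (h : y < y') : plog y < plog y' := by
  obtain ⟨m, h1, h2⟩ := exists_zpow_bounds hy
  obtain ⟨n, h3, h4⟩ := exists_zpow_bounds (hy.trans h)
  have hm := two_zpow_pos m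
  have hn := two_zpow_pos n
  have hmn : m ≤ n := by
    have : (2 : ℝ) ^ m < 2 ^ (n + 1) := by linarith
    have := (zpow_lt_zpow_iff_right₀ (by norm_num : (1 : ℝ) < 2)).1 this
    omega
  rw [plog_eq h1 h2.le, plog_eq h3 h4.le]
  rcases hmn.eq_or_lt with rfl | hmn
  · gcongr
  · have h5 : y / 2 ^ m < 2 := by
      rw [div_lt_iff₀ hm]
      rw [zpow_add_one₀ (by norm_num)] at h2
      linarith
    have h6 : 1 ≤ y' / 2 ^ n := by rwa [one_le_div hn]
    have : (m : ℝ) + 1 ≤ n := by exact_mod_cast hmn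
    linarith

theorem plog_lt_iff {y y' : ℝ} (hy : 0 < y) (hy' : 0 < y') : plog y < plog y' ↔ y < y' := by
  refine ⟨fun h => ?_, plog_strictMono hy⟩
  by_contra hh
  rcases (not_lt.1 hh).lt_or_eq with h1 | h1
  · exact absurd (plog_strictMono hy' h1) h.not_gt
  · rw [h1] at h
    exact lt_irrefl _ h

theorem plog_le_iff {y y' : ℝ} (hy : 0 < y) (hy' : 0 < y') : plog y ≤ plog y' ↔ y ≤ y' := by
  rw [← not_lt, ← not_lt, plog_lt_iff hy' hy]

theorem plog_inj {y y' : ℝ} (hy : 0 < y) (hy' : 0 < y') (h : plog y = plog y') : y = y' :=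
  le_antisymm ((plog_le_iff hy hy').1 h.le) ((plog_le_iff hy' hy).1 h.ge)

theorem pexp_plog {y : ℝ} (hy : 0 < y) : pexp (plog y) = y :=
  plog_inj (pexp_pos _) hy (plog_pexp _)

theorem plog_zpow (n : ℤ) : plog (2 ^ n) = n := by
  rw [plog_eq le_rfl (by gcongr <;> norm_num), div_self (two_zpow_pos n).ne']
  ring

theorem pexp_add_int (u : ℝ) (n : ℤ) : pexp (u + n) = 2 ^ n * pexp u := by
  apply plog_inj (pexp_pos _) (mul_pos (two_zpow_pos n) (pexp_pos _))
  rw [plog_zpow_mul n (pexp_pos _), plog_pexp, plog_pexp]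

/-- The slope drops by half at `2 ^ n`, so near this breakpoint the function is concave and equals
the minimum of its two affine branches. The formula holds on both sides of the breakpoint, as local
piecewise linearity requires. -/
theorem plog_eq_min {y : ℝ} {n : ℤ} (h : (2 : ℝ) ^ (n - 1) ≤ y) (h' : y ≤ 2 ^ (n + 1)) :
    plog y = min ((n - 1) + (y / 2 ^ (n - 1) - 1)) (n + (y / 2 ^ n - 1)) := by
  have hn := two_zpow_pos n
  have e : (2 : ℝ) ^ (n - 1) = 2 ^ n / 2 := by rw [zpow_sub_one₀ (by norm_num)]; ring
  have e' : y / (2 ^ n / 2) = 2 * (y / 2 ^ n) := by field_simp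
  rcases le_total y (2 ^ n) with h1 | h1
  · rw [plog_eq h (by simpa using h1), min_eq_left]
    · push_cast
      ring
    · rw [e, e']
      have : y / 2 ^ n ≤ 1 := by rwa [div_le_one hn]
      linarith
  · rw [plog_eq h1 h', min_eq_right]
    rw [e, e']
    have : 1 ≤ y / 2 ^ n := by rwa [one_le_div hn]
    linarith

theorem pexp_eq {u : ℝ} {n : ℤ} (h : n ≤ u) (h' : u ≤ n + 1) : pexp u = 2 ^ n * (1 + (u - n)) := by
  have hn := two_zpow_pos n
  rcases h'.lt_or_eq with h1 | h1
  · have : ⌊u⌋ = n := Int.floor_eq_iff.2 ⟨h, h1⟩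
    rw [pexp, Int.fract, this]
  · have : ⌊u⌋ = n + 1 := by rw [h1]; exact_mod_cast Int.floor_intCast (n + 1)
    rw [pexp, Int.fract, this, h1, zpow_add_one₀ (by norm_num)]
    push_cast
    ring

/-- Dually to `plog_eq_min`, the slope doubles at `n`, so the function is convex there. -/
theorem pexp_eq_max {u : ℝ} {n : ℤ} (h : n - 1 ≤ u) (h' : u ≤ n + 1) :
    pexp u = max (2 ^ n * (1 + (u - n) / 2)) (2 ^ n * (1 + (u - n))) := by
  have hn := two_zpow_pos n
  rcases le_total u n with h1 | h1
  · rw [pexp_eq (n := n - 1) (by push_cast; linarith) (by push_cast; linarith), max_eq_left,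
      zpow_sub_one₀ (by norm_num)]
    · push_cast
      ring
    · gcongr
      linarith
  · rw [pexp_eq h1 h', max_eq_right]
    gcongr
    linarith

/-! ### Piecewise linearity of the logarithm and its inverse -/

section PL

variable {X E : Type*} [TopologicalSpace X] [AddCommGroup E] [Module ℝ E]

theorem PL.plog {c : X → E} {f : X → ℝ} {x : X} (h : PL c f x) (hf : ContinuousAt f x)
    (hx : 0 < f x) : PL c (fun y => plog (f y)) x := by
  obtain ⟨n, h1, h2⟩ := exists_zpow_bounds hx
  have h3 : (2 : ℝ) ^ (n - 1) < f x := lt_of_lt_of_le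
    ((zpow_lt_zpow_iff_right₀ (by norm_num)).2 (by omega)) h1
  refine ((((PL.const ((n : ℝ) - 1)).add ((h.mul ((2 : ℝ) ^ (n - 1))⁻¹).sub (PL.const 1))).min
    ((PL.const (n : ℝ)).add ((h.mul ((2 : ℝ) ^ n)⁻¹).sub (PL.const 1))))).congr ?_
  filter_upwards [hf.eventually_const_lt h3, hf.eventually_lt_const h2] with y hy hy'
  rw [plog_eq_min hy.le hy'.le, div_eq_inv_mul, div_eq_inv_mul]

theorem PL.pexp {c : X → E} {f : X → ℝ} {x : X} (h : PL c f x) (hf : ContinuousAt f x) :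
    PL c (fun y => pexp (f y)) x := by
  have h1 := Int.floor_le (f x)
  have h2 := Int.lt_floor_add_one (f x)
  set n := ⌊f x⌋
  have h3 : (n : ℝ) - 1 < f x := by linarith
  have h4 : PL c (fun y => f y - n) x := h.sub (PL.const _)
  refine ((((PL.const 1).add (h4.mul 2⁻¹)).mul (2 ^ n)).max
    (((PL.const 1).add h4).mul (2 ^ n))).congr ?_
  filter_upwards [hf.eventually_const_lt h3, hf.eventually_lt_const h2] with y hy hy'
  rw [pexp_eq_max hy.le hy'.le, div_eq_inv_mul]

end PL

theorem continuousAt_plog {y : ℝ} (hy : 0 < y) : ContinuousAt plog y :=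
  (PL.plog (c := id) (f := id) PL.refl continuousAt_id hy).continuousAt continuousAt_id

theorem continuous_pexp : Continuous pexp :=
  continuous_iff_continuousAt.2 fun _ =>
    (PL.pexp (c := id) (f := id) PL.refl continuousAt_id).continuousAt continuousAt_id

/-- The exponential of the piecewise-linear logarithm, extended by zero. -/
def eplog (y : ℝ) : ℝ := if 0 < y then Real.exp (plog y) else 0

theorem eplog_of_pos {y : ℝ} (hy : 0 < y) : eplog y = Real.exp (plog y) := if_pos hy

@[simp]
theorem eplog_zero : eplog 0 = 0 := by simp [eplog]

theorem eplog_nonneg (y : ℝ) : 0 ≤ eplog y := by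
  unfold eplog
  split_ifs <;> positivity

theorem eplog_pos {y : ℝ} (hy : 0 < y) : 0 < eplog y := by
  rw [eplog_of_pos hy]
  positivity

theorem eplog_pos_iff {y : ℝ} : 0 < eplog y ↔ 0 < y := by
  refine ⟨fun h => ?_, eplog_pos⟩
  by_contra hy
  rw [eplog, if_neg hy] at h
  exact lt_irrefl _ h

theorem eplog_zpow_mul (n : ℤ) (y : ℝ) : eplog (2 ^ n * y) = Real.exp n * eplog y := by
  have hn := two_zpow_pos n
  by_cases hy : 0 < y
  · rw [eplog_of_pos hy, eplog_of_pos (mul_pos hn hy), plog_zpow_mul n hy, Real.exp_add, mul_comm]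
  · rw [eplog, eplog, if_neg hy, if_neg (by rwa [mul_pos_iff_of_pos_left hn]), mul_zero]

theorem eplog_two_mul (y : ℝ) : eplog (2 * y) = Real.exp 1 * eplog y := by
  simpa using eplog_zpow_mul 1 y

theorem eplog_half (y : ℝ) : eplog (y / 2) = eplog y / Real.exp 1 := by
  have := eplog_two_mul (y / 2)
  rw [mul_div_cancel₀ y two_ne_zero] at this
  rw [this]
  field_simp

theorem eplog_strictMono {y y' : ℝ} (hy : 0 ≤ y) (h : y < y') : eplog y < eplog y' := by
  rcases hy.eq_or_lt with rfl | hy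
  · rw [eplog_zero]
    exact eplog_pos h
  · rw [eplog_of_pos hy, eplog_of_pos (hy.trans h)]
    exact Real.exp_lt_exp.2 (plog_strictMono hy h)

theorem eplog_inj {y y' : ℝ} (hy : 0 ≤ y) (hy' : 0 ≤ y') (h : eplog y = eplog y') : y = y' := by
  rcases lt_trichotomy y y' with h1 | h1 | h1
  · exact absurd h (eplog_strictMono hy h1).ne
  · exact h1
  · exact absurd h (eplog_strictMono hy' h1).ne'

theorem eplog_mono {y y' : ℝ} (hy : 0 ≤ y) (h : y ≤ y') : eplog y ≤ eplog y' := by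
  rcases h.eq_or_lt with rfl | h
  · exact le_rfl
  · exact (eplog_strictMono hy h).le

theorem exists_eplog_eq {r : ℝ} (hr : 0 ≤ r) : ∃ y, 0 ≤ y ∧ eplog y = r := by
  rcases hr.eq_or_lt with rfl | hr
  · exact ⟨0, le_rfl, eplog_zero⟩
  · refine ⟨pexp (Real.log r), (pexp_pos _).le, ?_⟩
    rw [eplog_of_pos (pexp_pos _), plog_pexp, Real.exp_log hr]

theorem continuous_eplog : Continuous eplog := by
  rw [continuous_iff_continuousAt]
  intro y
  rcases lt_or_ge 0 y with hy | hy
  · have : ContinuousAt (fun y => Real.exp (plog y)) y :=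
      Real.continuous_exp.continuousAt.comp (continuousAt_plog hy)
    refine this.congr ?_
    filter_upwards [lt_mem_nhds hy] with z hz
    rw [eplog_of_pos hz]
  · have h0 : eplog y = 0 := if_neg hy.not_gt
    rw [ContinuousAt, h0, tendsto_order]
    refine ⟨fun a ha => .of_forall fun z => ha.trans_le (eplog_nonneg z), fun a ha => ?_⟩
    -- Continuity at the origin follows from monotonicity together with the existence of arguments
    -- with arbitrarily small positive values.
    obtain ⟨b, hb, hab⟩ := exists_eplog_eq (half_pos ha).le
    have hb' : 0 < b := eplog_pos_iff.1 (by rw [hab]; positivity)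
    filter_upwards [gt_mem_nhds (hy.trans_lt hb')] with z hz
    rcases lt_or_ge 0 z with h | h
    · have := eplog_strictMono h.le hz
      linarith
    · rw [eplog, if_neg h.not_gt]
      exact ha

end

section

/-! ### Two hyperbolic quadrants glued to a plane

A point of the plane is described by two labels `A, B ≥ 0` and by the side of the vertical axis it
lies on. The first return along a closed leaf acts on each side by `(A, B) ↦ (A / 2, 2 B)`. -/

/-- The horizontal stretching of the right half-plane. -/
def width (i : Bool) : ℝ := if i then 2 else 1

theorem width_pos (i : Bool) : 0 < width i := by cases i <;> norm_num [width]

/-- The smaller one of the two labels. -/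
def labelMin (i : Bool) (x : ℝ) : ℝ := max (x / width i) (-x)

/-- The label that vanishes on the upper half of the axis. -/
def labelA (i : Bool) (q : ℝ × ℝ) : ℝ := labelMin i q.1 + max (-q.2) 0

/-- The label that vanishes on the lower half of the axis. -/
def labelB (i : Bool) (q : ℝ × ℝ) : ℝ := labelMin i q.1 + max q.2 0

/-- The point with labels `A` and `B`, on the right if `0 ≤ s` and on the left otherwise. -/
def ofLabels (i : Bool) (s A B : ℝ) : ℝ × ℝ :=
  (if 0 ≤ s then width i * min A B else -min A B, B - A)

theorem labelMin_of_nonneg {i : Bool} {x : ℝ} (hx : 0 ≤ x) : labelMin i x = x / width i :=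
  max_eq_left ((neg_nonpos.2 hx).trans (div_nonneg hx (width_pos i).le))

theorem labelMin_of_nonpos {i : Bool} {x : ℝ} (hx : x ≤ 0) : labelMin i x = -x :=
  max_eq_right ((div_nonpos_of_nonpos_of_nonneg hx (width_pos i).le).trans (neg_nonneg.2 hx))

theorem labelMin_nonneg (i : Bool) (x : ℝ) : 0 ≤ labelMin i x := by
  rcases le_total 0 x with h | h
  · rw [labelMin_of_nonneg h]
    exact div_nonneg h (width_pos i).le
  · rw [labelMin_of_nonpos h]
    linarith

theorem labelMin_eq_zero {i : Bool} {x : ℝ} : labelMin i x = 0 ↔ x = 0 := by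
  rcases le_total 0 x with h | h
  · rw [labelMin_of_nonneg h, div_eq_zero_iff]
    simp [(width_pos i).ne']
  · rw [labelMin_of_nonpos h, neg_eq_zero]

theorem labelA_nonneg (i : Bool) (q : ℝ × ℝ) : 0 ≤ labelA i q :=
  add_nonneg (labelMin_nonneg _ _) (le_max_right _ _)

theorem labelB_nonneg (i : Bool) (q : ℝ × ℝ) : 0 ≤ labelB i q :=
  add_nonneg (labelMin_nonneg _ _) (le_max_right _ _)

theorem min_labels (i : Bool) (q : ℝ × ℝ) : min (labelA i q) (labelB i q) = labelMin i q.1 := by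
  unfold labelA labelB
  rcases le_total 0 q.2 with h | h
  · rw [max_eq_right (neg_nonpos.2 h), max_eq_left h, min_eq_left] <;> linarith
  · rw [max_eq_left (neg_nonneg.2 h), max_eq_right h, min_eq_right] <;> linarith

theorem ofLabels_labels (i : Bool) (q : ℝ × ℝ) :
    ofLabels i q.1 (labelA i q) (labelB i q) = q := by
  refine Prod.ext ?_ ?_
  · rw [ofLabels, min_labels]
    split_ifs with h
    · rw [labelMin_of_nonneg h, mul_div_cancel₀ _ (width_pos i).ne']
    · rw [labelMin_of_nonpos (not_le.1 h).le, neg_neg]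
  · change labelMin _ _ + max q.2 0 - (labelMin _ _ + max (-q.2) 0) = q.2
    rcases le_total 0 q.2 with h | h
    · rw [max_eq_right (neg_nonpos.2 h), max_eq_left h]
      ring
    · rw [max_eq_left (neg_nonneg.2 h), max_eq_right h]
      ring

section ofLabels

variable {i : Bool} {s A B : ℝ}

theorem labelMin_ofLabels (hA : 0 ≤ A) (hB : 0 ≤ B) :
    labelMin i (ofLabels i s A B).1 = min A B := by
  have h := le_min hA hB
  have hw := width_pos i
  unfold ofLabels
  split_ifs
  · rw [labelMin_of_nonneg (by positivity), mul_div_cancel_left₀ _ hw.ne']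
  · rw [labelMin_of_nonpos (by simpa using h), neg_neg]

theorem labelA_ofLabels (hA : 0 ≤ A) (hB : 0 ≤ B) : labelA i (ofLabels i s A B) = A := by
  rw [labelA, labelMin_ofLabels hA hB]
  change min A B + max (-(B - A)) 0 = A
  rcases le_total A B with h | h
  · rw [min_eq_left h, max_eq_right (by linarith), add_zero]
  · rw [min_eq_right h, max_eq_left (by linarith)]
    ring

theorem labelB_ofLabels (hA : 0 ≤ A) (hB : 0 ≤ B) : labelB i (ofLabels i s A B) = B := by
  rw [labelB, labelMin_ofLabels hA hB]
  change min A B + max (B - A) 0 = B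
  rcases le_total A B with h | h
  · rw [min_eq_left h, max_eq_left (by linarith)]
    ring
  · rw [min_eq_right h, max_eq_right (by linarith), add_zero]

/-- A point with a vanishing label lies on the axis, where the two quadrants are glued, so its side
is irrelevant. -/
theorem ofLabels_congr_of_min (h : min A B = 0) (s s' : ℝ) :
    ofLabels i s A B = ofLabels i s' A B := by
  simp [ofLabels, h]

theorem ofLabels_congr {s' : ℝ} (h : 0 ≤ s ↔ 0 ≤ s') : ofLabels i s A B = ofLabels i s' A B := by
  simp [ofLabels, h]

/-- The side of a point off the axis. -/
theorem ofLabels_side (hA : 0 < A) (hB : 0 < B) : 0 ≤ (ofLabels i s A B).1 ↔ 0 ≤ s := by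
  have h := lt_min hA hB
  have hw := width_pos i
  unfold ofLabels
  split_ifs with hs
  · simp only [hs, iff_true]
    positivity
  · simp only [hs, iff_false, not_le]
    linarith

end ofLabels

theorem continuous_labelMin (i : Bool) : Continuous (labelMin i) := by
  unfold labelMin
  fun_prop

theorem continuous_labelA (i : Bool) : Continuous (labelA i) :=
  ((continuous_labelMin i).comp continuous_fst).add (by fun_prop)

theorem continuous_labelB (i : Bool) : Continuous (labelB i) :=
  ((continuous_labelMin i).comp continuous_fst).add (by fun_prop)

/-- The invariant of a leaf that vanishes on the axis. -/
def leafInv (i : Bool) (q : ℝ × ℝ) : ℝ :=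
  if 0 ≤ q.1 then eplog (labelA i q) * eplog (width i * labelB i q)
  else -(eplog (labelA i q) * eplog (labelB i q))

theorem labels_eq_zero_of_fst {i : Bool} {q : ℝ × ℝ} (h : q.1 = 0) :
    labelA i q = 0 ∨ labelB i q = 0 := by
  have := min_labels i q
  rw [h, labelMin_eq_zero.2 rfl] at this
  rcases min_choice (labelA i q) (labelB i q) with h' | h' <;> rw [h'] at this
  · exact .inl this
  · exact .inr this

theorem labels_pos_of_fst {i : Bool} {q : ℝ × ℝ} (h : q.1 ≠ 0) :
    0 < labelA i q ∧ 0 < labelB i q := by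
  rw [← lt_min_iff, min_labels]
  exact (labelMin_nonneg _ _).lt_of_ne (fun h' => h (labelMin_eq_zero.1 h'.symm))

theorem fst_eq_zero_iff {i : Bool} {q : ℝ × ℝ} : q.1 = 0 ↔ labelA i q = 0 ∨ labelB i q = 0 := by
  refine ⟨labels_eq_zero_of_fst, fun h => ?_⟩
  by_contra hq
  have := labels_pos_of_fst (i := i) hq
  rcases h with h | h
  · exact this.1.ne' h
  · exact this.2.ne' h

theorem leafInv_ofLabels {i : Bool} {s A B : ℝ} (hA : 0 ≤ A) (hB : 0 ≤ B) :
    leafInv i (ofLabels i s A B) =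
      if 0 ≤ s then eplog A * eplog (width i * B) else -(eplog A * eplog B) := by
  unfold leafInv
  rw [labelA_ofLabels hA hB, labelB_ofLabels hA hB]
  rcases hA.eq_or_lt with rfl | hA
  · simp
  rcases hB.eq_or_lt with rfl | hB
  · simp
  simp only [ofLabels_side hA hB]

theorem continuous_leafInv (i : Bool) : Continuous (leafInv i) := by
  refine Continuous.if_le ?_ ?_ continuous_const continuous_fst ?_
  · exact (continuous_eplog.comp (continuous_labelA i)).mul
      (continuous_eplog.comp (continuous_const.mul (continuous_labelB i)))
  · exact ((continuous_eplog.comp (continuous_labelA i)).mul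
      (continuous_eplog.comp (continuous_labelB i))).neg
  · intro q hq
    rcases labels_eq_zero_of_fst (i := i) hq.symm with h | h <;> simp [h]

theorem eplog_width_mul (i : Bool) (B : ℝ) :
    eplog (width i * B) = (if i then Real.exp 1 else 1) * eplog B := by
  cases i
  · simp [width]
  · simp [width, eplog_two_mul]

theorem one_le_widthFactor (i : Bool) : (1 : ℝ) ≤ if i then Real.exp 1 else 1 := by
  cases i <;> simp

theorem leafInv_eq_zero_iff {i : Bool} {q : ℝ × ℝ} : leafInv i q = 0 ↔ q.1 = 0 := by
  constructor
  · intro h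
    by_contra hq
    obtain ⟨hA, hB⟩ := labels_pos_of_fst (i := i) hq
    have h1 := eplog_pos hA
    have h2 := eplog_pos hB
    have h3 := eplog_pos (mul_pos (width_pos i) hB)
    unfold leafInv at h
    split_ifs at h
    · exact (mul_pos h1 h3).ne' h
    · exact (mul_pos h1 h2).ne' (neg_eq_zero.1 h)
  · intro h
    unfold leafInv
    rcases labels_eq_zero_of_fst (i := i) h with h | h <;> simp [h]

theorem leafInv_pos_iff {i : Bool} {q : ℝ × ℝ} : 0 < leafInv i q ↔ 0 < q.1 := by
  rcases lt_trichotomy q.1 0 with h | h | h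
  · have := mul_nonneg (eplog_nonneg (labelA i q)) (eplog_nonneg (labelB i q))
    rw [leafInv, if_neg h.not_ge]
    constructor <;> intro <;> linarith
  · rw [leafInv_eq_zero_iff.2 h, h]
  · have h1 : leafInv i q ≠ 0 := fun h' => h.ne' (leafInv_eq_zero_iff.1 h')
    have h2 := mul_nonneg (eplog_nonneg (labelA i q)) (eplog_nonneg (width i * labelB i q))
    rw [leafInv, if_pos h.le] at h1 ⊢
    exact ⟨fun _ => h, fun _ => h2.lt_of_ne h1.symm⟩

theorem eplog_mul_le_abs_leafInv (i : Bool) (q : ℝ × ℝ) :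
    eplog (labelA i q) * eplog (labelB i q) ≤ |leafInv i q| := by
  have h1 := eplog_nonneg (labelA i q)
  have h2 := eplog_nonneg (labelB i q)
  have h := mul_nonneg h1 h2
  unfold leafInv
  split_ifs
  · rw [eplog_width_mul]
    refine le_trans ?_ (le_abs_self _)
    have := one_le_widthFactor i
    calc _ = eplog (labelA i q) * (1 * eplog (labelB i q)) := by ring
      _ ≤ _ := by gcongr
  · rw [abs_neg, abs_of_nonneg h]

/-- The product of the extended exponentials of the labels is determined by the invariant. -/
theorem eplog_mul_eq (i : Bool) (q : ℝ × ℝ) :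
    eplog (labelA i q) * eplog (labelB i q) =
      max (leafInv i q / if i then Real.exp 1 else 1) (-leafInv i q) := by
  have h1 := eplog_nonneg (labelA i q)
  have h2 := eplog_nonneg (labelB i q)
  have h := mul_nonneg h1 h2
  have hK := one_le_widthFactor i
  unfold leafInv
  rw [eplog_width_mul]
  set K : ℝ := if i then Real.exp 1 else 1
  have hK' : 0 < K := by linarith
  by_cases hq : 0 ≤ q.1
  · rw [if_pos hq, max_eq_left]
    · field_simp
    · have := mul_nonneg h1 (mul_nonneg hK'.le h2)
      have := div_nonneg this hK'.le
      linarith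
  · rw [if_neg hq, neg_neg, max_eq_right]
    refine le_trans ?_ h
    exact div_nonpos_of_nonpos_of_nonneg (by linarith) (by linarith)

/-! ### The two pieces and their symmetries -/

/-- How far a point has moved on from the transverse boundary. -/
def nearEnd (i : Bool) (p : Coord) : ℝ := eplog (labelA i p.2) * Real.exp (-p.1)

/-- How close a point has come to the interface of the two pieces. -/
def nearMid (i : Bool) (p : Coord) : ℝ := eplog (labelB i p.2) * Real.exp (p.1 - 1)

/-- A piece of the plug, unrolled along its closed leaf. -/
def piece (i : Bool) : Set Coord :=
  {p | nearEnd i p ≤ 1 ∧ nearMid i p < Real.exp 1 ∧ |leafInv i p.2| ≤ 1}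

/-- The `n`-fold return map, in the plane. -/
def returnMap (i : Bool) (n : ℤ) (q : ℝ × ℝ) : ℝ × ℝ :=
  ofLabels i q.1 (labelA i q / 2 ^ n) (2 ^ n * labelB i q)

/-- The deck transformations of the unrolled piece. -/
def deck (i : Bool) (n : ℤ) (p : Coord) : Coord := (p.1 - n, returnMap i n p.2)

/-- The rescaling of the first label between the two pieces. -/
def sideScale (i : Bool) (s : ℝ) : ℝ := if 0 ≤ s then width i / width (!i) else 1

theorem sideScale_pos (i : Bool) (s : ℝ) : 0 < sideScale i s := by
  unfold sideScale
  split_ifs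
  · exact div_pos (width_pos _) (width_pos _)
  · norm_num

/-- The transverse part of the change between the two pieces. -/
def switchMap (i : Bool) (q : ℝ × ℝ) : ℝ × ℝ :=
  ofLabels (!i) q.1 (sideScale i q.1 * labelA i q) (labelB i q)

/-- The change between the two pieces. -/
def switch (i : Bool) (p : Coord) : Coord :=
  (2 - p.1 - 2 * plog (labelB i p.2), switchMap i p.2)

/-! ### Deck transformations and the switch: composition laws and invariants -/

section symmetries

variable {i : Bool} {n m : ℤ} {p : Coord} {q : ℝ × ℝ} {s A B : ℝ}

@[simp]
theorem labelA_returnMap : labelA i (returnMap i n q) = labelA i q / 2 ^ n :=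
  labelA_ofLabels (div_nonneg (labelA_nonneg _ _) (two_zpow_pos n).le)
    (mul_nonneg (two_zpow_pos n).le (labelB_nonneg _ _))

@[simp]
theorem labelB_returnMap : labelB i (returnMap i n q) = 2 ^ n * labelB i q :=
  labelB_ofLabels (div_nonneg (labelA_nonneg _ _) (two_zpow_pos n).le)
    (mul_nonneg (two_zpow_pos n).le (labelB_nonneg _ _))

@[simp]
theorem labelA_switchMap : labelA (!i) (switchMap i q) = sideScale i q.1 * labelA i q :=
  labelA_ofLabels (mul_nonneg (sideScale_pos _ _).le (labelA_nonneg _ _)) (labelB_nonneg _ _)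

@[simp]
theorem labelB_switchMap : labelB (!i) (switchMap i q) = labelB i q :=
  labelB_ofLabels (mul_nonneg (sideScale_pos _ _).le (labelA_nonneg _ _)) (labelB_nonneg _ _)

theorem min_smul_eq_zero {a b A B : ℝ} (h : A = 0 ∨ B = 0) (hA : 0 ≤ A) (hB : 0 ≤ B)
    (ha : 0 < a) (hb : 0 < b) : min (a * A) (b * B) = 0 := by
  rcases h with rfl | rfl
  · rw [mul_zero]
    exact min_eq_left (by positivity)
  · rw [mul_zero]
    exact min_eq_right (by positivity)

/-- Points are determined by their labels and, off the axis, their side. -/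
theorem eq_of_labels {j : Bool} {q q' : ℝ × ℝ} (hA : labelA j q = labelA j q')
    (hB : labelB j q = labelB j q') (hs : q.1 ≠ 0 → (0 ≤ q.1 ↔ 0 ≤ q'.1)) : q = q' := by
  rw [← ofLabels_labels j q, ← ofLabels_labels j q', hA, hB]
  by_cases h : q.1 = 0
  · apply ofLabels_congr_of_min
    rw [← hA, ← hB, min_labels, h, labelMin_eq_zero]
  · exact ofLabels_congr (hs h)

theorem returnMap_side (h : q.1 ≠ 0) : 0 ≤ (returnMap i n q).1 ↔ 0 ≤ q.1 := by
  have := labels_pos_of_fst (i := i) h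
  exact ofLabels_side (div_pos this.1 (two_zpow_pos n)) (mul_pos (two_zpow_pos n) this.2)

theorem switchMap_side (h : q.1 ≠ 0) : 0 ≤ (switchMap i q).1 ↔ 0 ≤ q.1 := by
  have := labels_pos_of_fst (i := i) h
  exact ofLabels_side (mul_pos (sideScale_pos _ _) this.1) this.2

theorem returnMap_fst_eq_zero : (returnMap i n q).1 = 0 ↔ q.1 = 0 := by
  rw [fst_eq_zero_iff (i := i), fst_eq_zero_iff (i := i), labelA_returnMap, labelB_returnMap,
    div_eq_zero_iff, mul_eq_zero]
  simp [(two_zpow_pos n).ne']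

theorem switchMap_fst_eq_zero : (switchMap i q).1 = 0 ↔ q.1 = 0 := by
  rw [fst_eq_zero_iff (i := !i), fst_eq_zero_iff (i := i), labelA_switchMap, labelB_switchMap,
    mul_eq_zero]
  simp [(sideScale_pos i q.1).ne']

theorem returnMap_zero : returnMap i 0 q = q := by
  unfold returnMap
  simpa using ofLabels_labels i q

theorem returnMap_add : returnMap i n (returnMap i m q) = returnMap i (n + m) q := by
  apply eq_of_labels (j := i)
  · simp only [labelA_returnMap]
    rw [zpow_add₀ (by norm_num), mul_comm, div_div]
  · simp only [labelB_returnMap]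
    rw [zpow_add₀ (by norm_num), mul_assoc]
  · intro h
    have h1 : q.1 ≠ 0 := by simpa [returnMap_fst_eq_zero] using h
    rw [returnMap_side (by simpa [returnMap_fst_eq_zero] using h1), returnMap_side h1,
      returnMap_side h1]

theorem deck_zero : deck i 0 p = p := by simp [deck, returnMap_zero]

theorem deck_add : deck i n (deck i m p) = deck i (n + m) p := by
  simp only [deck, returnMap_add, Prod.mk.injEq, and_true]
  push_cast
  ring

theorem switchMap_switchMap (hB : 0 < labelB i q) : switchMap (!i) (switchMap i q) = q := by
  have hi : (!(!i)) = i := Bool.not_not i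
  have key : labelA (!(!i)) (switchMap (!i) (switchMap i q)) = labelA (!(!i)) q := by
    rw [labelA_switchMap, labelA_switchMap, hi]
    by_cases hq : q.1 = 0
    · have : labelA i q = 0 := by
        rcases labels_eq_zero_of_fst (i := i) hq with h | h
        · exact h
        · exact absurd h hB.ne'
      rw [this, mul_zero, mul_zero]
    · unfold sideScale
      simp only [switchMap_side hq, hi]
      have h1 := (width_pos i).ne'
      have h2 := (width_pos (!i)).ne'
      split_ifs
      · field_simp
      · ring
  refine eq_of_labels (j := !(!i)) key ?_ ?_
  · rw [labelB_switchMap, labelB_switchMap, hi]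
  · intro h
    have h1 : q.1 ≠ 0 := by simpa [switchMap_fst_eq_zero] using h
    rw [switchMap_side (by simpa [switchMap_fst_eq_zero] using h1), switchMap_side h1]

theorem switch_switch (hB : 0 < labelB i p.2) : switch (!i) (switch i p) = p := by
  refine Prod.ext ?_ (switchMap_switchMap hB)
  simp only [switch, labelB_switchMap]
  ring

theorem switchMap_returnMap (hB : 0 < labelB i q) :
    switchMap i (returnMap i n q) = returnMap (!i) n (switchMap i q) := by
  apply eq_of_labels (j := !i)
  · simp only [labelA_switchMap, labelA_returnMap]
    by_cases hq : q.1 = 0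
    · have : labelA i q = 0 := by
        rcases labels_eq_zero_of_fst (i := i) hq with h | h
        · exact h
        · exact absurd h hB.ne'
      simp [this]
    · unfold sideScale
      simp only [returnMap_side hq]
      ring
  · simp only [labelB_switchMap, labelB_returnMap]
  · intro h
    have h1 : q.1 ≠ 0 := by simpa [switchMap_fst_eq_zero, returnMap_fst_eq_zero] using h
    rw [switchMap_side (by simpa [returnMap_fst_eq_zero] using h1), returnMap_side h1,
      returnMap_side (by simpa [switchMap_fst_eq_zero] using h1), switchMap_side h1]

theorem switch_deck (hB : 0 < labelB i p.2) :
    switch i (deck i n p) = deck (!i) n (switch i p) := by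
  refine Prod.ext ?_ (switchMap_returnMap hB)
  simp only [switch, deck, labelB_returnMap]
  rw [plog_zpow_mul n hB]
  ring

-- The factors `exp (-n)` and `exp n` acquired by the two labels cancel.
@[simp]
theorem leafInv_returnMap : leafInv i (returnMap i n q) = leafInv i q := by
  rw [returnMap, leafInv_ofLabels (div_nonneg (labelA_nonneg _ _) (two_zpow_pos n).le)
    (mul_nonneg (two_zpow_pos n).le (labelB_nonneg _ _)), leafInv]
  have h1 : labelA i q / 2 ^ n = 2 ^ (-n) * labelA i q := by
    rw [zpow_neg, div_eq_inv_mul]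
  have h2 : Real.exp ((-n : ℤ) : ℝ) * Real.exp n = 1 := by
    rw [← Real.exp_add]
    simp
  rw [h1, mul_left_comm (width i), eplog_zpow_mul, eplog_zpow_mul, eplog_zpow_mul]
  split_ifs
  · linear_combination (eplog (labelA i q) * eplog (width i * labelB i q)) * h2
  · linear_combination -(eplog (labelA i q) * eplog (labelB i q)) * h2

@[simp]
theorem nearEnd_deck : nearEnd i (deck i n p) = nearEnd i p := by
  simp only [nearEnd, deck, labelA_returnMap]
  have h1 : labelA i p.2 / 2 ^ n = 2 ^ (-n) * labelA i p.2 := by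
    rw [zpow_neg, div_eq_inv_mul]
  rw [h1, eplog_zpow_mul, mul_comm (Real.exp _) (eplog _), mul_assoc, ← Real.exp_add]
  congr 2
  push_cast
  ring

@[simp]
theorem nearMid_deck : nearMid i (deck i n p) = nearMid i p := by
  simp only [nearMid, deck, labelB_returnMap]
  rw [eplog_zpow_mul, mul_comm (Real.exp _) (eplog _), mul_assoc, ← Real.exp_add]
  congr 2
  ring

theorem deck_mem_piece : deck i n p ∈ piece i ↔ p ∈ piece i := by
  simp only [piece, mem_ofPred_eq, nearEnd_deck, nearMid_deck]
  simp [deck]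

/-- The widths are powers of two, so a width can be moved from one factor to the other at the cost
of the same power of `e`. This is why `leafInv` carries the width on the right side: the product
then agrees in both pieces. -/
theorem eplog_switch_right {A B : ℝ} :
    eplog (width i / width (!i) * A) * eplog (width (!i) * B) = eplog A * eplog (width i * B) := by
  cases i
  · have : width false / width (!false) * A = A / 2 := by simp [width]; ring
    rw [this, eplog_half]
    simp only [width, Bool.not_false, if_true, eplog_two_mul]
    simp
    field_simp
  · have : width true / width (!true) * A = 2 * A := by simp [width]
    rw [this, eplog_two_mul]
    simp only [width, Bool.not_true, if_true, eplog_two_mul]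
    simp
    ring

@[simp]
theorem leafInv_switchMap : leafInv (!i) (switchMap i q) = leafInv i q := by
  rw [switchMap, leafInv_ofLabels (mul_nonneg (sideScale_pos _ _).le (labelA_nonneg _ _))
    (labelB_nonneg _ _), leafInv]
  unfold sideScale
  split_ifs
  · exact eplog_switch_right
  · rw [one_mul]

/-- The new time `2 - t - 2 plog B` is the reflection of `t` in the interface time `1 - plog B`, so
the exponent `plog B + t - 1` changes sign. -/
theorem nearMid_switch (hB : 0 < labelB i p.2) : nearMid (!i) (switch i p) = (nearMid i p)⁻¹ := by
  simp only [nearMid, switch, labelB_switchMap]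
  rw [eplog_of_pos hB, ← Real.exp_add, ← Real.exp_add, ← Real.exp_neg]
  congr 1
  ring

theorem labelB_pos_of_nearMid (h : 0 < nearMid i p) : 0 < labelB i p.2 :=
  eplog_pos_iff.1 (pos_of_mul_pos_left h (Real.exp_pos _).le)

/-- The bound on `nearMid` gives `t + plog B < 2`. If the new first label is positive, its extended
exponential times that of `B` therefore strictly exceeds `nearEnd` after the switch, and this
product is at most `|leafInv| ≤ 1`. The overlap of the pieces thus stays away from the transverse
boundary of either one. -/
theorem nearEnd_switch_lt (hp : p ∈ piece i) (hB : 0 < labelB i p.2) :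
    nearEnd (!i) (switch i p) < 1 := by
  obtain ⟨h1, h2, h3⟩ := hp
  simp only [nearEnd, switch, labelA_switchMap]
  by_cases hA : labelA i p.2 = 0
  · simp [hA]
  have hA' := (labelA_nonneg i p.2).lt_of_ne' hA
  have hq : p.2.1 ≠ 0 := fun h => by
    rcases labels_eq_zero_of_fst (i := i) h with h | h
    · exact hA h
    · exact hB.ne' h
  rw [nearMid, eplog_of_pos hB, ← Real.exp_add, Real.exp_lt_exp] at h2
  unfold sideScale
  unfold leafInv at h3
  split_ifs at h3 ⊢
  · have h4 := mul_nonneg (eplog_nonneg (labelA i p.2)) (eplog_nonneg (width i * labelB i p.2))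
    rw [abs_of_nonneg h4, ← eplog_switch_right] at h3
    have h5 : eplog (labelB i p.2) ≤ eplog (width (!i) * labelB i p.2) := by
      rw [eplog_width_mul]
      have := one_le_widthFactor (!i)
      have := eplog_nonneg (labelB i p.2)
      nlinarith
    set a := eplog (width i / width (!i) * labelA i p.2)
    have ha : 0 ≤ a := eplog_nonneg _
    have h6 : a * eplog (labelB i p.2) ≤ 1 :=
      (mul_le_mul_of_nonneg_left h5 ha).trans h3
    rw [eplog_of_pos hB] at h6
    have h7 : Real.exp (-(2 - p.1 - 2 * plog (labelB i p.2))) < Real.exp (plog (labelB i p.2)) := by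
      rw [Real.exp_lt_exp]
      linarith
    have ha' : 0 < a := eplog_pos (mul_pos (div_pos (width_pos _) (width_pos _)) hA')
    exact (mul_lt_mul_of_pos_left h7 ha').trans_le h6
  · rw [abs_neg, abs_of_nonneg (mul_nonneg (eplog_nonneg _) (eplog_nonneg _)),
      eplog_of_pos hB] at h3
    rw [one_mul]
    have h7 : Real.exp (-(2 - p.1 - 2 * plog (labelB i p.2))) < Real.exp (plog (labelB i p.2)) := by
      rw [Real.exp_lt_exp]
      linarith
    exact (mul_lt_mul_of_pos_left h7 (eplog_pos hA')).trans_le h3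

theorem switch_mem_piece (hp : p ∈ piece i) (hm : Real.exp (-1) < nearMid i p) :
    switch i p ∈ piece (!i) := by
  have hB := labelB_pos_of_nearMid ((Real.exp_pos _).trans hm)
  refine ⟨(nearEnd_switch_lt hp hB).le, ?_, ?_⟩
  · rw [nearMid_switch hB, inv_lt_comm₀ ((Real.exp_pos _).trans hm) (Real.exp_pos _),
      ← Real.exp_neg]
    exact hm
  · simp only [switch, leafInv_switchMap]
    exact hp.2.2

theorem nearMid_switch_gt (hp : p ∈ piece i) (hm : Real.exp (-1) < nearMid i p) :
    Real.exp (-1) < nearMid (!i) (switch i p) := by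
  have hB := labelB_pos_of_nearMid ((Real.exp_pos _).trans hm)
  rw [nearMid_switch hB, Real.exp_neg]
  exact inv_strictAnti₀ ((Real.exp_pos _).trans hm) hp.2.1

end symmetries

end

section

/-! ### The support as a quotient of the two pieces -/

/-- The support of the plug. -/
abbrev Support : Type := UnitAddCircle × (Icc (-1 : ℝ) 1 × Icc (-1 : ℝ) 1)

/-- The relative position of a point between the end and the interface of its piece. -/
def position (i : Bool) (p : Coord) : ℝ :=
  (nearMid i p - nearEnd i p) / (1 - nearEnd i p * nearMid i p)

/-- The part of a piece before the interface. -/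
def halfPiece (i : Bool) : Set Coord :=
  {p | nearEnd i p ≤ 1 ∧ nearMid i p ≤ 1 ∧ |leafInv i p.2| ≤ 1}

/-- The height in the support of a point before the interface. -/
def level (i : Bool) (p : Coord) : ℝ := if i then (1 - position i p) / 2 else (position i p - 1) / 2

/-- The point of the support that corresponds to a point before the interface. -/
def halfMap (i : Bool) (p : Coord) : Support :=
  ((p.1 : UnitAddCircle), (projIcc (-1) 1 (by norm_num) (leafInv i p.2),
    projIcc (-1) 1 (by norm_num) (level i p)))

/-- The map from an unrolled piece to the support. -/
def pieceMap (i : Bool) (p : Coord) : Support :=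
  if nearMid i p ≤ 1 then halfMap i p else halfMap (!i) (switch i p)

variable {i : Bool} {n : ℤ} {p p' : Coord}

theorem nearEnd_nonneg (i : Bool) (p : Coord) : 0 ≤ nearEnd i p :=
  mul_nonneg (eplog_nonneg _) (Real.exp_pos _).le

theorem nearMid_nonneg (i : Bool) (p : Coord) : 0 ≤ nearMid i p :=
  mul_nonneg (eplog_nonneg _) (Real.exp_pos _).le

/-- The time cancels, so the product is constant along each leaf line. By `eplog_mul_eq` it is even
a function of `leafInv`. -/
theorem nearEnd_mul_nearMid (i : Bool) (p : Coord) :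
    nearEnd i p * nearMid i p =
      eplog (labelA i p.2) * eplog (labelB i p.2) * Real.exp (-1) := by
  have : Real.exp (-p.1) * Real.exp (p.1 - 1) = Real.exp (-1) := by
    rw [← Real.exp_add]
    congr 1
    ring
  simp only [nearEnd, nearMid]
  linear_combination eplog (labelA i p.2) * eplog (labelB i p.2) * this

theorem nearEnd_mul_nearMid_lt (h : |leafInv i p.2| ≤ 1) : nearEnd i p * nearMid i p < 1 := by
  rw [nearEnd_mul_nearMid]
  have h1 := (eplog_mul_le_abs_leafInv i p.2).trans h
  have h2 : Real.exp (-1) < 1 := by simp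
  have h3 := Real.exp_pos (-1)
  nlinarith

theorem halfPiece_subset : halfPiece i ⊆ piece i := fun _ h =>
  ⟨h.1, h.2.1.trans_lt (by simp), h.2.2⟩

/-- With `E = nearEnd` and `M = nearMid`, one has `(1 - E M) + (M - E) = (1 - E) (1 + M)` and `(1 -
E M) - (M - E) = (1 - M) (1 + E)`. These factorisations give the bounds and the two equality cases.
-/
theorem position_mem (hp : p ∈ halfPiece i) : position i p ∈ Icc (-1 : ℝ) 1 := by
  obtain ⟨h1, h2, h3⟩ := hp
  have h4 := nearEnd_mul_nearMid_lt h3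
  have h5 := nearEnd_nonneg i p
  have h6 := nearMid_nonneg i p
  unfold position
  constructor
  · rw [le_div_iff₀ (by linarith)]
    nlinarith
  · rw [div_le_one (by linarith)]
    nlinarith

theorem position_eq_neg_one_iff (hp : p ∈ halfPiece i) : position i p = -1 ↔ nearEnd i p = 1 := by
  obtain ⟨h1, h2, h3⟩ := hp
  have h4 := nearEnd_mul_nearMid_lt h3
  have h6 := nearMid_nonneg i p
  rw [position, div_eq_iff (by linarith)]
  constructor
  · intro h
    have : (1 - nearEnd i p) * (1 + nearMid i p) = 0 := by linarith
    rcases mul_eq_zero.1 this with h | h <;> linarith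
  · intro h
    rw [h]
    ring

theorem position_eq_one_iff (hp : p ∈ halfPiece i) : position i p = 1 ↔ nearMid i p = 1 := by
  obtain ⟨h1, h2, h3⟩ := hp
  have h4 := nearEnd_mul_nearMid_lt h3
  have h6 := nearEnd_nonneg i p
  rw [position, div_eq_iff (by linarith)]
  constructor
  · intro h
    have : (1 - nearMid i p) * (1 + nearEnd i p) = 0 := by linarith
    rcases mul_eq_zero.1 this with h | h <;> linarith
  · intro h
    rw [h]
    ring

theorem level_mem (hp : p ∈ halfPiece i) : level i p ∈ Icc (-1 : ℝ) 1 := by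
  have h := position_mem hp
  unfold level
  split_ifs <;> constructor <;> linarith [h.1, h.2]

theorem coe_halfMap_inv (hp : |leafInv i p.2| ≤ 1) :
    ((halfMap i p).2.1 : ℝ) = leafInv i p.2 := by
  have := projIcc_of_mem (a := (-1 : ℝ)) (b := 1) (by norm_num) (abs_le.1 hp)
  simp only [halfMap]
  rw [this]

theorem coe_halfMap_level (hp : p ∈ halfPiece i) : ((halfMap i p).2.2 : ℝ) = level i p := by
  simp only [halfMap]
  rw [projIcc_of_mem _ (level_mem hp)]

theorem switch_mem_halfPiece (hp : p ∈ piece i) (h : 1 ≤ nearMid i p) :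
    switch i p ∈ halfPiece (!i) := by
  have h' : Real.exp (-1) < nearMid i p := lt_of_lt_of_le (by simp) h
  have h1 := switch_mem_piece hp h'
  refine ⟨h1.1, ?_, h1.2.2⟩
  rw [nearMid_switch (labelB_pos_of_nearMid (by linarith))]
  exact inv_le_one_of_one_le₀ h

theorem coe_pieceMap_inv (hp : p ∈ piece i) : ((pieceMap i p).2.1 : ℝ) = leafInv i p.2 := by
  unfold pieceMap
  split_ifs
  · exact coe_halfMap_inv hp.2.2
  · rw [coe_halfMap_inv] <;> simp only [switch, leafInv_switchMap]
    exact hp.2.2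

/-- Two points before the interface are identified only by deck transformations. -/
theorem exists_deck_of_halfMap_eq (hp : p ∈ halfPiece i) (hp' : p' ∈ halfPiece i)
    (h : halfMap i p = halfMap i p') : ∃ n : ℤ, p' = deck i n p := by
  have hinv : leafInv i p.2 = leafInv i p'.2 := by
    rw [← coe_halfMap_inv hp.2.2, ← coe_halfMap_inv hp'.2.2, h]
  have hlev : level i p = level i p' := by
    rw [← coe_halfMap_level hp, ← coe_halfMap_level hp', h]
  have hpos : position i p = position i p' := by
    unfold level at hlev
    split_ifs at hlev <;> linarith
  have ht : ((p.1 : ℝ) : UnitAddCircle) = (p'.1 : ℝ) := congrArg Prod.fst h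
  obtain ⟨n, hn⟩ : ∃ n : ℤ, p'.1 = p.1 - n := by
    have h0 : ((p.1 - p'.1 : ℝ) : UnitAddCircle) = 0 := by
      rw [AddCircle.coe_sub, ht, sub_self]
    obtain ⟨n, hn⟩ := (AddCircle.coe_eq_zero_iff (1 : ℝ)).1 h0
    refine ⟨n, ?_⟩
    simp only [zsmul_eq_mul, mul_one] at hn
    linarith
  -- The invariant fixes the product of `nearEnd` and `nearMid`, and the position then fixes their
  -- difference. Two nonnegative numbers are determined by these data.
  have hprod : eplog (labelA i p.2) * eplog (labelB i p.2) =
      eplog (labelA i p'.2) * eplog (labelB i p'.2) := by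
    rw [eplog_mul_eq, eplog_mul_eq, hinv]
  have hmul : nearEnd i p * nearMid i p = nearEnd i p' * nearMid i p' := by
    rw [nearEnd_mul_nearMid, nearEnd_mul_nearMid, hprod]
  have hlt := nearEnd_mul_nearMid_lt hp.2.2
  have hlt' := nearEnd_mul_nearMid_lt hp'.2.2
  have hsub : nearMid i p - nearEnd i p = nearMid i p' - nearEnd i p' := by
    unfold position at hpos
    rw [hmul] at hpos
    exact (div_left_inj' (by linarith)).1 hpos
  have hE := nearEnd_nonneg i p
  have hE' := nearEnd_nonneg i p'
  have hM := nearMid_nonneg i p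
  have hM' := nearMid_nonneg i p'
  have hend : nearEnd i p = nearEnd i p' := by
    have h1 : (nearEnd i p - nearEnd i p') * (nearEnd i p + nearMid i p') = 0 := by
      linear_combination hmul + (- nearEnd i p) * hsub
    rcases mul_eq_zero.1 h1 with h | h
    · linarith
    · have h2 : nearEnd i p = 0 := by linarith
      have h3 : nearMid i p' = 0 := by linarith
      linarith
  have hmid : nearMid i p = nearMid i p' := by linarith
  have hA : labelA i (returnMap i n p.2) = labelA i p'.2 := by
    apply eplog_inj (labelA_nonneg _ _) (labelA_nonneg _ _)
    have h1 := nearEnd_deck (i := i) (n := n) (p := p)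
    rw [hend] at h1
    simp only [nearEnd, deck, ← hn] at h1
    exact mul_right_cancel₀ (Real.exp_pos _).ne' h1
  have hB : labelB i (returnMap i n p.2) = labelB i p'.2 := by
    apply eplog_inj (labelB_nonneg _ _) (labelB_nonneg _ _)
    have h1 := nearMid_deck (i := i) (n := n) (p := p)
    rw [hmid] at h1
    simp only [nearMid, deck, ← hn] at h1
    exact mul_right_cancel₀ (Real.exp_pos _).ne' h1
  refine ⟨n, Prod.ext hn (eq_of_labels hA hB fun hq => ?_).symm⟩
  have hq1 : p.2.1 ≠ 0 := by simpa [returnMap_fst_eq_zero] using hq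
  have hq2 : p'.2.1 ≠ 0 := by
    -- The labels leave only the side open, and the sign of `leafInv` records the side.
    rwa [Ne, ← leafInv_eq_zero_iff (i := i), ← hinv, leafInv_eq_zero_iff]
  rw [returnMap_side hq1, le_iff_lt_or_eq, le_iff_lt_or_eq, ← leafInv_pos_iff (i := i), hinv,
    leafInv_pos_iff]
  simp [hq1.symm, hq2.symm]

theorem halfMap_deck : halfMap i (deck i n p) = halfMap i p := by
  have h1 : level i (deck i n p) = level i p := by
    simp only [level, position, nearEnd_deck, nearMid_deck]
  have h2 : leafInv i (deck i n p).2 = leafInv i p.2 := leafInv_returnMap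
  unfold halfMap
  rw [h1, h2]
  congr 1
  simp only [deck, AddCircle.coe_sub]
  have : ((n : ℝ) : UnitAddCircle) = 0 := by
    rw [AddCircle.coe_eq_zero_iff]
    exact ⟨n, by simp⟩
  rw [this, sub_zero]

theorem level_eq_zero (hp : p ∈ halfPiece i) (h : nearMid i p = 1) : level i p = 0 := by
  have := (position_eq_one_iff hp).2 h
  unfold level
  rw [this]
  simp

/-- On the interface both pieces give the same point. -/
theorem halfMap_switch (hp : p ∈ halfPiece i) (h : nearMid i p = 1) :
    halfMap (!i) (switch i p) = halfMap i p := by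
  have hB : 0 < labelB i p.2 := labelB_pos_of_nearMid (by rw [h]; norm_num)
  have h1 := switch_mem_halfPiece (halfPiece_subset hp) h.ge
  have h2 : nearMid (!i) (switch i p) = 1 := by rw [nearMid_switch hB, h, inv_one]
  have h3 : (switch i p).1 = p.1 := by
    have := h
    rw [nearMid, eplog_of_pos hB, ← Real.exp_add, Real.exp_eq_one_iff] at this
    simp only [switch]
    linarith
  unfold halfMap
  rw [level_eq_zero hp h, level_eq_zero h1 h2, h3]
  simp only [switch, leafInv_switchMap]

theorem level_nonpos (hp : p ∈ halfPiece false) : level false p ≤ 0 := by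
  have := (position_mem hp).2
  simp [level]
  linarith

theorem level_nonneg (hp : p ∈ halfPiece true) : 0 ≤ level true p := by
  have := (position_mem hp).2
  simp [level]
  linarith

theorem nearMid_eq_one_of_level (hp : p ∈ halfPiece i) (h : level i p = 0) : nearMid i p = 1 := by
  rw [← position_eq_one_iff hp]
  unfold level at h
  split_ifs at h <;> linarith

/-- The entry half occupies the levels `≤ 0` and the exit half the levels `≥ 0`, so a common point
lies at level 0, which is the interface. -/
theorem nearMid_eq_one_of_halfMap_eq (hp : p ∈ halfPiece i) (hp' : p' ∈ halfPiece (!i))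
    (h : halfMap i p = halfMap (!i) p') : nearMid i p = 1 ∧ nearMid (!i) p' = 1 := by
  have h1 : level i p = level (!i) p' := by
    rw [← coe_halfMap_level hp, ← coe_halfMap_level hp', h]
  have h2 : level i p = 0 := by
    cases i
    · exact le_antisymm (level_nonpos hp) (h1 ▸ level_nonneg hp')
    · exact le_antisymm (h1 ▸ level_nonpos hp') (level_nonneg hp)
  exact ⟨nearMid_eq_one_of_level hp h2, nearMid_eq_one_of_level hp' (h1 ▸ h2)⟩

theorem mem_halfPiece (hp : p ∈ piece i) (h : nearMid i p ≤ 1) : p ∈ halfPiece i :=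
  ⟨hp.1, h, hp.2.2⟩

theorem pieceMap_of_le (h : nearMid i p ≤ 1) : pieceMap i p = halfMap i p := if_pos h

theorem pieceMap_of_ge (hp : p ∈ piece i) (h : 1 ≤ nearMid i p) :
    pieceMap i p = halfMap (!i) (switch i p) := by
  rcases h.eq_or_lt with h | h
  · rw [pieceMap_of_le h.symm.le, halfMap_switch (mem_halfPiece hp h.symm.le) h.symm]
  · exact if_neg h.not_ge

theorem pieceMap_deck : pieceMap i (deck i n p) = pieceMap i p := by
  unfold pieceMap
  rw [nearMid_deck]
  split_ifs with h
  · exact halfMap_deck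
  · rw [switch_deck (labelB_pos_of_nearMid (by linarith)), halfMap_deck]

theorem pieceMap_switch (hp : p ∈ piece i) (h : Real.exp (-1) < nearMid i p) :
    pieceMap (!i) (switch i p) = pieceMap i p := by
  have hM := (Real.exp_pos _).trans h
  have hB := labelB_pos_of_nearMid hM
  have h1 := switch_mem_piece hp h
  rcases le_total (nearMid i p) 1 with h' | h'
  · have h2 : 1 ≤ nearMid (!i) (switch i p) := by
      rw [nearMid_switch hB]
      exact (one_le_inv₀ hM).2 h'
    have hi : (!(!i)) = i := Bool.not_not i
    rw [pieceMap_of_le h', pieceMap_of_ge h1 h2, switch_switch hB, hi]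
  · have h2 : nearMid (!i) (switch i p) ≤ 1 := by
      rw [nearMid_switch hB]
      exact inv_le_one_of_one_le₀ h'
    rw [pieceMap_of_ge hp h', pieceMap_of_le h2]

/-- A point past the interface is first replaced by its switch, which reduces everything to the
halves. Together with `deck_of_pieceMap_eq` this says that the support identifies points of the
pieces only through deck transformations and the switch. -/
theorem deck_switch_of_halfMap_eq (hp : p ∈ piece i) (hp' : p' ∈ piece (!i))
    (h : pieceMap i p = pieceMap (!i) p') :
    Real.exp (-1) < nearMid i p ∧ ∃ n : ℤ, p' = deck (!i) n (switch i p) := by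
  have hi : (!(!i)) = i := Bool.not_not i
  have he : Real.exp (-1) < 1 := by simp
  rcases le_total (nearMid i p) 1 with h1 | h1 <;> rcases le_total (nearMid (!i) p') 1 with h2 | h2
  · have g1 := mem_halfPiece hp h1
    have g2 := mem_halfPiece hp' h2
    rw [pieceMap_of_le h1, pieceMap_of_le h2] at h
    have h3 := nearMid_eq_one_of_halfMap_eq g1 g2 h
    refine ⟨by rw [h3.1]; exact he, ?_⟩
    rw [← halfMap_switch g1 h3.1] at h
    exact exists_deck_of_halfMap_eq (switch_mem_halfPiece hp h3.1.ge) g2 h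
  · have g1 := mem_halfPiece hp h1
    have g2 := switch_mem_halfPiece hp' h2
    rw [pieceMap_of_le h1, pieceMap_of_ge hp' h2] at h
    rw [hi] at g2 h
    obtain ⟨n, hn⟩ := exists_deck_of_halfMap_eq g1 g2 h
    have hB' : 0 < labelB (!i) p'.2 := labelB_pos_of_nearMid (by linarith)
    have hm : Real.exp (-1) < nearMid i p := by
      have h3 := nearMid_switch_gt hp' (he.trans_le h2)
      have h4 := nearMid_deck (i := i) (n := n) (p := p)
      rw [hi] at h3
      rw [← h4, ← hn]
      exact h3
    refine ⟨hm, n, ?_⟩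
    have hB := labelB_pos_of_nearMid ((Real.exp_pos _).trans hm)
    rw [← switch_deck hB, ← hn]
    have := switch_switch hB'
    rw [hi] at this
    exact this.symm
  · have g2 := mem_halfPiece hp' h2
    rw [pieceMap_of_ge hp h1, pieceMap_of_le h2] at h
    exact ⟨he.trans_le h1, exists_deck_of_halfMap_eq (switch_mem_halfPiece hp h1) g2 h⟩
  · have g1 := switch_mem_halfPiece hp h1
    have g2 := switch_mem_halfPiece hp' h2
    rw [pieceMap_of_ge hp h1, pieceMap_of_ge hp' h2] at h
    have h3 := nearMid_eq_one_of_halfMap_eq g1 g2 h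
    have hB : 0 < labelB i p.2 := labelB_pos_of_nearMid (by linarith)
    have h4 := h3.1
    rw [nearMid_switch hB, inv_eq_one] at h4
    have hB' : 0 < labelB (!i) p'.2 := labelB_pos_of_nearMid (by linarith)
    have h5 := h3.2
    rw [nearMid_switch hB', inv_eq_one] at h5
    refine ⟨he.trans_le h1, ?_⟩
    rw [halfMap_switch (mem_halfPiece hp' h5.le) h5] at h
    exact exists_deck_of_halfMap_eq g1 (mem_halfPiece hp' h5.le) h

theorem deck_of_pieceMap_eq (hp : p ∈ piece i) (hp' : p' ∈ piece i)
    (h : pieceMap i p = pieceMap i p') : ∃ n : ℤ, p' = deck i n p := by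
  rcases le_total (nearMid i p) 1 with h1 | h1
  · rcases le_total (nearMid i p') 1 with h2 | h2
    · rw [pieceMap_of_le h1, pieceMap_of_le h2] at h
      exact exists_deck_of_halfMap_eq (mem_halfPiece hp h1) (mem_halfPiece hp' h2) h
    · have hm : Real.exp (-1) < nearMid i p' := lt_of_lt_of_le (by simp) h2
      have hB' := labelB_pos_of_nearMid ((Real.exp_pos _).trans hm)
      rw [← pieceMap_switch hp' hm] at h
      obtain ⟨hm1, n, hn⟩ := deck_switch_of_halfMap_eq hp (switch_mem_piece hp' hm) h
      have hB := labelB_pos_of_nearMid ((Real.exp_pos _).trans hm1)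
      refine ⟨n, ?_⟩
      rw [← switch_switch hB', hn, ← switch_deck hB, switch_switch]
      simp only [deck, labelB_returnMap]
      exact mul_pos (two_zpow_pos n) hB
  · have hm : Real.exp (-1) < nearMid i p := lt_of_lt_of_le (by simp) h1
    have hB := labelB_pos_of_nearMid ((Real.exp_pos _).trans hm)
    have hi : (!(!i)) = i := Bool.not_not i
    have h' : pieceMap (!i) (switch i p) = pieceMap (!(!i)) p' := by
      rw [pieceMap_switch hp hm, hi, h]
    obtain ⟨-, n, hn⟩ := deck_switch_of_halfMap_eq (switch_mem_piece hp hm) (by rwa [hi]) h'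
    rw [hi] at hn
    have := switch_switch hB
    exact ⟨n, by rw [hn, this]⟩

/-- At a given time, `nearEnd` and `nearMid` determine the labels because `eplog` maps `[0, ∞)` onto
itself. The hypothesis on the product is the one constraint that ties them to `leafInv`. -/
theorem exists_labels (i : Bool) {t α β x : ℝ} (hα : 0 ≤ α) (hβ : 0 ≤ β)
    (h : α * β = max (x / if i then Real.exp 1 else 1) (-x) * Real.exp (-1)) :
    ∃ p : Coord, p.1 = t ∧ nearEnd i p = α ∧ nearMid i p = β ∧ leafInv i p.2 = x := by
  obtain ⟨A, hA, hA'⟩ := exists_eplog_eq (mul_nonneg hα (Real.exp_pos t).le)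
  obtain ⟨B, hB, hB'⟩ := exists_eplog_eq (mul_nonneg hβ (Real.exp_pos (1 - t)).le)
  have e1 : Real.exp t * Real.exp (-t) = 1 := by rw [← Real.exp_add]; simp
  have e2 : Real.exp (1 - t) * Real.exp (t - 1) = 1 := by rw [← Real.exp_add]; simp
  have e3 : Real.exp t * Real.exp (1 - t) * Real.exp (-1) = 1 := by
    rw [← Real.exp_add, ← Real.exp_add]
    simp
  refine ⟨(t, ofLabels i x A B), rfl, ?_, ?_, ?_⟩
  · simp only [nearEnd]
    rw [labelA_ofLabels hA hB, hA', mul_assoc, e1, mul_one]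
  · simp only [nearMid]
    rw [labelB_ofLabels hA hB, hB', mul_assoc, e2, mul_one]
  · rw [leafInv_ofLabels hA hB, eplog_width_mul, hA', hB']
    have hK := one_le_widthFactor i
    set K : ℝ := if i then Real.exp 1 else 1
    have hK' : 0 < K := by linarith
    have e4 : α * Real.exp t * (β * Real.exp (1 - t)) = max (x / K) (-x) := by
      have h0 := Real.exp_pos (-1)
      apply mul_right_cancel₀ h0.ne'
      rw [← h]
      linear_combination α * β * e3
    split_ifs with hx
    · rw [max_eq_left] at e4
      · rw [eq_div_iff hK'.ne'] at e4
        linarith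
      · have := div_nonneg hx hK'.le
        linarith
    · rw [max_eq_right] at e4
      · linarith
      · have := div_nonpos_of_nonpos_of_nonneg (not_le.1 hx).le hK'.le
        linarith

/-- Every point of the support comes from a point before the interface of one of the pieces. -/
theorem exists_halfMap_eq (P : Support) :
    ∃ (i : Bool) (p : Coord), p ∈ halfPiece i ∧ p.1 ∈ Icc (0 : ℝ) 1 ∧ halfMap i p = P := by
  obtain ⟨θ, ⟨x, hx⟩, ⟨y, hy⟩⟩ := P
  obtain ⟨t, ht, rfl⟩ : ∃ t ∈ Icc (0 : ℝ) 1, (t : UnitAddCircle) = θ := by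
    have := AddCircle.coe_image_Icc_eq (p := (1 : ℝ)) 0
    rw [zero_add] at this
    have h : θ ∈ ((↑) : ℝ → UnitAddCircle) '' Icc 0 1 := this ▸ mem_univ θ
    exact h
  obtain ⟨i, z, hz, hlev⟩ : ∃ (i : Bool) (z : ℝ), z ∈ Icc (-1 : ℝ) 1 ∧
      y = if i then (1 - z) / 2 else (z - 1) / 2 := by
    rcases le_total y 0 with h | h
    · exact ⟨false, 2 * y + 1, ⟨by linarith [hy.1], by linarith⟩, by simp⟩
    · exact ⟨true, 1 - 2 * y, ⟨by linarith [hy.2], by linarith⟩, by simp⟩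
  have hK := one_le_widthFactor i
  -- `ξ` is the product of `nearEnd` and `nearMid` forced by the invariant `x`.
  obtain ⟨ξ, hξ, hξ0, hξ1⟩ : ∃ ξ, ξ = max (x / if i then Real.exp 1 else 1) (-x) * Real.exp (-1) ∧
      0 ≤ ξ ∧ ξ < 1 := by
    refine ⟨_, rfl, ?_, ?_⟩
    · refine mul_nonneg ?_ (Real.exp_pos _).le
      rcases le_total 0 x with h | h
      · exact le_max_of_le_left (div_nonneg h (by linarith))
      · exact le_max_of_le_right (by linarith)
    · have h1 : max (x / if i then Real.exp 1 else 1) (-x) ≤ 1 := by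
        refine max_le ?_ (by linarith [hx.1])
        rw [div_le_one (by linarith)]
        linarith [hx.2]
      have h2 : Real.exp (-1) < 1 := by simp
      have h3 := Real.exp_pos (-1)
      nlinarith
  -- `d` is the difference of `nearMid` and `nearEnd` forced by the position `z`. With product `ξ`,
  -- the two numbers are `(r ± d) / 2`, where `r` is the root of the discriminant.
  set d := z * (1 - ξ) with hd
  set r := Real.sqrt (d ^ 2 + 4 * ξ) with hr
  have hr2 : r ^ 2 = d ^ 2 + 4 * ξ := Real.sq_sqrt (by positivity)
  have hr0 : 0 ≤ r := Real.sqrt_nonneg _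
  have hrd : |d| ≤ r := Real.abs_le_sqrt (by linarith)
  have hd1 : |d| ≤ 1 - ξ := by
    rw [hd, abs_mul, abs_of_pos (by linarith : 0 < 1 - ξ)]
    exact mul_le_of_le_one_left (by linarith) (abs_le.2 hz)
  have hr1 : r ≤ 2 - |d| := by
    refine le_of_sq_le_sq ?_ (by linarith)
    rw [hr2, sub_sq, sq_abs]
    linarith
  obtain ⟨p, hp1, hp2, hp3, hp4⟩ := exists_labels i (t := t) (α := (r - d) / 2) (β := (r + d) / 2)
    (x := x) (by linarith [le_abs_self d]) (by linarith [neg_abs_le d]) (by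
      rw [← hξ]
      linear_combination hr2 / 4)
  have hmem : p ∈ halfPiece i := by
    refine ⟨?_, ?_, ?_⟩
    · rw [hp2]
      linarith [neg_abs_le d]
    · rw [hp3]
      linarith [le_abs_self d]
    · rw [hp4]
      exact abs_le.2 hx
  have hpos : position i p = z := by
    rw [position, hp2, hp3]
    have : (r - d) / 2 * ((r + d) / 2) = ξ := by linear_combination hr2 / 4
    rw [this, div_eq_iff (by linarith)]
    linarith
  refine ⟨i, p, hmem, by rw [hp1]; exact ht, ?_⟩
  refine Prod.ext ?_ (Prod.ext (Subtype.ext ?_) (Subtype.ext ?_))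
  · simp [halfMap, hp1]
  · rw [coe_halfMap_inv hmem.2.2, hp4]
  · rw [coe_halfMap_level hmem, level, hpos]; exact hlev.symm

/-! ### Continuity and openness -/

theorem continuous_nearEnd (i : Bool) : Continuous (nearEnd i) :=
  (continuous_eplog.comp ((continuous_labelA i).comp continuous_snd)).mul (by fun_prop)

theorem continuous_nearMid (i : Bool) : Continuous (nearMid i) :=
  (continuous_eplog.comp ((continuous_labelB i).comp continuous_snd)).mul (by fun_prop)

theorem continuousOn_position (i : Bool) : ContinuousOn (position i) {p | |leafInv i p.2| ≤ 1} := by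
  refine ContinuousOn.div ?_ ?_ ?_
  · exact ((continuous_nearMid i).sub (continuous_nearEnd i)).continuousOn
  · exact (continuous_const.sub ((continuous_nearEnd i).mul (continuous_nearMid i))).continuousOn
  · intro p hp
    have := nearEnd_mul_nearMid_lt (i := i) hp
    linarith

theorem continuousOn_halfMap (i : Bool) : ContinuousOn (halfMap i) {p | |leafInv i p.2| ≤ 1} := by
  have h : ContinuousOn (level i) {p | |leafInv i p.2| ≤ 1} := by
    cases i
    · exact ((continuousOn_position false).sub continuousOn_const).div_const 2
    · exact (continuousOn_const.sub (continuousOn_position true)).div_const 2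
  refine ContinuousOn.prodMk ?_ (ContinuousOn.prodMk ?_ ?_)
  · exact ((AddCircle.continuous_mk' 1).comp continuous_fst).continuousOn
  · exact (continuous_projIcc.comp ((continuous_leafInv i).comp continuous_snd)).continuousOn
  · exact continuous_projIcc.comp_continuousOn h

theorem continuous_returnMap (i : Bool) (n : ℤ) : Continuous (returnMap i n) := by
  have hA := continuous_labelA i
  have hB := continuous_labelB i
  refine Continuous.prodMk (Continuous.if_le ?_ ?_ continuous_const continuous_fst ?_) ?_
  · fun_prop
  · fun_prop
  · intro q hq
    have := labels_eq_zero_of_fst (i := i) hq.symm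
    have h0 := min_smul_eq_zero this (labelA_nonneg i q) (labelB_nonneg i q)
      (inv_pos.2 (two_zpow_pos n)) (two_zpow_pos n)
    rw [inv_mul_eq_div] at h0
    rw [h0]
    simp
  · fun_prop

theorem continuous_deck (i : Bool) (n : ℤ) : Continuous (deck i n) :=
  Continuous.prodMk (by fun_prop) ((continuous_returnMap i n).comp continuous_snd)

theorem isOpen_labelB_pos (i : Bool) : IsOpen {q : ℝ × ℝ | 0 < labelB i q} :=
  isOpen_lt continuous_const (continuous_labelB i)

/-- The two sides scale `A` differently, so the map tears along the lower half of the axis. Where `B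
> 0`, the axis has `A = 0` and the scale has no effect. -/
theorem continuousOn_switchMap (i : Bool) : ContinuousOn (switchMap i) {q | 0 < labelB i q} := by
  rw [continuousOn_iff_continuous_domRestrict]
  have hA := (continuous_labelA i).comp
    (continuous_subtype_val (p := fun q : ℝ × ℝ => q ∈ {q : ℝ × ℝ | 0 < labelB i q}))
  have hB := (continuous_labelB i).comp
    (continuous_subtype_val (p := fun q : ℝ × ℝ => q ∈ {q : ℝ × ℝ | 0 < labelB i q}))
  have : {q : ℝ × ℝ | 0 < labelB i q}.domRestrict (switchMap i) = fun q =>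
      if 0 ≤ q.1.1 then ofLabels (!i) 0 (width i / width (!i) * labelA i q.1) (labelB i q.1)
      else ofLabels (!i) (-1) (labelA i q.1) (labelB i q.1) := by
    ext1 q
    simp only [domRestrict_apply, switchMap, sideScale]
    split_ifs with h
    · exact ofLabels_congr (by simp [h])
    · rw [one_mul]
      exact ofLabels_congr (by simp [h])
  rw [this]
  refine Continuous.if_le ?_ ?_ continuous_const
    (continuous_fst.comp continuous_subtype_val) ?_
  · unfold ofLabels
    simp only [le_refl, if_true]
    exact ((continuous_const.mul ((continuous_const.mul hA).min hB))).prodMk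
      (hB.sub (continuous_const.mul hA))
  · unfold ofLabels
    have : ¬ (0 : ℝ) ≤ -1 := by norm_num
    simp only [this, if_false]
    exact ((hA.min hB).neg).prodMk (hB.sub hA)
  · rintro ⟨q, hq⟩ h
    have hq' : 0 < labelB i q := hq
    have h0 : labelA i q = 0 := by
      rcases labels_eq_zero_of_fst (i := i) h.symm with h | h
      · exact h
      · exact absurd h hq'.ne'
    simp only [h0, mul_zero]
    exact ofLabels_congr_of_min (min_eq_left (labelB_nonneg _ _)) _ _

theorem continuousOn_switch (i : Bool) : ContinuousOn (switch i) {p | 0 < labelB i p.2} := by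
  refine ContinuousOn.prodMk ?_ ?_
  · refine ContinuousOn.sub (by fun_prop) (continuousOn_const.mul ?_)
    intro p hp
    exact (ContinuousAt.comp (g := plog) (f := fun p : Coord => labelB i p.2) (continuousAt_plog hp)
      ((continuous_labelB i).comp continuous_snd).continuousAt).continuousWithinAt
  · exact (continuousOn_switchMap i).comp continuous_snd.continuousOn fun p hp => hp

theorem continuousOn_pieceMap (i : Bool) : ContinuousOn (pieceMap i) (piece i) := by
  rw [continuousOn_iff_continuous_domRestrict]
  have hv : Continuous (Subtype.val : piece i → Coord) := continuous_subtype_val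
  refine continuous_if_le ((continuous_nearMid i).comp hv) continuous_const ?_ ?_ ?_
  · exact ((continuousOn_halfMap i).comp hv.continuousOn fun p _ => p.2.2.2)
  · refine (continuousOn_halfMap (!i)).comp (((continuousOn_switch i).comp hv.continuousOn ?_)) ?_
    · intro p hp
      exact labelB_pos_of_nearMid (lt_of_lt_of_le one_pos hp)
    · intro p hp
      exact (switch_mem_halfPiece p.2 hp).2.2
  · rintro p hp
    have hp' : nearMid i p.1 = 1 := hp
    exact (halfMap_switch (mem_halfPiece p.2 hp'.le) hp').symm

/-- Over a time interval of length one, the bounds on `nearEnd` and `nearMid` bound both labels by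
2, because `eplog 2 = e`. Bounded labels bound the point. -/
theorem isCompact_halfPiece (i : Bool) : IsCompact {p ∈ halfPiece i | p.1 ∈ Icc (0 : ℝ) 1} := by
  have hcl : IsClosed {p ∈ halfPiece i | p.1 ∈ Icc (0 : ℝ) 1} := by
    refine IsClosed.inter ?_ (isClosed_Icc.preimage continuous_fst)
    exact ((isClosed_le (continuous_nearEnd i) continuous_const).inter
      ((isClosed_le (continuous_nearMid i) continuous_const).inter
      (isClosed_le ((continuous_leafInv i).comp continuous_snd).abs continuous_const)))
  refine (isCompact_Icc (a := ((0, (-4, -4)) : Coord)) (b := (1, (4, 4)))).of_isClosed_subset hcl ?_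
  rintro ⟨t, q⟩ ⟨⟨h1, h2, -⟩, ht⟩
  have he : eplog 2 = Real.exp 1 := by
    rw [eplog_of_pos (by norm_num)]
    have := plog_zpow 1
    norm_num at this
    rw [this]
  have hlt : ∀ y, eplog y ≤ Real.exp 1 → y ≤ 2 := by
    intro y hy
    by_contra h
    have := eplog_strictMono (by norm_num) (not_le.1 h)
    rw [he] at this
    linarith
  have hA : labelA i q ≤ 2 := by
    apply hlt
    simp only [nearEnd] at h1
    rw [Real.exp_neg, ← div_eq_mul_inv, div_le_one (Real.exp_pos _)] at h1
    exact h1.trans (Real.exp_le_exp.2 ht.2)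
  have hB : labelB i q ≤ 2 := by
    apply hlt
    simp only [nearMid] at h2
    have : t - 1 = -(1 - t) := by ring
    rw [this, Real.exp_neg, ← div_eq_mul_inv, div_le_one (Real.exp_pos _)] at h2
    refine h2.trans (Real.exp_le_exp.2 ?_)
    have := ht.1
    simp only at this
    linarith
  have hA0 := labelA_nonneg i q
  have hB0 := labelB_nonneg i q
  have h3 : |q.2| ≤ 2 := by
    have : q.2 = labelB i q - labelA i q := by
      conv_lhs => rw [← ofLabels_labels i q]
      rfl
    rw [this, abs_le]
    constructor <;> linarith
  have h4 : |q.1| ≤ 4 := by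
    have hm : labelMin i q.1 ≤ 2 := by
      rw [← min_labels]
      exact (min_le_left _ _).trans hA
    have hw : width i ≤ 2 := by cases i <;> norm_num [width]
    have hw0 := width_pos i
    rcases le_total 0 q.1 with h | h
    · rw [labelMin_of_nonneg h, div_le_iff₀ hw0] at hm
      rw [abs_of_nonneg h]
      linarith
    · rw [labelMin_of_nonpos h] at hm
      rw [abs_of_nonpos h]
      linarith
  rw [abs_le] at h3 h4
  exact ⟨⟨ht.1, by simp; linarith, by simp; linarith⟩, ⟨ht.2, by simp; linarith, by simp; linarith⟩⟩

/-- The complement of the image is a union of two compact images: in each piece, a compact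
fundamental domain minus the open set `V j` of points identified with a point of `U`. -/
theorem isOpen_image_pieceMap {U : Set Coord} (hU : IsOpen U) :
    IsOpen (pieceMap i '' (U ∩ piece i)) := by
  set V : Bool → Set Coord := fun j => if j = i then ⋃ n : ℤ, deck i n ⁻¹' U else
    {p | Real.exp (-1) < nearMid j p} ∩ switch j ⁻¹' (⋃ n : ℤ, deck i n ⁻¹' U) with hV
  have hdU : IsOpen (⋃ n : ℤ, deck i n ⁻¹' U) :=
    isOpen_iUnion fun n => hU.preimage (continuous_deck i n)
  have hVo : ∀ j, IsOpen (V j) := by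
    intro j
    simp only [hV]
    split_ifs
    · exact hdU
    · refine ContinuousOn.isOpen_inter_preimage ?_
        (isOpen_lt continuous_const (continuous_nearMid j)) hdU
      exact (continuousOn_switch j).mono fun p hp =>
        labelB_pos_of_nearMid ((Real.exp_pos _).trans hp)
  have hmem : ∀ j, ∀ p ∈ piece j, p ∈ V j ↔ pieceMap j p ∈ pieceMap i '' (U ∩ piece i) := by
    intro j p hp
    by_cases hj : j = i
    · subst hj
      simp only [hV, if_true, mem_iUnion, mem_preimage]
      constructor
      · rintro ⟨n, hn⟩
        exact ⟨_, ⟨hn, deck_mem_piece.2 hp⟩, pieceMap_deck⟩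
      · rintro ⟨p', ⟨hp', hp''⟩, e⟩
        obtain ⟨n, rfl⟩ := deck_of_pieceMap_eq hp hp'' e.symm
        exact ⟨n, hp'⟩
    · have hj' : i = !j := Bool.eq_not.2 (Ne.symm hj)
      simp only [hV, if_neg hj, mem_inter_iff, mem_iUnion, mem_preimage, mem_ofPred_eq]
      subst hj'
      constructor
      · rintro ⟨hm, n, hn⟩
        refine ⟨_, ⟨hn, deck_mem_piece.2 (switch_mem_piece hp hm)⟩, ?_⟩
        rw [pieceMap_deck, pieceMap_switch hp hm]
      · rintro ⟨p', ⟨hp', hp''⟩, e⟩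
        obtain ⟨hm, n, rfl⟩ := deck_switch_of_halfMap_eq hp hp'' e.symm
        exact ⟨hm, n, hp'⟩
  have hcompl : (pieceMap i '' (U ∩ piece i))ᶜ =
      ⋃ j : Bool, halfMap j '' ({p ∈ halfPiece j | p.1 ∈ Icc (0 : ℝ) 1} \ V j) := by
    ext P
    simp only [mem_compl_iff, mem_iUnion]
    constructor
    · intro h
      obtain ⟨j, p, hp, ht, rfl⟩ := exists_halfMap_eq P
      refine ⟨j, p, ⟨⟨hp, ht⟩, fun hpV => h ?_⟩, rfl⟩
      rw [← pieceMap_of_le hp.2.1]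
      exact (hmem j p (halfPiece_subset hp)).1 hpV
    · rintro ⟨j, p, ⟨⟨hp, ht⟩, hpV⟩, rfl⟩ h
      rw [← pieceMap_of_le hp.2.1] at h
      exact hpV ((hmem j p (halfPiece_subset hp)).2 h)
  rw [← isClosed_compl_iff, hcompl]
  refine isClosed_iUnion_of_finite fun j => ?_
  refine (((isCompact_halfPiece j).diff (hVo j)).image_of_continuousOn ?_).isClosed
  exact (continuousOn_halfMap j).mono fun p hp => hp.1.1.2.2

end

section

/-! ### The symmetries are piecewise linear and preserve area -/

/-- The signed width of the side of the axis on which `s` lies. -/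
def sideWidth (i : Bool) (s : ℝ) : ℝ := if 0 ≤ s then width i else -1

/-- The labels on a side with signed width `w`. -/
def toLabels (w : ℝ) (q : ℝ × ℝ) : ℝ × ℝ := (q.1 / w + max (-q.2) 0, q.1 / w + max q.2 0)

/-- The point with given labels on a side with signed width `w`. -/
def fromLabels (w : ℝ) (v : ℝ × ℝ) : ℝ × ℝ := (w * min v.1 v.2, v.2 - v.1)

theorem sideWidth_ne_zero (i : Bool) (s : ℝ) : sideWidth i s ≠ 0 := by
  unfold sideWidth
  split_ifs
  · exact (width_pos i).ne'
  · norm_num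

theorem ofLabels_eq (i : Bool) (s A B : ℝ) :
    ofLabels i s A B = fromLabels (sideWidth i s) (A, B) := by
  unfold ofLabels fromLabels sideWidth
  split_ifs <;> simp

theorem labels_eq_of_nonneg {i : Bool} {q : ℝ × ℝ} (h : 0 ≤ q.1) :
    (labelA i q, labelB i q) = toLabels (width i) q := by
  simp only [labelA, labelB, labelMin_of_nonneg h, toLabels]

theorem labels_eq_of_nonpos {i : Bool} {q : ℝ × ℝ} (h : q.1 ≤ 0) :
    (labelA i q, labelB i q) = toLabels (-1) q := by
  simp only [labelA, labelB, labelMin_of_nonpos h, toLabels, div_neg, div_one]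

theorem labels_eq {i : Bool} {q : ℝ × ℝ} {s : ℝ} (h : 0 ≤ s ↔ 0 ≤ q.1) :
    (labelA i q, labelB i q) = toLabels (sideWidth i s) q := by
  unfold sideWidth
  split_ifs with hs
  · exact labels_eq_of_nonneg (h.1 hs)
  · exact labels_eq_of_nonpos (not_le.1 (h.not.1 hs)).le

theorem continuous_toLabels (w : ℝ) : Continuous (toLabels w) := by
  unfold toLabels
  fun_prop

theorem continuous_fromLabels (w : ℝ) : Continuous (fromLabels w) := by
  unfold fromLabels
  fun_prop

theorem plWith_toLabels (w : ℝ) (q : ℝ × ℝ) : PLWith (AreaFactor |w|⁻¹) id (toLabels w) q := by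
  refine PLWith.piecewise (f₁ := fun q => (q.1 / w, q.1 / w + q.2))
    (f₂ := fun q => (q.1 / w - q.2, q.1 / w)) (LinearMap.snd ℝ ℝ ℝ).toAffineMap
    (PLWith.planeMap w⁻¹ 0 w⁻¹ 1 0 0 (by simp [abs_inv]) ?_)
    (PLWith.planeMap w⁻¹ (-1) w⁻¹ 0 0 0 (by simp [abs_inv]) ?_) ?_ ?_
  · exact .of_forall fun q => by simp; ring
  · exact .of_forall fun q => by simp; constructor <;> ring
  · refine .of_forall fun q hq => ?_
    have hq' : 0 ≤ q.2 := hq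
    simp [toLabels, hq']
  · refine .of_forall fun q hq => ?_
    have hq' : q.2 ≤ 0 := hq
    simp [toLabels, hq', sub_eq_add_neg]

theorem plWith_fromLabels (w : ℝ) (v : ℝ × ℝ) : PLWith (AreaFactor |w|) id (fromLabels w) v := by
  refine PLWith.piecewise (f₁ := fun v => (w * v.1, v.2 - v.1))
    (f₂ := fun v => (w * v.2, v.2 - v.1))
    (LinearMap.snd ℝ ℝ ℝ - LinearMap.fst ℝ ℝ ℝ).toAffineMap
    (PLWith.planeMap w 0 (-1) 1 0 0 (by simp) ?_)
    (PLWith.planeMap 0 w (-1) 1 0 0 (by simp) ?_) ?_ ?_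
  · exact .of_forall fun q => by simp; ring
  · exact .of_forall fun q => by simp; ring
  · refine .of_forall fun v hv => ?_
    have hv' : v.1 ≤ v.2 := by simpa using hv
    simp [fromLabels, hv']
  · refine .of_forall fun v hv => ?_
    have hv' : v.2 ≤ v.1 := by simpa using hv
    simp [fromLabels, hv']

/-- Rescaling of the labels. -/
theorem plWith_rescale {w w' a b : ℝ} (hw : w ≠ 0) (h : |w'| * |a * b| = |w|) (q : ℝ × ℝ) :
    PLWith (AreaFactor 1) id
      (fun q => fromLabels w' (a * (toLabels w q).1, b * (toLabels w q).2)) q := by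
  have h1 : PLWith (AreaFactor (|a * b| * |w|⁻¹)) id
      (fun q => (a * (toLabels w q).1, b * (toLabels w q).2)) q :=
    PLWith.trans (fun A B => AreaFactor.comp rfl A B) (plWith_toLabels w q)
      (PLWith.planeMap a 0 0 b 0 0 (d := |a * b|) (by simp) (.of_forall fun q => by simp))
  have hc : ContinuousAt (fun q => (a * (toLabels w q).1, b * (toLabels w q).2)) q :=
    (Continuous.prodMk (continuous_const.mul (continuous_toLabels w).fst)
      (continuous_const.mul (continuous_toLabels w).snd)).continuousAt
  have hw' : |w| ≠ 0 := abs_ne_zero.2 hw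
  exact PLWith.trans (fun A B => AreaFactor.comp (by rw [← mul_assoc, h, mul_inv_cancel₀ hw']) A B)
    h1 ((plWith_fromLabels w' _).comap hc)

variable {i : Bool} {n : ℤ} {q : ℝ × ℝ}

/-- The two label factors are inverse to each other and the width is unchanged, so area is preserved
on each side. The sides agree on the axis, where the smaller label vanishes. -/
theorem plWith_returnMap (i : Bool) (n : ℤ) (q : ℝ × ℝ) :
    PLWith (AreaFactor 1) id (returnMap i n) q := by
  have hn := two_zpow_pos n
  have key : ∀ w : ℝ, |w| * |(2 ^ n)⁻¹ * 2 ^ n| = |w| := fun w => by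
    rw [inv_mul_cancel₀ hn.ne']
    simp
  refine PLWith.piecewise (LinearMap.fst ℝ ℝ ℝ).toAffineMap
    (plWith_rescale (width_pos i).ne' (key _) q)
    (plWith_rescale (w := -1) (by norm_num) (key _) q) ?_ ?_
  · refine .of_forall fun q (hq : 0 ≤ q.1) => ?_
    rw [← labels_eq_of_nonneg hq, returnMap, ofLabels_eq, sideWidth, if_pos hq, inv_mul_eq_div]
  · refine .of_forall fun q (hq : q.1 ≤ 0) => ?_
    rw [← labels_eq_of_nonpos (i := i) hq, returnMap]
    rcases hq.eq_or_lt with h | h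
    · have h0 : min (labelA i q / 2 ^ n) (2 ^ n * labelB i q) = 0 := by
        rw [← inv_mul_eq_div]
        exact min_smul_eq_zero (labels_eq_zero_of_fst h) (labelA_nonneg i q) (labelB_nonneg i q)
          (inv_pos.2 hn) hn
      rw [ofLabels_congr_of_min h0 q.1 (-1), ofLabels_eq, sideWidth, if_neg (by norm_num),
        inv_mul_eq_div]
    · rw [ofLabels_eq, sideWidth, if_neg h.not_ge, inv_mul_eq_div]

/-- On the right, the factor on `A` exactly compensates for the change of width. -/
theorem plWith_switchMap (h : 0 < labelB i q) : PLWith (AreaFactor 1) id (switchMap i) q := by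
  have h1 := width_pos i
  have h2 := width_pos (!i)
  have hev : ∀ᶠ q in 𝓝 q, 0 < labelB i q := (isOpen_labelB_pos i).mem_nhds h
  refine PLWith.piecewise (LinearMap.fst ℝ ℝ ℝ).toAffineMap
    (plWith_rescale (w := width i) (w' := width (!i)) (a := width i / width (!i)) (b := 1) h1.ne'
      ?_ q)
    (plWith_rescale (w := -1) (w' := -1) (a := 1) (b := 1) (by norm_num) (by simp) q) ?_ ?_
  · rw [mul_one, ← abs_mul, mul_div_cancel₀ _ h2.ne']
  · refine .of_forall fun q (hq : 0 ≤ q.1) => ?_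
    rw [← labels_eq_of_nonneg hq, switchMap, sideScale, if_pos hq, ofLabels_eq, sideWidth,
      if_pos hq, one_mul]
  · filter_upwards [hev] with q hB (hq : q.1 ≤ 0)
    rw [← labels_eq_of_nonpos (i := i) hq, switchMap]
    simp only [one_mul]
    rcases hq.eq_or_lt with h | h
    · have h0 : labelA i q = 0 := (labels_eq_zero_of_fst h).resolve_right hB.ne'
      rw [h0, mul_zero, ofLabels_congr_of_min (min_eq_left hB.le) q.1 (-1), ofLabels_eq, sideWidth,
        if_neg (by norm_num)]
    · rw [ofLabels_eq, sideWidth, sideScale, if_neg h.not_ge, if_neg h.not_ge, one_mul]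

/-- The orientation of the leaves in the piece `i`. -/
def orient (i : Bool) : ℝ := if i then -1 else 1

theorem orient_not (i : Bool) : orient (!i) = -orient i := by cases i <;> simp [orient]

theorem orient_mul_self (i : Bool) : orient i * orient i = 1 := by cases i <;> simp [orient]

/-- The oriented coordinates of a piece. -/
def oriented (i : Bool) (p : Coord) : Coord := (orient i * p.1, p.2)

theorem continuous_oriented (i : Bool) : Continuous (oriented i) := by
  unfold oriented
  fun_prop

theorem isLeafShift_returnMap (i : Bool) (n : ℤ) (a : ℝ) (q : ℝ × ℝ) :
    IsLeafShift (fun _ => a) (returnMap i n) q :=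
  ⟨PL.const a, plWith_returnMap i n q, univ, univ_mem,
    (Function.LeftInverse.injective (g := returnMap i (-n)) fun q => by
      rw [returnMap_add, neg_add_cancel, returnMap_zero]).injOn⟩

theorem pl_labels (i : Bool) (q : ℝ × ℝ) : PL id (labelA i) q ∧ PL id (labelB i) q := by
  have h1 : PL (E := ℝ × ℝ) (X := ℝ × ℝ) id (fun q => q.1) q := PL.fst PL.refl
  have h2 : PL (E := ℝ × ℝ) (X := ℝ × ℝ) id (fun q => q.2) q := PL.snd PL.refl
  have hm : PL id (fun q : ℝ × ℝ => labelMin i q.1) q :=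
    ((h1.mul (width i)⁻¹).max h1.neg).congr (.of_forall fun q => by
      rw [labelMin, div_eq_inv_mul])
  exact ⟨hm.add (h2.neg.max (PL.const 0)), hm.add (h2.max (PL.const 0))⟩

theorem PL.plog_labelA (h : 0 < labelA i q) : PL id (fun q => PLPlug.plog (labelA i q)) q :=
  PL.plog (pl_labels i q).1 (continuous_labelA i).continuousAt h

theorem PL.plog_labelB (h : 0 < labelB i q) : PL id (fun q => PLPlug.plog (labelB i q)) q :=
  PL.plog (pl_labels i q).2 (continuous_labelB i).continuousAt h

theorem isLeafShift_switchMap (h : 0 < labelB i q) :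
    IsLeafShift (fun q => orient i * (2 * plog (labelB i q) - 2)) (switchMap i) q := by
  refine ⟨?_, plWith_switchMap h, _, (isOpen_labelB_pos i).mem_nhds h, ?_⟩
  · exact (((PL.plog_labelB h).mul 2).sub (PL.const 2)).mul _
  · intro q hq q' hq' e
    rw [← switchMap_switchMap hq, e, switchMap_switchMap hq']

theorem oriented_deck (i : Bool) (n : ℤ) (p : Coord) :
    oriented i (deck i n p) = ((oriented i p).1 + -(orient i * n), returnMap i n (oriented i p).2)
        := by
  simp only [oriented, deck, Prod.mk.injEq, and_true]
  ring

/-- The switch reverses time and so does the change of `orient`; together they give a translation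
along the leaves, which is the form demanded by `IsLeafShift`. -/
theorem oriented_switch (i : Bool) (p : Coord) :
    oriented (!i) (switch i p) =
      ((oriented i p).1 + orient i * (2 * plog (labelB i p.2) - 2),
        switchMap i (oriented i p).2) := by
  simp only [oriented, switch, orient_not, Prod.mk.injEq, and_true]
  ring

/-- A shear of the plane that straightens the graph of a piecewise-linear function. -/
theorem plWith_shear {k : ℝ → ℝ} {v : ℝ × ℝ} (hk : PL id k v.1) (w : ℝ) :
    PLWith (AreaFactor |w|) id (fun v : ℝ × ℝ => (k v.1 - w * v.2, v.1)) v := by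
  obtain ⟨ι, hι, C, G, hC, -, h⟩ := hk
  refine ⟨ι, hι, fun i => (LinearMap.fst ℝ ℝ ℝ).toAffineMap ⁻¹' C i,
    fun i => planeMap ((G i).linear 1) (-w) 1 0 (G i 0) 0, fun i => (hC i).preimage _, fun i => ?_,
        ?_⟩
  · have := areaFactor_planeMap ((G i).linear 1) (-w) 1 0 (G i 0) 0
    simpa using this
  · have hc : Tendsto (fun u : ℝ × ℝ => u.1) (𝓝 v) (𝓝 v.1) := continuous_fst.continuousAt
    filter_upwards [hc.eventually h] with u hu
    refine ⟨hu.1, fun i hi => ?_⟩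
    have h1 := hu.2 i hi
    have h2 := congrFun (G i).decomp u.1
    have h3 : (G i).linear u.1 = u.1 * (G i).linear 1 := by
      rw [← smul_eq_mul, ← map_smul, smul_eq_mul, mul_one]
    simp only [Pi.add_apply, h3] at h2
    simp only [id] at h1
    rw [planeMap_apply]
    ext
    · simp only [id]
      rw [h1, h2]
      ring
    · simp

end

section

/-! ### Charts -/

/-- A chart of the support that is straightened from the oriented coordinates of one of the
pieces. -/
structure ChartData (e : OpenPartialHomeomorph Support Model) where
  side : Bool
  lift : Support → Coord
  shift : ℝ × ℝ → ℝ
  plane : ℝ × ℝ → ℝ × ℝ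
  continuousOn_lift : ContinuousOn lift e.source
  lift_mem : ∀ y ∈ e.source, lift y ∈ piece side
  pieceMap_lift : ∀ y ∈ e.source, pieceMap side (lift y) = y
  coords_eq : ∀ y ∈ e.source,
    coords e y = ((oriented side (lift y)).1 + shift (lift y).2, plane (lift y).2)
  leafShift : ∀ y ∈ e.source, IsLeafShift shift plane (lift y).2
  injOn : ∀ y ∈ e.source, ∀ z ∈ e.source,
    plane (lift y).2 = plane (lift z).2 → (lift y).2 = (lift z).2
  entry_iff : ∀ y ∈ e.source,
    (coords e y).1 = 0 ↔ side = false ∧ nearEnd side (lift y) = 1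
  exit_iff : ∀ y ∈ e.source,
    (coords e y).1 = 1 ↔ side = true ∧ nearEnd side (lift y) = 1
  parallel_iff : ∀ y ∈ e.source, (coords e y).2.1 = 0 ↔ |leafInv side (lift y).2| = 1

/-! ### Changes between lifts and charts -/

section transitions

variable {X : Type*} [TopologicalSpace X] {x : X} {i : Bool}

/-- Two lifts to the same piece differ by a deck transformation. Its index can be read off from the
difference of times, which is continuous and integral, so it is locally constant. -/
theorem transition_of_pieceMap_eq {u v : X → Coord} (hu : ContinuousAt u x) (hv : ContinuousAt v x)
    (hum : ∀ᶠ y in 𝓝 x, u y ∈ piece i) (hvm : ∀ᶠ y in 𝓝 x, v y ∈ piece i)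
    (h : ∀ᶠ y in 𝓝 x, pieceMap i (u y) = pieceMap i (v y)) :
    Transition (oriented i ∘ u) (oriented i ∘ v) x := by
  obtain ⟨n, hn⟩ := deck_of_pieceMap_eq hum.self_of_nhds hvm.self_of_nhds h.self_of_nhds
  have hd : ContinuousAt (fun y => |(v y).1 - (u y).1 + n|) x :=
    ((hv.fst.sub hu.fst).add continuousAt_const).abs
  have h0 : |(v x).1 - (u x).1 + n| < 1 := by
    rw [hn]
    simp [deck]
  have hev : ∀ᶠ y in 𝓝 x, v y = deck i n (u y) := by
    filter_upwards [hum, hvm, h, hd.eventually_lt_const h0] with y h1 h2 h3 h4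
    obtain ⟨m, hm⟩ := deck_of_pieceMap_eq h1 h2 h3
    have h5 : (v y).1 = (u y).1 - m := congrArg Prod.fst hm
    rw [h5] at h4
    have h6 : |((n - m : ℤ) : ℝ)| < 1 := by
      have : ((n - m : ℤ) : ℝ) = (u y).1 - m - (u y).1 + n := by
        push_cast
        ring
      rwa [this]
    have h7 : n - m = 0 := by
      rw [← Int.abs_lt_one_iff]
      exact_mod_cast h6
    have h8 : n = m := by omega
    rw [h8, hm]
  refine (isLeafShift_returnMap i n (-(orient i * n)) _).transition
    ((continuous_oriented i).continuousAt.comp hu) ?_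
  filter_upwards [hev] with y hy
  rw [Function.comp_apply, hy, oriented_deck]
  rfl

theorem transition_of_lifts {i j : Bool} {u v : X → Coord} (hu : ContinuousAt u x)
    (hv : ContinuousAt v x) (hum : ∀ᶠ y in 𝓝 x, u y ∈ piece i) (hvm : ∀ᶠ y in 𝓝 x, v y ∈ piece j)
    (h : ∀ᶠ y in 𝓝 x, pieceMap i (u y) = pieceMap j (v y)) :
    Transition (oriented i ∘ u) (oriented j ∘ v) x := by
  by_cases hij : j = i
  · subst hij
    exact transition_of_pieceMap_eq hu hv hum hvm h
  · obtain rfl : j = !i := Bool.eq_not.2 hij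
    have hmid : ∀ᶠ y in 𝓝 x, Real.exp (-1) < nearMid i (u y) := by
      filter_upwards [hum, hvm, h] with y h1 h2 h3
      exact (deck_switch_of_halfMap_eq h1 h2 h3).1
    have hB : 0 < labelB i (u x).2 :=
      labelB_pos_of_nearMid ((Real.exp_pos _).trans hmid.self_of_nhds)
    have hs : ContinuousAt (switch i ∘ u) x :=
      ContinuousAt.comp ((continuousOn_switch i).continuousAt
        (((isOpen_labelB_pos i).preimage continuous_snd).mem_nhds hB)) hu
    refine Transition.trans (c' := oriented (!i) ∘ (switch i ∘ u)) ?_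
      (transition_of_pieceMap_eq hs hv ?_ hvm ?_)
    · refine (isLeafShift_switchMap hB).transition (c := oriented i ∘ u)
        ((continuous_oriented i).continuousAt.comp hu) (.of_forall fun y => ?_)
      exact oriented_switch i (u y)
    · filter_upwards [hum, hmid] with y h1 h2
      exact switch_mem_piece h1 h2
    · filter_upwards [hum, hmid, h] with y h1 h2 h3
      rw [← h3]
      exact pieceMap_switch h1 h2

variable {e e' : OpenPartialHomeomorph Support Model}

theorem ChartData.continuousAt_lift (d : ChartData e) {y : Support} (hy : y ∈ e.source) :
    ContinuousAt d.lift y :=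
  d.continuousOn_lift.continuousAt (e.open_source.mem_nhds hy)

/-- The base space `X` is left free because three cases are needed: the support itself for chart
changes, a leaf line for plaques, and the cover of the thickened annulus for the attaching map. -/
theorem ChartData.transition_of_lift (d : ChartData e) {P : Support} (hP : P ∈ e.source) {i : Bool}
    {v : X → Coord}
    {f : X → Support} (hf : ContinuousAt f x) (hfx : f x = P)
    (hv : ContinuousAt v x) (hvm : ∀ᶠ y in 𝓝 x, v y ∈ piece i)
    (h : ∀ᶠ y in 𝓝 x, pieceMap i (v y) = f y) :
    Transition (oriented i ∘ v) (coords e ∘ f) x ∧ Transition (coords e ∘ f) (oriented i ∘ v) x :=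
        by
  subst hfx
  have hs : ∀ᶠ y in 𝓝 x, f y ∈ e.source := hf (e.open_source.mem_nhds hP)
  have hl : ContinuousAt (d.lift ∘ f) x := ContinuousAt.comp (d.continuousAt_lift hP) hf
  have hm : ∀ᶠ y in 𝓝 x, (d.lift ∘ f) y ∈ piece d.side := hs.mono fun y hy => d.lift_mem _ hy
  have hp : ∀ᶠ y in 𝓝 x, pieceMap d.side ((d.lift ∘ f) y) = pieceMap i (v y) := by
    filter_upwards [hs, h] with y h1 h2
    rw [h2]
    exact d.pieceMap_lift _ h1
  have hc : ContinuousAt (oriented d.side ∘ (d.lift ∘ f)) x :=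
    (continuous_oriented _).continuousAt.comp hl
  have hcoord : ∀ᶠ y in 𝓝 x, (coords e ∘ f) y =
      (((oriented d.side ∘ (d.lift ∘ f)) y).1 + d.shift ((oriented d.side ∘ (d.lift ∘ f)) y).2,
        d.plane ((oriented d.side ∘ (d.lift ∘ f)) y).2) :=
    hs.mono fun y hy => d.coords_eq _ hy
  constructor
  · exact (transition_of_lifts hv hl hvm hm (hp.mono fun _ h => h.symm)).trans
      (IsLeafShift.transition (c := oriented d.side ∘ (d.lift ∘ f)) (d.leafShift _ hP) hc hcoord)
  · exact (IsLeafShift.transition_symm (c := oriented d.side ∘ (d.lift ∘ f)) (d.leafShift _ hP) hc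
      hcoord).trans
      (transition_of_lifts hl hv hm hvm hp)

theorem ChartData.transition (d : ChartData e) (d' : ChartData e') {P : Support} (hP : P ∈
    e.source) (hP' : P ∈ e'.source) :
    Transition (coords e) (coords e') P := by
  have hs : ∀ᶠ y in 𝓝 P, y ∈ e.source := e.open_source.mem_nhds hP
  have h1 := d.continuousAt_lift hP
  have h2 : ∀ᶠ y in 𝓝 P, d.lift y ∈ piece d.side := hs.mono fun y hy => d.lift_mem _ hy
  have h3 : ∀ᶠ y in 𝓝 P, pieceMap d.side (d.lift y) = id y :=
    hs.mono fun y hy => d.pieceMap_lift _ hy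
  exact (d.transition_of_lift hP continuousAt_id rfl h1 h2 h3).2.trans
    (d'.transition_of_lift hP' continuousAt_id rfl h1 h2 h3).1

end transitions

/-! ### Existence of charts -/

section construction

/-- The real coordinates of a point of the model. -/
def modelCoords (m : Model) : Coord := (m.1, (m.2.1, m.2.2))

/-- The point of the model with given real coordinates. -/
def toModel (c : Coord) : Model := (projIcc 0 1 zero_le_one c.1, (⟨max 0 c.2.1, mem_Ici.2
    (le_max_left _ _)⟩, c.2.2))

theorem continuous_modelCoords : Continuous modelCoords := by
  unfold modelCoords
  fun_prop

theorem continuous_toModel : Continuous toModel := by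
  refine Continuous.prodMk (continuous_projIcc.comp continuous_fst) (Continuous.prodMk ?_ ?_)
  · exact Continuous.subtype_mk (by fun_prop) _
  · fun_prop

theorem modelCoords_toModel {c : Coord} (h1 : c.1 ∈ Icc (0 : ℝ) 1) (h2 : 0 ≤ c.2.1) :
    modelCoords (toModel c) = c := by
  simp only [modelCoords, toModel]
  rw [projIcc_of_mem _ h1, max_eq_right h2]

theorem toModel_modelCoords (m : Model) : toModel (modelCoords m) = m := by
  obtain ⟨t, ⟨x, hx⟩, z⟩ := m
  simp only [modelCoords, toModel, projIcc_val]
  have hx' : 0 ≤ x := hx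
  simp [hx']

variable {i : Bool}

/-- A nontrivial deck transformation moves the time by at least one, so a window that is short in
time embeds. -/
theorem injOn_pieceMap {W : Set Coord} (hW : ∀ p ∈ W, ∀ p' ∈ W, |p.1 - p'.1| < 1) :
    InjOn (pieceMap i) (W ∩ piece i) := by
  rintro p ⟨hpW, hp⟩ p' ⟨hpW', hp'⟩ h
  obtain ⟨n, hn⟩ := deck_of_pieceMap_eq hp hp' h
  have h1 : p'.1 = p.1 - n := congrArg Prod.fst hn
  have h2 := hW p hpW p' hpW'
  rw [h1, sub_sub_cancel] at h2
  have h3 : n = 0 := by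
    rw [← Int.abs_lt_one_iff]
    exact_mod_cast h2
  rw [hn, h3, deck_zero]

theorem continuousOn_invFunOn_pieceMap {W : Set Coord} (hWo : IsOpen W)
    (hW : ∀ p ∈ W, ∀ p' ∈ W, |p.1 - p'.1| < 1) :
    ContinuousOn (Function.invFunOn (pieceMap i) (W ∩ piece i)) (pieceMap i '' (W ∩ piece i)) := by
  have hinj := (injOn_pieceMap (i := i) hW).leftInvOn_invFunOn
  rw [continuousOn_open_iff (isOpen_image_pieceMap hWo)]
  intro U hU
  convert isOpen_image_pieceMap (i := i) (hU.inter hWo) using 1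
  ext y
  constructor
  · rintro ⟨⟨p, hp, rfl⟩, hy⟩
    rw [mem_preimage, hinj hp] at hy
    exact ⟨p, ⟨⟨hy, hp.1⟩, hp.2⟩, rfl⟩
  · rintro ⟨p, ⟨⟨hU', hpW⟩, hp⟩, rfl⟩
    refine ⟨⟨p, ⟨hpW, hp⟩, rfl⟩, ?_⟩
    rw [mem_preimage, hinj ⟨hpW, hp⟩]
    exact hU'

/-- The straightening `(orient · t + g, β)` is a homeomorphism of a whole window of coordinate
space. The hypothesis `hmem` says that it cuts the piece out exactly where the values lie in the
model, so restriction gives a chart with the correct faces. -/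
theorem exists_chart (i : Bool) (β : OpenPartialHomeomorph (ℝ × ℝ) (ℝ × ℝ)) (g : ℝ × ℝ → ℝ)
    {W : Set Coord} (hWo : IsOpen W) (hWβ : ∀ p ∈ W, p.2 ∈ β.source)
    (hshift : ∀ p ∈ W, IsLeafShift g β p.2)
    (hW : ∀ p ∈ W, ∀ p' ∈ W, |p.1 - p'.1| < 1)
    (hmem : ∀ p ∈ W, p ∈ piece i ↔ orient i * p.1 + g p.2 ∈ Icc (0 : ℝ) 1 ∧ 0 ≤ (β p.2).1)
    (hentry : ∀ p ∈ W, p ∈ piece i →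
      (orient i * p.1 + g p.2 = 0 ↔ i = false ∧ nearEnd i p = 1))
    (hexit : ∀ p ∈ W, p ∈ piece i →
      (orient i * p.1 + g p.2 = 1 ↔ i = true ∧ nearEnd i p = 1))
    (hpar : ∀ p ∈ W, p ∈ piece i → ((β p.2).1 = 0 ↔ |leafInv i p.2| = 1))
    {p₀ : Coord} (hp₀ : p₀ ∈ W) (hp₀' : p₀ ∈ piece i) :
    ∃ e : OpenPartialHomeomorph Support Model, pieceMap i p₀ ∈ e.source ∧
      Nonempty (ChartData e) := by
  set Φ : Coord → Coord := fun p => (orient i * p.1 + g p.2, β p.2) with hΦ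
  set Ψ : Coord → Coord := fun m => (orient i * (m.1 - g (β.symm m.2)), β.symm m.2) with hΨ
  have hΨΦ : ∀ p ∈ W, Ψ (Φ p) = p := by
    intro p hp
    simp only [hΨ, hΦ, β.left_inv (hWβ p hp)]
    refine Prod.ext ?_ rfl
    simp only [add_sub_cancel_right]
    rw [← mul_assoc, orient_mul_self, one_mul]
  have hΦΨ : ∀ m, m.2 ∈ β.target → Φ (Ψ m) = m := by
    intro m hm
    simp only [hΨ, hΦ, β.right_inv hm]
    refine Prod.ext ?_ rfl
    simp only
    rw [← mul_assoc, orient_mul_self, one_mul, sub_add_cancel]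
  have hgc : ∀ p ∈ W, ContinuousAt g p.2 := fun p hp =>
    (hshift p hp).shift.continuousAt continuousAt_id
  have hΦc : ContinuousOn Φ W := by
    intro p hp
    have h1 : ContinuousAt (fun p : Coord => g p.2) p :=
      ContinuousAt.comp (g := g) (f := fun p : Coord => p.2) (hgc p hp) continuous_snd.continuousAt
    have h2 : ContinuousAt (fun p : Coord => β p.2) p :=
      ContinuousAt.comp (g := β) (f := fun p : Coord => p.2) (β.continuousAt (hWβ p hp))
        continuous_snd.continuousAt
    exact (((continuousAt_const.mul continuousAt_fst).add h1).prodMk h2).continuousWithinAt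
  set T : Set Coord := {m | m.2 ∈ β.target ∧ Ψ m ∈ W} with hT
  have hΨc : ∀ m ∈ T, ContinuousAt Ψ m := by
    rintro m ⟨hm, hmW⟩
    have h2 : ContinuousAt (fun m : Coord => β.symm m.2) m :=
      ContinuousAt.comp (g := β.symm) (f := fun p : Coord => p.2) (β.continuousAt_symm hm)
        continuous_snd.continuousAt
    have h1 : ContinuousAt (fun m : Coord => g (β.symm m.2)) m :=
      ContinuousAt.comp (g := g) (f := fun p : Coord => β.symm p.2) (hgc (Ψ m) hmW) h2
    exact (continuousAt_const.mul (continuousAt_fst.sub h1)).prodMk h2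
  have hTo : IsOpen T := by
    rw [isOpen_iff_mem_nhds]
    intro m hm
    exact inter_mem (continuous_snd.continuousAt (β.open_target.mem_nhds hm.1))
      (hΨc m hm (hWo.mem_nhds hm.2))
  set lift := Function.invFunOn (pieceMap i) (W ∩ piece i) with hlift
  have hl : ∀ p ∈ W ∩ piece i, lift (pieceMap i p) = p := fun p hp =>
    (injOn_pieceMap hW).leftInvOn_invFunOn hp
  have hlc : ContinuousOn lift (pieceMap i '' (W ∩ piece i)) :=
    continuousOn_invFunOn_pieceMap hWo hW
  have hcoord : ∀ p ∈ W ∩ piece i, modelCoords (toModel (Φ p)) = Φ p := fun p hp =>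
    modelCoords_toModel ((hmem p hp.1).1 hp.2).1 ((hmem p hp.1).1 hp.2).2
  have hΨm : ∀ m : Model, modelCoords m ∈ T → Ψ (modelCoords m) ∈ W ∩ piece i := by
    intro m hm
    refine ⟨hm.2, ?_⟩
    have h1 := hΦΨ _ hm.1
    have h2 : orient i * (Ψ (modelCoords m)).1 + g (Ψ (modelCoords m)).2 = m.1 :=
      congrArg Prod.fst h1
    have h3 : β (Ψ (modelCoords m)).2 = (modelCoords m).2 := congrArg Prod.snd h1
    rw [hmem _ hm.2, h2, h3]
    exact ⟨m.1.2, m.2.1.2⟩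
  let e : OpenPartialHomeomorph Support Model :=
    { toFun := fun y => toModel (Φ (lift y))
      invFun := fun m => pieceMap i (Ψ (modelCoords m))
      source := pieceMap i '' (W ∩ piece i)
      target := modelCoords ⁻¹' T
      map_source' := by
        rintro _ ⟨p, hp, rfl⟩
        rw [hl p hp, mem_preimage, hcoord p hp]
        refine ⟨β.map_source (hWβ p hp.1), ?_⟩
        rw [hΨΦ p hp.1]
        exact hp.1
      map_target' := fun m hm => ⟨_, hΨm m hm, rfl⟩
      left_inv' := by
        rintro _ ⟨p, hp, rfl⟩
        rw [hl p hp, hcoord p hp, hΨΦ p hp.1]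
      right_inv' := fun m hm => by
        rw [hl _ (hΨm m hm), hΦΨ _ hm.1, toModel_modelCoords]
      open_source := isOpen_image_pieceMap hWo
      open_target := hTo.preimage continuous_modelCoords
      continuousOn_toFun := by
        refine continuous_toModel.comp_continuousOn (hΦc.comp hlc ?_)
        rintro _ ⟨p, hp, rfl⟩
        rw [hl p hp]
        exact hp.1
      continuousOn_invFun := by
        refine (continuousOn_pieceMap i).comp ?_ fun m hm => (hΨm m hm).2
        intro m hm
        exact (ContinuousAt.comp (hΨc _ hm) continuous_modelCoords.continuousAt).continuousWithinAt
            }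
  have hec : ∀ p ∈ W ∩ piece i, coords e (pieceMap i p) = Φ p := by
    intro p hp
    have : coords e (pieceMap i p) = modelCoords (toModel (Φ (lift (pieceMap i p)))) := rfl
    rw [this, hl p hp, hcoord p hp]
  refine ⟨e, ⟨p₀, ⟨hp₀, hp₀'⟩, rfl⟩, ⟨{
    side := i
    lift := lift
    shift := g
    plane := β
    continuousOn_lift := hlc
    lift_mem := ?_
    pieceMap_lift := ?_
    coords_eq := ?_
    leafShift := ?_
    injOn := ?_
    entry_iff := ?_
    exit_iff := ?_
    parallel_iff := ?_ }⟩⟩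
  · rintro _ ⟨p, hp, rfl⟩
    rw [hl p hp]
    exact hp.2
  · rintro _ ⟨p, hp, rfl⟩
    rw [hl p hp]
  · rintro _ ⟨p, hp, rfl⟩
    rw [hl p hp, hec p hp]
    rfl
  · rintro _ ⟨p, hp, rfl⟩
    rw [hl p hp]
    exact hshift p hp.1
  · rintro _ ⟨p, hp, rfl⟩ _ ⟨p', hp', rfl⟩ h
    rw [hl p hp, hl p' hp'] at h ⊢
    exact β.injOn (hWβ p hp.1) (hWβ p' hp'.1) h
  · rintro _ ⟨p, hp, rfl⟩
    rw [hl p hp, hec p hp]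
    exact hentry p hp.1 hp.2
  · rintro _ ⟨p, hp, rfl⟩
    rw [hl p hp, hec p hp]
    exact hexit p hp.1 hp.2
  · rintro _ ⟨p, hp, rfl⟩
    rw [hl p hp, hec p hp]
    exact hpar p hp.1 hp.2

/-- A leaf coordinate near a point of a piece. -/
theorem exists_leafCoordinate (p₀ : Coord) (hp₀ : nearEnd i p₀ ≤ 1) :
    ∃ (g : ℝ × ℝ → ℝ) (W : Set Coord), IsOpen W ∧ p₀ ∈ W ∧ (∀ p ∈ W, |p.1 - p₀.1| < 1 / 2) ∧
      ∀ p ∈ W, PL id g p.2 ∧ (nearEnd i p ≤ 1 ↔ orient i * p.1 + g p.2 ∈ Icc (0 : ℝ) 1) ∧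
        (orient i * p.1 + g p.2 = 0 ↔ i = false ∧ nearEnd i p = 1) ∧
        (orient i * p.1 + g p.2 = 1 ↔ i = true ∧ nearEnd i p = 1) := by
  have hd : IsOpen {p : Coord | |p.1 - p₀.1| < 1 / 2} :=
    isOpen_lt (by fun_prop) continuous_const
  rcases hp₀.lt_or_eq with h | h
  -- Away from the end, a constant shift puts the base point at height `1 / 2`, and the window of
  -- radius `1 / 2` stays strictly between the faces.
  · refine ⟨fun _ => 1 / 2 - orient i * p₀.1, {p | |p.1 - p₀.1| < 1 / 2} ∩ {p | nearEnd i p < 1},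
      hd.inter (isOpen_lt (continuous_nearEnd i) continuous_const), ⟨by simp, h⟩, fun p hp => hp.1,
      ?_⟩
    rintro p ⟨hp, hp'⟩
    simp only [mem_ofPred_eq] at hp hp'
    rw [abs_lt] at hp
    refine ⟨PL.const _, ?_, ?_, ?_⟩
    · simp only [hp'.le, true_iff]
      cases i <;> simp only [orient, Bool.false_eq_true, if_false, if_true] <;>
        constructor <;> linarith
    · simp only [hp'.ne, and_false, iff_false]
      cases i <;> simp only [orient, Bool.false_eq_true, if_false, if_true] <;>
        intro h <;> linarith
    · simp only [hp'.ne, and_false, iff_false]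
      cases i <;> simp only [orient, Bool.false_eq_true, if_false, if_true] <;>
        intro h <;> linarith
  -- At the end, the coordinate is `t - plog A` in the entry piece and `1 - (t - plog A)` in the
  -- exit piece, so the end is the face 0 or 1 respectively. The second condition on the window says
  -- `t - plog A < 1`, which excludes the opposite face.
  · refine ⟨fun q => -orient i * plog (labelA i q) + if i then 1 else 0,
      {p | |p.1 - p₀.1| < 1 / 2} ∩ {p | Real.exp (p.1 - 1) < eplog (labelA i p.2)},
      hd.inter (isOpen_lt (by fun_prop)
        (continuous_eplog.comp ((continuous_labelA i).comp continuous_snd))), ⟨by simp, ?_⟩,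
      fun p hp => hp.1, ?_⟩
    · rw [nearEnd, Real.exp_neg, ← div_eq_mul_inv, div_eq_one_iff_eq (Real.exp_ne_zero _)] at h
      simp [h]
    rintro p ⟨-, hp'⟩
    simp only [mem_ofPred_eq] at hp'
    have hA : 0 < labelA i p.2 := eplog_pos_iff.1 ((Real.exp_pos _).trans hp')
    rw [eplog_of_pos hA, Real.exp_lt_exp] at hp'
    have hE : nearEnd i p = Real.exp (plog (labelA i p.2) - p.1) := by
      rw [nearEnd, eplog_of_pos hA, ← Real.exp_add, sub_eq_add_neg]
    refine ⟨((PL.plog_labelA hA).mul _).add (PL.const _), ?_, ?_, ?_⟩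
    · rw [hE, Real.exp_le_one_iff]
      cases i <;> simp only [orient, Bool.false_eq_true, if_false, if_true, mem_Icc] <;>
        constructor
      · intro; constructor <;> linarith
      · rintro ⟨_, _⟩; linarith
      · intro; constructor <;> linarith
      · rintro ⟨_, _⟩; linarith
    · rw [hE, Real.exp_eq_one_iff]
      cases i <;> simp only [orient, Bool.false_eq_true, if_false, if_true, true_and, false_and,
        iff_false, reduceCtorEq] <;> try constructor
      all_goals intro; linarith
    · rw [hE, Real.exp_eq_one_iff]
      cases i <;> simp only [orient, Bool.false_eq_true, if_false, if_true, true_and, false_and,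
        iff_false] <;> try constructor
      all_goals intro; linarith

theorem toLabels_fromLabels {w : ℝ} (hw : w ≠ 0) (v : ℝ × ℝ) : toLabels w (fromLabels w v) = v := by
  simp only [toLabels, fromLabels, mul_div_cancel_left₀ _ hw]
  refine Prod.ext ?_ ?_
  · rcases le_total v.1 v.2 with h | h
    · simp [h]
    · simp [h]
  · rcases le_total v.1 v.2 with h | h
    · simp [h]
    · simp [h]

theorem fromLabels_toLabels {w : ℝ} (hw : w ≠ 0) (q : ℝ × ℝ) : fromLabels w (toLabels w q) = q := by
  simp only [toLabels, fromLabels]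
  refine Prod.ext ?_ ?_
  · rw [min_add_add_left]
    rcases le_total 0 q.2 with h | h
    · simp [h, mul_div_cancel₀ _ hw]
    · simp [h, mul_div_cancel₀ _ hw]
  · rcases le_total 0 q.2 with h | h
    · simp [h]
    · simp [h]

theorem abs_leafInv {q : ℝ × ℝ} (h : q.1 ≠ 0) :
    |leafInv i q| = Real.exp (plog (labelA i q) + plog (|sideWidth i q.1| * labelB i q)) := by
  obtain ⟨hA, hB⟩ := labels_pos_of_fst (i := i) h
  have hw := width_pos i
  unfold leafInv sideWidth
  split_ifs
  · rw [abs_of_pos hw, eplog_of_pos hA, eplog_of_pos (mul_pos hw hB), ← Real.exp_add,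
      abs_of_pos (Real.exp_pos _)]
  · rw [abs_neg, abs_neg, abs_one, one_mul, eplog_of_pos hA, eplog_of_pos hB, ← Real.exp_add,
      abs_of_pos (Real.exp_pos _)]

/-- Transverse coordinates near a point of a piece. -/
theorem exists_transverseCoordinates (q₀ : ℝ × ℝ) (hq₀ : |leafInv i q₀| ≤ 1) :
    ∃ β : OpenPartialHomeomorph (ℝ × ℝ) (ℝ × ℝ), q₀ ∈ β.source ∧ ∀ q ∈ β.source,
      PLWith (AreaFactor 1) id β q ∧ (|leafInv i q| ≤ 1 ↔ 0 ≤ (β q).1) ∧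
        ((β q).1 = 0 ↔ |leafInv i q| = 1) := by
  rcases hq₀.lt_or_eq with h | h
  · have ho : IsOpen ({q | |leafInv i q| < 1} ∩ {q | q₀.1 - 1 < q.1}) :=
      (isOpen_lt (continuous_leafInv i).abs continuous_const).inter
        (isOpen_lt continuous_const continuous_fst)
    -- Away from the parallel boundary, a translation takes `q₀` to first coordinate 1, and the
    -- window keeps the first coordinate positive.
    refine ⟨(Homeomorph.addRight ((1 - q₀.1, 0) : ℝ × ℝ)).toOpenPartialHomeomorph.restrOpen _ ho,
      ?_, ?_⟩
    · simpa using h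
    · intro q hq
      have hq' : |leafInv i q| < 1 ∧ q₀.1 - 1 < q.1 := by simpa using hq
      have e : ((Homeomorph.addRight ((1 - q₀.1, 0) : ℝ × ℝ)).toOpenPartialHomeomorph.restrOpen _
          ho)
        q = (q.1 + (1 - q₀.1), q.2) := by
        simp [Prod.ext_iff]
      refine ⟨PLWith.planeMap 1 0 0 1 (1 - q₀.1) 0 (by simp) (.of_forall fun q => ?_), ?_, ?_⟩
      · simp [Prod.ext_iff]
      · rw [e]
        simp only [hq'.1.le, true_iff]
        linarith
      · rw [e]
        simp only [hq'.1.ne, iff_false]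
        intro h
        linarith
  · have h0 : q₀.1 ≠ 0 := by
      intro h'
      rw [(leafInv_eq_zero_iff (i := i)).2 h'] at h
      norm_num at h
    set w := sideWidth i q₀.1 with hw
    have hw0 : w ≠ 0 := sideWidth_ne_zero _ _
    have hN : ∀ q : ℝ × ℝ, 0 < q.1 / w → q.1 ≠ 0 ∧ (0 ≤ q₀.1 ↔ 0 ≤ q.1) ∧
        (labelA i q, labelB i q) = toLabels w q ∧
        0 < (toLabels w q).1 ∧ 0 < (toLabels w q).2 ∧ |leafInv i q| =
          Real.exp (plog (toLabels w q).1 + plog (|w| * (toLabels w q).2)) := by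
      intro q hq
      have h1 : q.1 ≠ 0 := by
        rintro h1
        simp [h1] at hq
      have h2 : 0 ≤ q₀.1 ↔ 0 ≤ q.1 := by
        rw [hw, sideWidth] at hq
        split_ifs at hq with h3
        · simp only [h3, true_iff]
          exact ((div_pos_iff_of_pos_right (width_pos i)).1 hq).le
        · simp only [h3, false_iff, not_le]
          rw [div_neg, div_one] at hq
          linarith
      have h3 := labels_eq (i := i) h2
      have hA : (toLabels w q).1 = labelA i q := by rw [hw, ← h3]
      have hB : (toLabels w q).2 = labelB i q := by rw [hw, ← h3]
      have h4 := labels_pos_of_fst (i := i) h1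
      refine ⟨h1, h2, h3, hA ▸ h4.1, hB ▸ h4.2, ?_⟩
      rw [abs_leafInv h1, hA, hB]
      have : sideWidth i q.1 = w := by
        simp only [hw, sideWidth, h2]
      rw [this]
    have haw : 0 < |w| := abs_pos.2 hw0
    -- In label coordinates the curve `|leafInv| = 1` is `plog A + plog (|w| B) = 0`, that is, the
    -- PL graph `|w| B = k A`. The shear `S` turns it into the line where the first coordinate is 0,
    -- and its area factor `|w|` undoes that of `toLabels`.
    set k : ℝ → ℝ := fun A => pexp (-plog A) with hk
    have hkPL : ∀ A : ℝ, 0 < A → PL id k A := fun A hA =>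
      PL.pexp (PL.plog (c := id) (f := id) PL.refl continuousAt_id hA).neg (continuousAt_plog
          hA).neg
    have hkc : ∀ A : ℝ, 0 < A → ContinuousAt k A := fun A hA =>
      (hkPL A hA).continuousAt continuousAt_id
    let S : ℝ × ℝ → ℝ × ℝ := fun v => (k v.1 - |w| * v.2, v.1)
    let S' : ℝ × ℝ → ℝ × ℝ := fun v => (v.2, (k v.2 - v.1) / |w|)
    have hSS' : ∀ v, S (S' v) = v := by
      intro v
      refine Prod.ext ?_ rfl
      simp only [S, S']
      rw [mul_div_cancel₀ _ haw.ne']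
      ring
    have hS'S : ∀ v, S' (S v) = v := by
      intro v
      refine Prod.ext rfl ?_
      simp only [S, S', sub_sub_cancel]
      rw [mul_div_cancel_left₀ _ haw.ne']
    have hfst : ∀ v, (fromLabels w v).1 / w = min v.1 v.2 := fun v => by
      rw [fromLabels, mul_div_cancel_left₀ _ hw0]
    let β : OpenPartialHomeomorph (ℝ × ℝ) (ℝ × ℝ) :=
      { toFun := fun q => S (toLabels w q)
        invFun := fun v => fromLabels w (S' v)
        source := {q | 0 < q.1 / w}
        target := {v | 0 < v.2 ∧ v.1 < k v.2}
        map_source' := by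
          intro q hq
          obtain ⟨-, -, -, h1, h2, -⟩ := hN q hq
          refine ⟨h1, ?_⟩
          have := mul_pos haw h2
          simp only [S]
          linarith
        map_target' := by
          rintro v ⟨h1, h2⟩
          change (0 : ℝ) < (fromLabels w (S' v)).1 / w
          rw [hfst]
          exact lt_min h1 (div_pos (by linarith) haw)
        left_inv' := fun q _ => by rw [hS'S, fromLabels_toLabels hw0]
        right_inv' := fun v _ => by rw [toLabels_fromLabels hw0, hSS']
        open_source := isOpen_lt continuous_const (by fun_prop)
        open_target := by
          rw [isOpen_iff_mem_nhds]
          rintro v ⟨h1, h2⟩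
          have h3 : ContinuousAt (fun v : ℝ × ℝ => k v.2) v :=
            ContinuousAt.comp (g := k) (hkc _ h1) continuousAt_snd
          exact inter_mem (continuousAt_snd.eventually (lt_mem_nhds h1))
            (continuousAt_fst.eventually_lt h3 h2)
        continuousOn_toFun := by
          intro q hq
          have hc := (continuous_toLabels w).continuousAt (x := q)
          have h3 : ContinuousAt (fun q => k (toLabels w q).1) q :=
            ContinuousAt.comp (g := k) (f := fun q => (toLabels w q).1) (hkc _ (hN q hq).2.2.2.1)
              hc.fst
          exact ((h3.sub (continuousAt_const.mul hc.snd)).prodMk hc.fst).continuousWithinAt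
        continuousOn_invFun := by
          rintro v ⟨h1, -⟩
          have h3 : ContinuousAt (fun v : ℝ × ℝ => k v.2) v :=
            ContinuousAt.comp (g := k) (hkc _ h1) continuousAt_snd
          have h4 : ContinuousAt S' v :=
            continuousAt_snd.prodMk ((h3.sub continuousAt_fst).div_const _)
          exact (ContinuousAt.comp (continuous_fromLabels w).continuousAt h4).continuousWithinAt }
    refine ⟨β, ?_, ?_⟩
    · change (0 : ℝ) < q₀.1 / w
      rw [hw, sideWidth]
      split_ifs with h3
      · exact div_pos (lt_of_le_of_ne h3 h0.symm) (width_pos i)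
      · rw [div_neg, div_one]
        linarith
    · intro q hq
      obtain ⟨-, -, -, h1, h2, h3⟩ := hN q hq
      have h4 := mul_pos haw h2
      have hβ : (β q).1 = k (toLabels w q).1 - |w| * (toLabels w q).2 := rfl
      refine ⟨?_, ?_, ?_⟩
      · refine PLWith.trans (fun A B => AreaFactor.comp (d := |w|⁻¹) (e := |w|)
          (by rw [mul_inv_cancel₀ haw.ne']) A B) (plWith_toLabels w q) ?_
        have := plWith_shear (v := toLabels w q) (hkPL _ h1) |w|
        rw [abs_abs] at this
        exact this.comap (continuous_toLabels w).continuousAt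
      · rw [h3, hβ, Real.exp_le_one_iff, sub_nonneg, ← plog_le_iff h4 (pexp_pos _), plog_pexp]
        constructor <;> intro <;> linarith
      · rw [h3, hβ, Real.exp_eq_one_iff, sub_eq_zero]
        constructor
        · intro h
          have := plog_pexp (-plog (toLabels w q).1)
          simp only [hk] at h
          rw [h] at this
          linarith
        · intro h
          refine plog_inj (pexp_pos _) h4 ?_
          rw [plog_pexp]
          linarith

theorem exists_chart_at (P : Support) :
    ∃ e : OpenPartialHomeomorph Support Model, P ∈ e.source ∧ Nonempty (ChartData e) := by
  obtain ⟨i, p₀, hp₀, -, rfl⟩ := exists_halfMap_eq P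
  rw [← pieceMap_of_le hp₀.2.1]
  obtain ⟨g, W, hWo, hpW, hWt, hW⟩ := exists_leafCoordinate p₀ hp₀.1
  obtain ⟨β, hqβ, hβ⟩ := exists_transverseCoordinates p₀.2 hp₀.2.2
  refine exists_chart i β g (W := W ∩ (Prod.snd ⁻¹' β.source ∩ {p | nearMid i p < Real.exp 1}))
    (hWo.inter ((β.open_source.preimage continuous_snd).inter
      (isOpen_lt (continuous_nearMid i) continuous_const))) (fun p hp => hp.2.1) ?_ ?_ ?_ ?_ ?_ ?_
    ⟨hpW, hqβ, (halfPiece_subset hp₀).2.1⟩ (halfPiece_subset hp₀)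
  · exact fun p hp => ⟨(hW p hp.1).1, (hβ _ hp.2.1).1, β.source,
      β.open_source.mem_nhds hp.2.1, β.injOn⟩
  · intro p hp p' hp'
    have h1 := abs_lt.1 (hWt p hp.1)
    have h2 := abs_lt.1 (hWt p' hp'.1)
    rw [abs_lt]
    constructor <;> linarith [h1.1, h1.2, h2.1, h2.2]
  · rintro p ⟨hp, hp1, hp2⟩
    rw [← (hW p hp).2.1, ← (hβ _ hp1).2.1]
    exact ⟨fun h => ⟨h.1, h.2.2⟩, fun h => ⟨h.1, hp2, h.2⟩⟩
  · exact fun p hp _ => (hW p hp.1).2.2.1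
  · exact fun p hp _ => (hW p hp.1).2.2.2
  · exact fun p hp _ => (hβ _ hp.2.1).2.2

end construction

/-- The foliation of the plug. -/
def plugFoliation : MeasuredPLFoliation Support where
  atlas := {e | Nonempty (ChartData e)}
  cover := fun P => (exists_chart_at P).imp fun _ h => ⟨h.2, h.1⟩
  foliated := fun _ ⟨d⟩ _ ⟨d'⟩ _ hP => (d.transition d' hP.1 hP.2).foliatedPLAt
  measured := fun _ ⟨d⟩ _ ⟨d'⟩ _ hP => (d.transition d' hP.1 hP.2).transverselyMeasuredAt

end

section

/-! ### Boundary and leaves -/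

variable {i : Bool} {p : Coord} {P Q : Support}

theorem position_ne_neg_one_of_switch (hp : p ∈ piece i) (h : 1 ≤ nearMid i p) :
    position (!i) (switch i p) ≠ -1 := by
  rw [Ne, position_eq_neg_one_iff (switch_mem_halfPiece hp h)]
  exact (nearEnd_switch_lt hp (labelB_pos_of_nearMid (one_pos.trans_le h))).ne

theorem pieceMap_level_eq_neg_one (hp : p ∈ piece i) :
    ((pieceMap i p).2.2 : ℝ) = -1 ↔ i = false ∧ nearEnd i p = 1 := by
  rcases le_total (nearMid i p) 1 with h | h
  · have h' := mem_halfPiece hp h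
    rw [pieceMap_of_le h, coe_halfMap_level h', ← position_eq_neg_one_iff h']
    have := position_mem h'
    cases i <;> simp only [level, Bool.false_eq_true, if_false, if_true, true_and, false_and,
      reduceCtorEq, iff_false]
    · constructor <;> intro <;> linarith
    · intro h
      linarith [this.2]
  · have h' := switch_mem_halfPiece hp h
    have h2 := position_ne_neg_one_of_switch hp h
    rw [pieceMap_of_ge hp h, coe_halfMap_level h']
    have := position_mem h'
    have hE : nearEnd i p ≠ 1 := by
      intro hE
      have h3 := nearEnd_mul_nearMid_lt (i := i) hp.2.2
      rw [hE] at h3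
      linarith
    simp only [hE, and_false, iff_false]
    cases i <;> simp only [level, Bool.false_eq_true, if_false, if_true, Bool.not_false,
      Bool.not_true] at *
    · intro h
      linarith [this.2]
    · exact fun h => h2 (by linarith)

theorem pieceMap_level_eq_one (hp : p ∈ piece i) :
    ((pieceMap i p).2.2 : ℝ) = 1 ↔ i = true ∧ nearEnd i p = 1 := by
  rcases le_total (nearMid i p) 1 with h | h
  · have h' := mem_halfPiece hp h
    rw [pieceMap_of_le h, coe_halfMap_level h', ← position_eq_neg_one_iff h']
    have := position_mem h'
    cases i <;> simp only [level, Bool.false_eq_true, if_false, if_true, true_and, false_and,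
      iff_false]
    · intro h
      linarith [this.2]
    · constructor <;> intro <;> linarith
  · have h' := switch_mem_halfPiece hp h
    have h2 := position_ne_neg_one_of_switch hp h
    rw [pieceMap_of_ge hp h, coe_halfMap_level h']
    have := position_mem h'
    have hE : nearEnd i p ≠ 1 := by
      intro hE
      have h3 := nearEnd_mul_nearMid_lt (i := i) hp.2.2
      rw [hE] at h3
      linarith
    simp only [hE, and_false, iff_false]
    cases i <;> simp only [level, Bool.false_eq_true, if_false, if_true, Bool.not_false,
      Bool.not_true] at *
    · exact fun h => h2 (by linarith)
    · intro h
      linarith [this.2]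

theorem mem_entry : P ∈ plugFoliation.entry ↔ (P.2.2 : ℝ) = -1 := by
  constructor
  · rintro ⟨e, ⟨d⟩, hP, h⟩
    rw [← d.pieceMap_lift P hP, pieceMap_level_eq_neg_one (d.lift_mem P hP)]
    exact (d.entry_iff P hP).1 h
  · intro h
    obtain ⟨e, hP, ⟨d⟩⟩ := exists_chart_at P
    rw [← d.pieceMap_lift P hP, pieceMap_level_eq_neg_one (d.lift_mem P hP)] at h
    exact ⟨e, ⟨d⟩, hP, (d.entry_iff P hP).2 h⟩

theorem mem_exit : P ∈ plugFoliation.exit ↔ (P.2.2 : ℝ) = 1 := by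
  constructor
  · rintro ⟨e, ⟨d⟩, hP, h⟩
    rw [← d.pieceMap_lift P hP, pieceMap_level_eq_one (d.lift_mem P hP)]
    exact (d.exit_iff P hP).1 h
  · intro h
    obtain ⟨e, hP, ⟨d⟩⟩ := exists_chart_at P
    rw [← d.pieceMap_lift P hP, pieceMap_level_eq_one (d.lift_mem P hP)] at h
    exact ⟨e, ⟨d⟩, hP, (d.exit_iff P hP).2 h⟩

theorem mem_parallel : P ∈ plugFoliation.parallel ↔ |(P.2.1 : ℝ)| = 1 := by
  constructor
  · rintro ⟨e, ⟨d⟩, hP, h⟩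
    rw [← d.pieceMap_lift P hP, coe_pieceMap_inv (d.lift_mem P hP)]
    exact (d.parallel_iff P hP).1 h
  · intro h
    obtain ⟨e, hP, ⟨d⟩⟩ := exists_chart_at P
    rw [← d.pieceMap_lift P hP, coe_pieceMap_inv (d.lift_mem P hP)] at h
    exact ⟨e, ⟨d⟩, hP, (d.parallel_iff P hP).2 h⟩

theorem mem_boundary : P ∈ plugFoliation.boundary ↔
    (P.2.2 : ℝ) = -1 ∨ (P.2.2 : ℝ) = 1 ∨ |(P.2.1 : ℝ)| = 1 := by
  rw [MeasuredPLFoliation.boundary, mem_union, mem_union, mem_entry, mem_exit, mem_parallel,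
    or_assoc]

/-! ### Leaves as lines in the unrolled pieces -/

theorem nearEnd_anti {t t' : ℝ} (h : t ≤ t') (q : ℝ × ℝ) : nearEnd i (t', q) ≤ nearEnd i (t, q) :=
  mul_le_mul_of_nonneg_left (Real.exp_le_exp.2 (neg_le_neg h)) (eplog_nonneg _)

theorem nearMid_mono {t t' : ℝ} (h : t ≤ t') (q : ℝ × ℝ) : nearMid i (t, q) ≤ nearMid i (t', q) :=
  mul_le_mul_of_nonneg_left (Real.exp_le_exp.2 (sub_le_sub_right h 1)) (eplog_nonneg _)

/-- Of the three conditions, one holds from some time on, one holds up to some time, and one does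
not depend on time. -/
theorem ordConnected_line (i : Bool) (q : ℝ × ℝ) : OrdConnected {t : ℝ | (t, q) ∈ piece i} :=
  ⟨fun _ ha _ hb _ hc => ⟨(nearEnd_anti hc.1 q).trans ha.1, (nearMid_mono hc.2 q).trans_lt hb.2.1,
    ha.2.2⟩⟩

theorem eventually_samePlaque {q : ℝ × ℝ} (t : {t : ℝ | (t, q) ∈ piece i}) :
    ∀ᶠ s : {t : ℝ | (t, q) ∈ piece i} in 𝓝 t,
      plugFoliation.SamePlaque (pieceMap i (t, q)) (pieceMap i (s, q)) := by
  obtain ⟨e, hP, ⟨d⟩⟩ := exists_chart_at (pieceMap i (t, q))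
  set u : {t : ℝ | (t, q) ∈ piece i} → Support := fun s => pieceMap i (s, q) with hu
  have huc : Continuous u := (continuousOn_pieceMap i).comp_continuous
    (continuous_subtype_val.prodMk continuous_const) fun s => s.2
  have hT := (d.transition_of_lift (x := t) hP huc.continuousAt rfl (i := i)
    (v := fun s : {t : ℝ | (t, q) ∈ piece i} => ((s : ℝ), q))
    (continuous_subtype_val.prodMk continuous_const).continuousAt
    (.of_forall fun s => s.2) (.of_forall fun s => rfl)).1
  obtain ⟨b, hb⟩ := hT.pl.exists_fun
  have htarget : e.target ∈ 𝓝 (e (u t)) := e.open_target.mem_nhds (e.map_source hP)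
  -- A plaque must contain the whole segment between its points. A product neighbourhood with a ball
  -- in the leaf coordinate lies in the target and contains such segments.
  rw [← Prod.mk.eta (p := e (u t)), nhds_prod_eq, mem_prod_iff] at htarget
  obtain ⟨V, hV, V', hV', hVV'⟩ := htarget
  obtain ⟨ε, hε, hεV⟩ := Metric.mem_nhds_iff.1 hV
  have hsrc : ∀ᶠ s in 𝓝 t, u s ∈ e.source := huc.continuousAt (e.open_source.mem_nhds hP)
  have hec : ContinuousAt (fun s => (e (u s)).1) t :=
    (ContinuousAt.comp (f := u) (e.continuousAt hP) huc.continuousAt).fst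
  filter_upwards [hsrc, hb, hec.eventually (Metric.ball_mem_nhds _ hε)] with s hs hbs hds
  have h0 := hb.self_of_nhds
  have h2 : (coords e (u t)).2 = (coords e (u s)).2 :=
    (congrArg Prod.snd h0).trans (congrArg Prod.snd hbs).symm
  have h3 : (e (u t)).2 = (e (u s)).2 :=
    Prod.ext (Subtype.ext (congrArg Prod.fst h2)) (congrArg Prod.snd h2 :)
  refine ⟨e, ⟨d⟩, hP, hs, h3, fun τ hτ => hVV' ⟨hεV ?_, mem_of_mem_nhds hV'⟩⟩
  have hτ' : (τ : ℝ) ∈ uIcc ((e (u t)).1 : ℝ) ((e (u s)).1 : ℝ) := by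
    rw [mem_uIcc] at hτ ⊢
    exact hτ
  rw [Subtype.dist_eq, Real.dist_eq] at hds
  rw [Metric.mem_ball, Subtype.dist_eq, Real.dist_eq]
  exact (abs_sub_left_of_mem_uIcc hτ').trans_lt hds

/-- The relation is open along the line by `eventually_samePlaque`, and the line meets the piece in
a connected set. -/
theorem sameLeaf_of_line {t t' : ℝ} {q : ℝ × ℝ} (h : (t, q) ∈ piece i) (h' : (t', q) ∈ piece i) :
    plugFoliation.SameLeaf (pieceMap i (t, q)) (pieceMap i (t', q)) := by
  have : PreconnectedSpace {t : ℝ | (t, q) ∈ piece i} :=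
    Subtype.preconnectedSpace (ordConnected_line i q).isPreconnected
  let R : {t : ℝ | (t, q) ∈ piece i} → {t : ℝ | (t, q) ∈ piece i} → Prop := fun s s' =>
    plugFoliation.SameLeaf (pieceMap i (s, q)) (pieceMap i (s', q))
  have : Std.Symm R := ⟨fun _ _ => .symm _ _⟩
  exact PreconnectedSpace.induction₂ R (fun s => (eventually_samePlaque s).mono fun s' => .rel _ _)
    ⟨fun _ _ _ => .trans _ _ _⟩ ⟨t, h⟩ ⟨t', h'⟩

theorem sameLeaf_of_snd_eq {p p' : Coord} (h : p ∈ piece i) (h' : p' ∈ piece i) (e : p.2 = p'.2) :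
    plugFoliation.SameLeaf (pieceMap i p) (pieceMap i p') := by
  obtain ⟨t, q⟩ := p
  obtain ⟨t', q'⟩ := p'
  obtain rfl : q = q' := e
  exact sameLeaf_of_line h h'

theorem exists_lifts_of_samePlaque (h : plugFoliation.SamePlaque P Q) :
    ∃ i, ∃ p ∈ piece i, ∃ p' ∈ piece i, pieceMap i p = P ∧ pieceMap i p' = Q ∧ p.2 = p'.2 := by
  obtain ⟨e, ⟨d⟩, hP, hQ, h, -⟩ := h
  refine ⟨d.side, _, d.lift_mem P hP, _, d.lift_mem Q hQ, d.pieceMap_lift P hP, d.pieceMap_lift Q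
      hQ,
    d.injOn P hP Q hQ ?_⟩
  have h1 : (coords e P).2 = (coords e Q).2 := by
    simp only [coords, h]
  rwa [d.coords_eq P hP, d.coords_eq Q hQ] at h1

/-- The points of the support whose lifts have transverse coordinates satisfying `R`. -/
def saturation (R : Bool → ℝ × ℝ → Prop) : Set Support :=
  {P | ∃ i, ∃ p ∈ piece i, pieceMap i p = P ∧ R i p.2}

/-- A condition on the transverse coordinates that is compatible with the identifications. -/
structure IsLeafwise (R : Bool → ℝ × ℝ → Prop) : Prop where
  returnMap : ∀ i n q, R i q → R i (returnMap i n q)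
  switchMap : ∀ i q, 0 < labelB i q → R i q → R (!i) (switchMap i q)

theorem IsLeafwise.of_mem {R : Bool → ℝ × ℝ → Prop} (hR : IsLeafwise R) (hp : p ∈ piece i)
    (h : pieceMap i p ∈ saturation R) : R i p.2 := by
  obtain ⟨j, p', hp', e, hr⟩ := h
  by_cases hij : i = j
  · subst hij
    obtain ⟨n, rfl⟩ := deck_of_pieceMap_eq hp' hp e
    exact hR.returnMap _ _ _ hr
  · obtain rfl : i = !j := Bool.eq_not.2 hij
    obtain ⟨hm, n, rfl⟩ := deck_switch_of_halfMap_eq hp' hp e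
    exact hR.returnMap _ _ _
      (hR.switchMap _ _ (labelB_pos_of_nearMid ((Real.exp_pos _).trans hm)) hr)

theorem IsLeafwise.mem_iff {R : Bool → ℝ × ℝ → Prop} (hR : IsLeafwise R) (hp : p ∈ piece i) :
    pieceMap i p ∈ saturation R ↔ R i p.2 :=
  ⟨hR.of_mem hp, fun h => ⟨i, p, hp, rfl, h⟩⟩

theorem IsLeafwise.mem_iff_of_sameLeaf {R : Bool → ℝ × ℝ → Prop} (hR : IsLeafwise R)
    (h : plugFoliation.SameLeaf P Q) : P ∈ saturation R ↔ Q ∈ saturation R := by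
  induction h with
  | rel P Q h =>
    obtain ⟨i, p, hp, p', hp', rfl, rfl, e⟩ := exists_lifts_of_samePlaque h
    rw [hR.mem_iff hp, hR.mem_iff hp', e]
  | refl P => rfl
  | symm P Q _ h => exact h.symm
  | trans P Q S _ _ h h' => exact h.trans h'

theorem isLeafwise_leafInv (c : ℝ) : IsLeafwise fun i q => leafInv i q = c :=
  ⟨fun i n q h => by rw [leafInv_returnMap, h], fun i q _ h => by rw [leafInv_switchMap, h]⟩

/-- The return map fixes the origin, and the switch never applies there because `B = 0`. -/
theorem isLeafwise_core (i : Bool) : IsLeafwise fun j q => j = i ∧ q = 0 := by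
  constructor
  · rintro j n q ⟨rfl, rfl⟩
    refine ⟨rfl, ?_⟩
    simp [returnMap, ofLabels, labelA, labelB, labelMin]
  · rintro j q h ⟨rfl, rfl⟩
    simp [labelB, labelMin] at h

/-- Leaves that start on the lower half of the axis keep `B = 0`, hence never reach the interface
and stay in the entry piece. This excludes them as partners of an exit point. -/
theorem isLeafwise_entryAxis :
    IsLeafwise fun i q => i = false ∧ labelB i q = 0 ∧ 0 < labelA i q := by
  constructor
  · rintro i n q ⟨rfl, h1, h2⟩
    refine ⟨rfl, ?_, ?_⟩
    · rw [labelB_returnMap, h1, mul_zero]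
    · rw [labelA_returnMap]
      exact div_pos h2 (two_zpow_pos n)
  · rintro i q h ⟨-, h1, -⟩
    exact absurd h1 h.ne'

theorem coe_sub_intCast (x : ℝ) (n : ℤ) : ((x - n : ℝ) : UnitAddCircle) = (x : ℝ) := by
  rw [AddCircle.coe_sub, sub_eq_self, AddCircle.coe_eq_zero_iff]
  exact ⟨n, by simp⟩

theorem coe_add_intCast (x : ℝ) (n : ℤ) : ((x + n : ℝ) : UnitAddCircle) = (x : ℝ) := by
  have := coe_sub_intCast x (-n)
  push_cast at this
  rwa [sub_neg_eq_add] at this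

/-- All identifications multiply `A` by a power of two, which shifts `plog A` by an integer. This
class is the angle at which the leaf enters and also the one at which it exits. -/
theorem isLeafwise_angle (c : UnitAddCircle) :
    IsLeafwise fun i q => q.1 ≠ 0 ∧ ((plog (labelA i q) : ℝ) : UnitAddCircle) = c := by
  constructor
  · rintro i n q ⟨h0, h⟩
    refine ⟨by rwa [Ne, returnMap_fst_eq_zero], ?_⟩
    have hA := (labels_pos_of_fst (i := i) h0).1
    rw [labelA_returnMap, div_eq_inv_mul, ← zpow_neg, plog_zpow_mul _ hA, coe_add_intCast, h]
  · rintro i q - ⟨h0, h⟩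
    refine ⟨by rwa [Ne, switchMap_fst_eq_zero], ?_⟩
    have hA := (labels_pos_of_fst (i := i) h0).1
    rw [labelA_switchMap, sideScale]
    split_ifs
    · cases i
      · simp only [width, Bool.not_false, if_true, Bool.false_eq_true, if_false]
        have : 1 / 2 * labelA false q = 2 ^ (-1 : ℤ) * labelA false q := by norm_num
        rw [this, plog_zpow_mul _ hA, coe_add_intCast, h]
      · simp only [width, Bool.not_true, if_true, Bool.false_eq_true, if_false, div_one]
        have : 2 * labelA true q = 2 ^ (1 : ℤ) * labelA true q := by norm_num
        rw [this, plog_zpow_mul _ hA, coe_add_intCast, h]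
    · rw [one_mul, h]

/-- The closed leaf in the middle of the piece `i`. -/
def core (i : Bool) : Set Support := saturation fun j q => j = i ∧ q = 0

/-! ### The closed leaves -/

theorem zero_mem_piece (i : Bool) (t : ℝ) : (t, (0, 0)) ∈ halfPiece i := by
  simp [halfPiece, nearEnd, nearMid, labelA, labelB, labelMin, leafInv]

theorem core_eq (i : Bool) : core i = range fun t : ℝ => pieceMap i (t, (0, 0)) := by
  ext P
  constructor
  · rintro ⟨j, p, hp, rfl, rfl, h⟩
    obtain ⟨t, q⟩ := p
    obtain rfl : q = (0, 0) := h
    exact ⟨t, rfl⟩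
  · rintro ⟨t, rfl⟩
    exact ⟨i, _, halfPiece_subset (zero_mem_piece i t), rfl, rfl, rfl⟩

theorem core_eq_leaf (i : Bool) (t : ℝ) : core i = plugFoliation.leaf (pieceMap i (t, (0, 0))) := by
  have h0 : ∀ t, pieceMap i (t, (0, 0)) ∈ core i := fun t => by
    rw [core_eq]
    exact ⟨t, rfl⟩
  ext P
  constructor
  · rw [core_eq]
    rintro ⟨s, rfl⟩
    exact sameLeaf_of_line (halfPiece_subset (zero_mem_piece i t))
      (halfPiece_subset (zero_mem_piece i s))
  · intro h
    exact ((isLeafwise_core i).mem_iff_of_sameLeaf h).1 (h0 t)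

theorem core_eq_image (i : Bool) :
    core i = (fun t : ℝ => pieceMap i (t, (0, 0))) '' Icc 0 1 := by
  rw [core_eq]
  refine subset_antisymm ?_ (image_subset_range _ _)
  rintro _ ⟨t, rfl⟩
  refine ⟨Int.fract t, ⟨Int.fract_nonneg t, (Int.fract_lt_one t).le⟩, ?_⟩
  have := pieceMap_deck (i := i) (n := ⌊t⌋) (p := (t, (0, 0)))
  simp only [deck, Int.self_sub_floor] at this
  rw [((isLeafwise_core i).returnMap i ⌊t⌋ (0, 0) ⟨rfl, rfl⟩).2] at this
  exact this

theorem isCompact_core (i : Bool) : IsCompact (core i) := by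
  rw [core_eq_image]
  refine isCompact_Icc.image ((continuousOn_pieceMap i).comp_continuous ?_ fun t =>
    halfPiece_subset (zero_mem_piece i t))
  fun_prop

theorem level_of_mem_core (h : P ∈ core i) : (P.2.2 : ℝ) = if i then 1 / 2 else -1 / 2 := by
  rw [core_eq] at h
  obtain ⟨t, rfl⟩ := h
  have h := zero_mem_piece i t
  simp only
  rw [pieceMap_of_le h.2.1, coe_halfMap_level h]
  simp [level, position, nearEnd, nearMid, labelA, labelB, labelMin]

theorem isClosedLeaf_core (i : Bool) : plugFoliation.IsClosedLeaf (core i) := by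
  refine ⟨⟨_, core_eq_leaf i 0⟩, isCompact_core i, ?_, ?_⟩
  · rw [eq_empty_iff_forall_notMem]
    rintro P ⟨h1, h2⟩
    rw [mem_entry, level_of_mem_core h1] at h2
    split_ifs at h2 <;> norm_num at h2
  · rw [eq_empty_iff_forall_notMem]
    rintro P ⟨h1, h2⟩
    rw [mem_exit, level_of_mem_core h1] at h2
    split_ifs at h2 <;> norm_num at h2

theorem core_ne : core false ≠ core true := by
  intro h
  have h1 : pieceMap false (0, (0, 0)) ∈ core false := by
    rw [core_eq]
    exact ⟨0, rfl⟩
  have h2 := level_of_mem_core h1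
  have h3 := level_of_mem_core (h ▸ h1)
  rw [h2] at h3
  norm_num at h3

/-- Leaves that run into one of the closed leaves are not compact. -/
theorem not_isCompact_leaf (hp : p ∈ piece i) (h0 : p.2.1 = 0) (h : p.2 ≠ 0) :
    ¬ IsCompact (plugFoliation.leaf (pieceMap i p)) := by
  intro hc
  obtain ⟨t, q⟩ := p
  simp only at h0 h
  have hinv : leafInv i q = 0 := leafInv_eq_zero_iff.2 h0
  -- On the axis the leaf can be followed forever in one direction: backwards if `A = 0` and
  -- forwards if `B = 0`. Brought back to time `t` by the deck transformations, its points converge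
  -- to the origin.
  obtain ⟨m, hm, hlim⟩ : ∃ m : ℤ, (∀ n : ℕ, (t + (m * n : ℤ), q) ∈ piece i) ∧
      Tendsto (fun n : ℕ => returnMap i (m * n) q) atTop (𝓝 (0, 0)) := by
    have hpow : Tendsto (fun n : ℕ => ((2 : ℝ) ^ n)⁻¹) atTop (𝓝 0) :=
      (tendsto_pow_atTop_atTop_of_one_lt (by norm_num)).inv_tendsto_atTop
    have habs : ∀ n, returnMap i n q =
        (0, 2 ^ n * labelB i q - labelA i q / 2 ^ n) := by
      intro n
      refine Prod.ext (returnMap_fst_eq_zero.2 h0) rfl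
    simp only [habs]
    rcases labels_eq_zero_of_fst (i := i) h0 with hA | hB
    · refine ⟨-1, fun n => ⟨?_, ?_, ?_⟩, ?_⟩
      · simp [nearEnd, hA]
      · refine (nearMid_mono ?_ q).trans_lt hp.2.1
        push_cast
        have : (0 : ℝ) ≤ n := by positivity
        linarith
      · simp [hinv]
      · rw [hA]
        refine Tendsto.prodMk_nhds tendsto_const_nhds ?_
        simpa using hpow.mul_const (labelB i q)
    · refine ⟨1, fun n => ⟨?_, ?_, ?_⟩, ?_⟩
      · refine (nearEnd_anti ?_ q).trans hp.1
        push_cast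
        have : (0 : ℝ) ≤ n := by positivity
        linarith
      · simp [nearMid, hB, Real.exp_pos]
      · simp [hinv]
      · rw [hB]
        refine Tendsto.prodMk_nhds tendsto_const_nhds ?_
        have := (hpow.const_mul (labelA i q)).neg
        simpa [div_eq_mul_inv] using this
  have hdeck : ∀ n : ℕ, deck i (m * n) (t + (m * n : ℤ), q) = (t, returnMap i (m * n) q) := by
    intro n
    simp [deck]
  have hmem : ∀ n : ℕ, (t, returnMap i (m * n) q) ∈ piece i := fun n => by
    rw [← hdeck, deck_mem_piece]
    exact hm n
  have hz := halfPiece_subset (zero_mem_piece i t)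
  have hlim' : Tendsto (fun n : ℕ => pieceMap i (t, returnMap i (m * n) q)) atTop
      (𝓝 (pieceMap i (t, (0, 0)))) :=
    (continuousOn_pieceMap i _ hz).tendsto.comp (tendsto_nhdsWithin_iff.2
      ⟨tendsto_const_nhds.prodMk_nhds hlim, .of_forall hmem⟩)
  -- A compact leaf would be closed and would contain this limit, but the leaves of core points lie
  -- in the core.
  have h1 : pieceMap i (t, (0, 0)) ∈ plugFoliation.leaf (pieceMap i (t, q)) := by
    refine hc.isClosed.mem_of_tendsto hlim' (.of_forall fun n => ?_)
    rw [← hdeck, pieceMap_deck]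
    exact sameLeaf_of_line hp (hm n)
  have h2 : pieceMap i (t, q) ∈ core i := by
    refine ((isLeafwise_core i).mem_iff_of_sameLeaf h1).2 ?_
    exact ⟨i, _, hz, rfl, rfl, rfl⟩
  exact h ((isLeafwise_core i).of_mem hp h2).2

/-- Off the axis, every point has the sum of the logarithms of its labels bounded. -/
theorem plog_add_plog_nonpos {q : ℝ × ℝ} (h0 : q.1 ≠ 0) (h : |leafInv i q| ≤ 1) :
    plog (labelA i q) + plog (labelB i q) ≤ 0 := by
  obtain ⟨hA, hB⟩ := labels_pos_of_fst (i := i) h0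
  have := (eplog_mul_le_abs_leafInv i q).trans h
  rwa [eplog_of_pos hA, eplog_of_pos hB, ← Real.exp_add, Real.exp_le_one_iff] at this

theorem nearEnd_eq {t : ℝ} {q : ℝ × ℝ} (hA : 0 < labelA i q) :
    nearEnd i (t, q) = Real.exp (plog (labelA i q) - t) := by
  rw [nearEnd, eplog_of_pos hA, ← Real.exp_add, sub_eq_add_neg]

theorem nearMid_eq {t : ℝ} {q : ℝ × ℝ} (hB : 0 < labelB i q) :
    nearMid i (t, q) = Real.exp (plog (labelB i q) + t - 1) := by
  rw [nearMid, eplog_of_pos hB, ← Real.exp_add, add_sub_assoc]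

theorem end_mem_piece {q : ℝ × ℝ} (h0 : q.1 ≠ 0) (h : |leafInv i q| ≤ 1) :
    (plog (labelA i q), q) ∈ halfPiece i ∧ nearEnd i (plog (labelA i q), q) = 1 := by
  obtain ⟨hA, hB⟩ := labels_pos_of_fst (i := i) h0
  have h1 := plog_add_plog_nonpos h0 h
  have h2 : nearEnd i (plog (labelA i q), q) = 1 := by simp [nearEnd_eq hA]
  refine ⟨⟨h2.le, ?_, h⟩, h2⟩
  rw [nearMid_eq hB, Real.exp_le_one_iff]
  linarith

theorem mid_mem_piece {q : ℝ × ℝ} (h0 : q.1 ≠ 0) (h : |leafInv i q| ≤ 1) :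
    (1 - plog (labelB i q), q) ∈ piece i ∧ nearMid i (1 - plog (labelB i q), q) = 1 := by
  obtain ⟨hA, hB⟩ := labels_pos_of_fst (i := i) h0
  have h1 := plog_add_plog_nonpos h0 h
  have h2 : nearMid i (1 - plog (labelB i q), q) = 1 := by simp [nearMid_eq hB]
  refine ⟨⟨?_, by rw [h2]; simp, h⟩, h2⟩
  rw [nearEnd_eq hA, Real.exp_le_one_iff]
  linarith

/-- The leaf of a point off the axis, as the image of two compact arcs. -/
theorem sameLeaf_switchMap {t t' : ℝ} {q : ℝ × ℝ} (h0 : q.1 ≠ 0) (h : (t, q) ∈ piece i)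
    (h' : (t', switchMap i q) ∈ piece (!i)) :
    plugFoliation.SameLeaf (pieceMap i (t, q)) (pieceMap (!i) (t', switchMap i q)) := by
  obtain ⟨h1, h2⟩ := mid_mem_piece h0 h.2.2
  have h3 : Real.exp (-1) < nearMid i (1 - plog (labelB i q), q) := by
    rw [h2]
    simp
  refine .trans _ _ _ (sameLeaf_of_line h h1) ?_
  rw [← pieceMap_switch h1 h3]
  exact sameLeaf_of_snd_eq (switch_mem_piece h1 h3) h' rfl

/-- Every point off the axis has a lift to a given piece. -/
theorem exists_sameLeaf_lift (j : Bool) (hp : p ∈ piece i) (h0 : p.2.1 ≠ 0) :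
    ∃ q : ℝ × ℝ, q.1 ≠ 0 ∧ |leafInv j q| ≤ 1 ∧ ∀ t, (t, q) ∈ piece j →
      plugFoliation.SameLeaf (pieceMap i p) (pieceMap j (t, q)) := by
  by_cases hij : j = i
  · subst hij
    exact ⟨p.2, h0, hp.2.2, fun t ht => sameLeaf_of_snd_eq hp ht rfl⟩
  · obtain rfl : j = !i := Bool.eq_not.2 hij
    refine ⟨switchMap i p.2, by rwa [Ne, switchMap_fst_eq_zero], ?_, fun t ht => ?_⟩
    · rw [leafInv_switchMap]
      exact hp.2.2
    · exact sameLeaf_switchMap h0 hp ht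

theorem leaf_meets_entry (hp : p ∈ piece i) (h0 : p.2.1 ≠ 0) :
    (plugFoliation.leaf (pieceMap i p) ∩ plugFoliation.entry).Nonempty := by
  obtain ⟨q, hq, hq', h⟩ := exists_sameLeaf_lift false hp h0
  obtain ⟨h1, h2⟩ := end_mem_piece hq hq'
  refine ⟨_, h _ (halfPiece_subset h1), ?_⟩
  rw [mem_entry, pieceMap_level_eq_neg_one (halfPiece_subset h1)]
  exact ⟨rfl, h2⟩

theorem leaf_meets_exit (hp : p ∈ piece i) (h0 : p.2.1 ≠ 0) :
    (plugFoliation.leaf (pieceMap i p) ∩ plugFoliation.exit).Nonempty := by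
  obtain ⟨q, hq, hq', h⟩ := exists_sameLeaf_lift true hp h0
  obtain ⟨h1, h2⟩ := end_mem_piece hq hq'
  refine ⟨_, h _ (halfPiece_subset h1), ?_⟩
  rw [mem_exit, pieceMap_level_eq_one (halfPiece_subset h1)]
  exact ⟨rfl, h2⟩

theorem exists_pieceMap_eq (P : Support) : ∃ i, ∃ p ∈ piece i, pieceMap i p = P := by
  obtain ⟨i, p, hp, -, rfl⟩ := exists_halfMap_eq P
  exact ⟨i, p, halfPiece_subset hp, pieceMap_of_le hp.2.1⟩

/-- A leaf off the axis has an endpoint on the entry region, and one on the axis but off the origin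
is not compact, so only the cores remain. -/
theorem isClosedLeaf_iff (L : Set Support) :
    plugFoliation.IsClosedLeaf L ↔ L = core false ∨ L = core true := by
  constructor
  · rintro ⟨⟨P, rfl⟩, hc, h1, -⟩
    obtain ⟨i, p, hp, rfl⟩ := exists_pieceMap_eq P
    by_cases h0 : p.2.1 = 0
    · by_cases h : p.2 = 0
      · obtain ⟨t, q⟩ := p
        obtain rfl : q = (0, 0) := h
        rw [← core_eq_leaf]
        cases i <;> simp
      · exact absurd hc (not_isCompact_leaf hp h0 h)
    · exact absurd h1 (leaf_meets_entry hp h0).ne_empty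
  · rintro (rfl | rfl) <;> exact isClosedLeaf_core _

theorem ncard_closedLeaves : {L : Set Support | plugFoliation.IsClosedLeaf L}.ncard = 2 := by
  have : {L : Set Support | plugFoliation.IsClosedLeaf L} = {core false, core true} := by
    ext L
    rw [mem_ofPred_eq, isClosedLeaf_iff]
    rfl
  rw [this, ncard_pair core_ne]

theorem isCompact_arc (i : Bool) {q : ℝ × ℝ} (h0 : q.1 ≠ 0) :
    IsCompact {t : ℝ | (t, q) ∈ halfPiece i} := by
  obtain ⟨hA, hB⟩ := labels_pos_of_fst (i := i) h0
  by_cases h : |leafInv i q| ≤ 1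
  · have : {t : ℝ | (t, q) ∈ halfPiece i} = Icc (plog (labelA i q)) (1 - plog (labelB i q)) := by
      ext t
      simp only [halfPiece, mem_ofPred_eq, nearEnd_eq hA, nearMid_eq hB, Real.exp_le_one_iff, h,
        and_true, mem_Icc]
      constructor <;> rintro ⟨h1, h2⟩ <;> constructor <;> linarith
    rw [this]
    exact isCompact_Icc
  · have : {t : ℝ | (t, q) ∈ halfPiece i} = ∅ := by
      ext t
      simp [halfPiece, h]
    rw [this]
    exact isCompact_empty

/-- The leaf of a point off the axis is compact. -/
theorem isCompact_leaf (hp : p ∈ piece i) (h0 : p.2.1 ≠ 0) :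
    IsCompact (plugFoliation.leaf (pieceMap i p)) := by
  set q : Bool → ℝ × ℝ := fun j => if j = i then p.2 else switchMap i p.2 with hq
  have hi : (!(!i)) = i := Bool.not_not i
  have hq0 : ∀ j, (q j).1 ≠ 0 := by
    intro j
    simp only [hq]
    split_ifs
    · exact h0
    · rwa [Ne, switchMap_fst_eq_zero]
  have hqi : q i = p.2 := by simp [hq]
  have hqn : q (!i) = switchMap i p.2 := by simp [hq]
  have hB := (labels_pos_of_fst (i := i) h0).2
  have hqs : ∀ j, switchMap j (q j) = q (!j) := by
    intro j
    by_cases hj : j = i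
    · subst hj
      rw [hqi, hqn]
    · obtain rfl : j = !i := Bool.eq_not.2 hj
      rw [hqn, switchMap_switchMap hB, hi, hqi]
  have hR : IsLeafwise fun j q' => ∃ n : ℤ, q' = returnMap j n (q j) := by
    constructor
    · rintro j n _ ⟨m, rfl⟩
      exact ⟨n + m, returnMap_add⟩
    · rintro j _ - ⟨m, rfl⟩
      refine ⟨m, ?_⟩
      rw [switchMap_returnMap (labels_pos_of_fst (hq0 j)).2, hqs]
  -- Up to deck transformations the leaf has a single line in each piece, and it is covered by the
  -- two compact arcs of these lines before the interface.
  have key : plugFoliation.leaf (pieceMap i p) =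
      ⋃ j : Bool, (fun t : ℝ => pieceMap j (t, q j)) '' {t | (t, q j) ∈ halfPiece j} := by
    ext Q
    simp only [mem_iUnion]
    constructor
    · intro h
      have h1 : Q ∈ saturation fun j q' => ∃ n : ℤ, q' = returnMap j n (q j) := by
        refine (hR.mem_iff_of_sameLeaf h).1 ⟨i, p, hp, rfl, 0, ?_⟩
        rw [returnMap_zero, hqi]
      obtain ⟨j, ⟨t, q'⟩, hp', rfl, n, hn⟩ := h1
      obtain rfl : q' = returnMap j n (q j) := hn
      have h2 : (t, returnMap j n (q j)) = deck j n (t + n, q j) := by simp [deck]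
      rw [h2, deck_mem_piece] at hp'
      rw [h2, pieceMap_deck]
      rcases le_total (nearMid j (t + n, q j)) 1 with h3 | h3
      · exact ⟨j, _, mem_halfPiece hp' h3, rfl⟩
      · have h4 := switch_mem_halfPiece hp' h3
        have h5 : switch j (t + n, q j) =
          (2 - (t + n) - 2 * plog (labelB j (q j)), q (!j)) := by rw [← hqs]; rfl
        rw [pieceMap_of_ge hp' h3, ← pieceMap_of_le h4.2.1]
        rw [h5] at h4 ⊢
        exact ⟨!j, _, h4, rfl⟩
    · rintro ⟨j, t, ht, rfl⟩
      by_cases hj : j = i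
      · subst hj
        exact sameLeaf_of_snd_eq hp (halfPiece_subset ht) hqi.symm
      · obtain rfl : j = !i := Bool.eq_not.2 hj
        simp only
        have ht' := halfPiece_subset ht
        rw [hqn] at ht' ⊢
        exact sameLeaf_switchMap h0 hp ht'
  rw [key]
  refine isCompact_iUnion fun j => (isCompact_arc j (hq0 j)).image_of_continuousOn ?_
  exact (continuousOn_pieceMap j).comp (by fun_prop) fun t ht => halfPiece_subset ht

theorem isFlowBordism_plugFoliation : plugFoliation.IsFlowBordism where
  t2 := inferInstance
  compact := inferInstance
  parallel_finite := by
    intro P hP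
    obtain ⟨i, p, hp, rfl⟩ := exists_pieceMap_eq P
    have h0 : p.2.1 ≠ 0 := by
      intro h0
      rw [mem_parallel, coe_pieceMap_inv hp, leafInv_eq_zero_iff.2 h0] at hP
      norm_num at hP
    exact ⟨⟨_, rfl⟩, isCompact_leaf hp h0, leaf_meets_entry hp h0, leaf_meets_exit hp h0⟩

theorem exists_infinite_leaf :
    ∃ P ∈ plugFoliation.entry, plugFoliation.IsInfiniteLeaf (plugFoliation.leaf P) := by
  have h1 : eplog 1 = 1 := by
    rw [eplog_of_pos one_pos]
    have := plog_zpow 0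
    norm_num at this
    rw [this]
    simp
  -- This point has `A = 1` and `B = 0`. Its time `0 = plog A` puts it on the entry region, and
  -- since it lies on the axis its leaf spirals onto the core.
  have hp : ((0, (0, -1)) : Coord) ∈ piece false := by
    simp [piece, nearEnd, nearMid, labelA, labelB, labelMin, leafInv, h1, Real.exp_pos]
  refine ⟨pieceMap false (0, (0, -1)), ?_, ⟨_, rfl⟩, not_isCompact_leaf hp rfl ?_⟩
  · rw [mem_entry, pieceMap_level_eq_neg_one hp]
    simp [nearEnd, labelA, labelMin, h1]
  · simp

end

section

/-! ### Coordinates on the base -/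

/-- The second label over the base, over one fundamental domain. -/
def baseLocal (f x : ℝ) : ℝ := max (x / 2) (max (x - max f 0 / 2) (2 * x - 1 - f))

/-- The inverse of `baseLocal f`. -/
def baseLocalInv (f b : ℝ) : ℝ := min (2 * b) (min (b + max f 0 / 2) ((b + 1 + f) / 2))

theorem baseLocal_strictMono (f : ℝ) : StrictMono (baseLocal f) := by
  intro x y h
  unfold baseLocal
  exact max_lt_max (by linarith) (max_lt_max (by linarith) (by linarith))

/-- The inverse of a maximum of increasing affine functions is the minimum of their inverses. -/
theorem baseLocal_baseLocalInv (f b : ℝ) : baseLocal f (baseLocalInv f b) = b := by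
  unfold baseLocal baseLocalInv
  generalize max f 0 = g
  apply le_antisymm
  · refine max_le ?_ (max_le ?_ ?_)
    · linarith [min_le_left (2 * b) (min (b + g / 2) ((b + 1 + f) / 2))]
    · linarith [min_le_right (2 * b) (min (b + g / 2) ((b + 1 + f) / 2)),
        min_le_left (b + g / 2) ((b + 1 + f) / 2)]
    · linarith [min_le_right (2 * b) (min (b + g / 2) ((b + 1 + f) / 2)),
        min_le_right (b + g / 2) ((b + 1 + f) / 2)]
  · rcases min_choice (2 * b) (min (b + g / 2) ((b + 1 + f) / 2)) with h | h
    · rw [h]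
      exact le_max_of_le_left (by linarith)
    · rw [h]
      rcases min_choice (b + g / 2) ((b + 1 + f) / 2) with h | h
      · rw [h]
        exact le_max_of_le_right (le_max_of_le_left (by linarith))
      · rw [h]
        exact le_max_of_le_right (le_max_of_le_right (by linarith))

theorem baseLocalInv_baseLocal (f x : ℝ) : baseLocalInv f (baseLocal f x) = x :=
  (baseLocal_strictMono f).injective (baseLocal_baseLocalInv _ _)

/-- The factor 2 matches one return of the second label. The truncation `max f 0` lets the same
formula serve on both sides of an integral angle, where `⌊φ⌋` jumps. -/
theorem baseLocal_add_one {f x : ℝ} (h : -1 ≤ f) (h' : f ≤ 0) (hx : 0 ≤ x) (hx' : x ≤ 1) :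
    baseLocal f x = 2 * baseLocal (f + 1) x := by
  unfold baseLocal
  rw [max_eq_right h', max_eq_left (by linarith : 0 ≤ f + 1)]
  apply le_antisymm
  · refine max_le ?_ (max_le ?_ ?_)
    · linarith [le_max_left (x / 2) (max (x - (f + 1) / 2) (2 * x - 1 - (f + 1)))]
    · linarith [le_max_left (x / 2) (max (x - (f + 1) / 2) (2 * x - 1 - (f + 1)))]
    · linarith [le_max_right (x / 2) (max (x - (f + 1) / 2) (2 * x - 1 - (f + 1))),
        le_max_left (x - (f + 1) / 2) (2 * x - 1 - (f + 1))]
  · rw [mul_comm, ← le_div_iff₀ (by norm_num)]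
    refine max_le ?_ (max_le ?_ ?_)
    · linarith [le_max_right (x / 2) (max (x - 0 / 2) (2 * x - 1 - f)),
        le_max_left (x - 0 / 2) (2 * x - 1 - f)]
    · linarith [le_max_right (x / 2) (max (x - 0 / 2) (2 * x - 1 - f)),
        le_max_right (x - 0 / 2) (2 * x - 1 - f)]
    · linarith [le_max_right (x / 2) (max (x - 0 / 2) (2 * x - 1 - f)),
        le_max_right (x - 0 / 2) (2 * x - 1 - f)]

/-- The second label over the base. -/
def baseLabel (φ x : ℝ) : ℝ := 2 ^ (-⌊φ⌋) * baseLocal (Int.fract φ) x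

/-- The inverse of `baseLabel φ`. -/
def baseLabelInv (φ b : ℝ) : ℝ := baseLocalInv (Int.fract φ) (2 ^ ⌊φ⌋ * b)

theorem baseLabel_strictMono (φ : ℝ) : StrictMono (baseLabel φ) := fun _ _ h =>
  mul_lt_mul_of_pos_left (baseLocal_strictMono _ h) (two_zpow_pos _)

theorem baseLabel_baseLabelInv (φ b : ℝ) : baseLabel φ (baseLabelInv φ b) = b := by
  rw [baseLabel, baseLabelInv, baseLocal_baseLocalInv, zpow_neg, ← mul_assoc,
    inv_mul_cancel₀ (two_zpow_pos _).ne', one_mul]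

theorem baseLabelInv_baseLabel (φ x : ℝ) : baseLabelInv φ (baseLabel φ x) = x :=
  (baseLabel_strictMono φ).injective (baseLabel_baseLabelInv _ _)

theorem baseLabel_zero (φ : ℝ) : baseLabel φ 0 = 0 := by
  have := Int.fract_nonneg φ
  rw [baseLabel, baseLocal, max_eq_left, zero_div, mul_zero]
  rw [max_eq_left this]
  exact max_le (by linarith) (by linarith)

theorem baseLabelInv_zero (φ : ℝ) : baseLabelInv φ 0 = 0 := by
  have := baseLabelInv_baseLabel φ 0
  rwa [baseLabel_zero] at this

/-- Together with the first label `pexp φ`, this places the rim of the base exactly on `|leafInv| =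
1`; see `abs_baseInv_one`. -/
theorem baseLabel_one (φ : ℝ) : baseLabel φ 1 = pexp (-φ) := by
  have h0 := Int.fract_nonneg φ
  have h1 := (Int.fract_lt_one φ).le
  have h2 := Int.floor_add_fract φ
  rw [pexp_eq (n := -⌊φ⌋ - 1) (by push_cast; linarith) (by push_cast; linarith), baseLabel,
    baseLocal, max_eq_left h0, max_eq_left (a := 1 - Int.fract φ / 2) (by linarith),
    max_eq_right (by linarith), zpow_sub_one₀ (by norm_num)]
  push_cast
  rw [mul_assoc]
  congr 1
  linarith

theorem baseLabel_sub_int (φ x : ℝ) (n : ℤ) : baseLabel (φ - n) x = 2 ^ n * baseLabel φ x := by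
  rw [baseLabel, baseLabel, Int.floor_sub_intCast, Int.fract_sub_intCast, ← mul_assoc,
    ← zpow_add₀ (by norm_num)]
  congr 2
  ring

theorem baseLabel_nonneg {φ x : ℝ} (hx : 0 ≤ x) : 0 ≤ baseLabel φ x := by
  rw [← baseLabel_zero φ]
  exact (baseLabel_strictMono φ).monotone hx

theorem baseLabel_pos {φ x : ℝ} (hx : 0 < x) : 0 < baseLabel φ x := by
  rw [← baseLabel_zero φ]
  exact baseLabel_strictMono φ hx

theorem baseLabelInv_mem {φ b : ℝ} (hb : 0 ≤ b) (hb' : b ≤ pexp (-φ)) :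
    baseLabelInv φ b ∈ Icc (0 : ℝ) 1 := by
  constructor
  · rwa [← (baseLabel_strictMono φ).le_iff_le, baseLabel_baseLabelInv, baseLabel_zero]
  · rwa [← (baseLabel_strictMono φ).le_iff_le, baseLabel_baseLabelInv, baseLabel_one]

theorem baseLabel_eq {φ x : ℝ} {n : ℤ} (h : n - 1 ≤ φ) (h' : φ ≤ n + 1) (hx : 0 ≤ x)
    (hx' : x ≤ 1) : baseLabel φ x = 2 ^ (-n) * baseLocal (φ - n) x := by
  have h1 := Int.floor_le φ
  have h2 := Int.lt_floor_add_one φ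
  have h3 := Int.self_sub_floor φ
  obtain h4 | h4 | h4 : ⌊φ⌋ = n ∨ ⌊φ⌋ = n - 1 ∨ ⌊φ⌋ = n + 1 := by
    have h5 : n - 1 ≤ ⌊φ⌋ := by
      rw [Int.le_floor]
      push_cast
      exact h
    have h6 : ⌊φ⌋ ≤ n + 1 := by
      have : (⌊φ⌋ : ℝ) ≤ ((n + 1 : ℤ) : ℝ) := by
        push_cast
        linarith
      exact_mod_cast this
    omega
  · rw [baseLabel, ← h3, h4]
  · rw [h4] at h1 h2 h3
    push_cast at h1 h2 h3
    rw [baseLabel, baseLocal_add_one (f := φ - n) (by linarith) (by linarith) hx hx', ← h3, h4,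
        neg_sub,
      zpow_sub₀ (by norm_num), zpow_one, zpow_neg]
    have : φ - (n - 1) = φ - n + 1 := by ring
    rw [this]
    field_simp
  · rw [h4] at h1 h2 h3
    push_cast at h1 h2 h3
    have h5 : φ - n = 0 + 1 := by linarith
    have h6 := baseLocal_add_one (f := 0) (by norm_num) le_rfl hx hx'
    have h7 : Int.fract φ = 0 := by linarith
    rw [baseLabel, h5, h4, h7, h6, neg_add, zpow_add₀ (by norm_num), zpow_neg, zpow_neg, zpow_one]
    field_simp

theorem baseLabelInv_eq {φ b : ℝ} {n : ℤ} (h : n - 1 ≤ φ) (h' : φ ≤ n + 1) (hb : 0 ≤ b)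
    (hb' : b ≤ pexp (-φ)) : baseLabelInv φ b = baseLocalInv (φ - n) (2 ^ n * b) := by
  have hx := baseLabelInv_mem hb hb'
  have h1 := baseLabel_eq h h' hx.1 hx.2
  rw [baseLabel_baseLabelInv] at h1
  have h2 : 2 ^ n * b = baseLocal (φ - n) (baseLabelInv φ b) := by
    rw [zpow_neg] at h1
    rw [eq_comm, ← inv_mul_eq_iff_eq_mul₀ (two_zpow_pos n).ne']
    exact h1.symm
  rw [h2, baseLocalInv_baseLocal]

/-! ### Piecewise linearity over the base, across integral angles -/

section PL

variable {X E : Type*} [TopologicalSpace X] [AddCommGroup E] [Module ℝ E] {c : X → E}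
  {f g : X → ℝ} {x : X}

theorem eventually_near_round (hf : ContinuousAt f x) :
    ∀ᶠ y in 𝓝 x, (round (f x) : ℝ) - 1 ≤ f y ∧ f y ≤ round (f x) + 1 := by
  have h := abs_le.1 (abs_sub_round (f x))
  filter_upwards [hf.eventually_lt_const (u := (round (f x) : ℝ) + 1) (by linarith [h.2]),
    hf.eventually_const_lt (u := (round (f x) : ℝ) - 1) (by linarith [h.1])] with y h1 h2
  exact ⟨h2.le, h1.le⟩

theorem PL.baseLabel (hf : PL c f x) (hg : PL c g x) (hfc : ContinuousAt f x)
    (hg0 : ∀ᶠ y in 𝓝 x, 0 ≤ g y ∧ g y ≤ 1) : PL c (fun y => baseLabel (f y) (g y)) x := by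
  set n := round (f x)
  have h1 : PL c (fun y => f y - n) x := hf.sub (PL.const _)
  refine (PL.mul (2 ^ (-n)) ((hg.mul 2⁻¹).max ((hg.sub ((h1.max (PL.const 0)).mul 2⁻¹)).max
    (((hg.mul 2).sub (PL.const 1)).sub h1)))).congr ?_
  filter_upwards [hg0, eventually_near_round hfc] with y h2 h3
  rw [baseLabel_eq h3.1 h3.2 h2.1 h2.2, baseLocal]
  simp only [div_eq_inv_mul]
  rfl

end PL

/-- The point over the base with angle `φ` and radial coordinate `x`, on the piece `i`. -/
def baseMap (i : Bool) (φ x : ℝ) : ℝ × ℝ :=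
  ofLabels i x (pexp φ) (baseLabel φ |x| / |sideWidth i x|)

/-- The radial coordinate of a point of the base. -/
def baseRadius (i : Bool) (q : ℝ × ℝ) : ℝ :=
  if 0 ≤ q.1 then baseLabelInv (plog (labelA i q)) (width i * labelB i q)
  else -baseLabelInv (plog (labelA i q)) (labelB i q)

variable {i : Bool} {φ x : ℝ}

theorem abs_sideWidth_pos (i : Bool) (x : ℝ) : 0 < |sideWidth i x| :=
  abs_pos.2 (sideWidth_ne_zero i x)

@[simp]
theorem labelA_baseMap : labelA i (baseMap i φ x) = pexp φ :=
  labelA_ofLabels (pexp_pos _).le (div_nonneg (baseLabel_nonneg (abs_nonneg x)) (abs_nonneg _))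

@[simp]
theorem labelB_baseMap : labelB i (baseMap i φ x) = baseLabel φ |x| / |sideWidth i x| :=
  labelB_ofLabels (pexp_pos _).le (div_nonneg (baseLabel_nonneg (abs_nonneg x)) (abs_nonneg _))

theorem baseMap_fst_eq_zero : (baseMap i φ x).1 = 0 ↔ x = 0 := by
  rw [fst_eq_zero_iff (i := i), labelA_baseMap, labelB_baseMap]
  simp only [(pexp_pos φ).ne', false_or, div_eq_zero_iff, (abs_sideWidth_pos i x).ne', or_false]
  constructor
  · intro h
    by_contra hx
    exact (baseLabel_pos (abs_pos.2 hx)).ne' h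
  · rintro rfl
    rw [abs_zero, baseLabel_zero]

theorem baseMap_side (hx : x ≠ 0) : 0 ≤ (baseMap i φ x).1 ↔ 0 ≤ x :=
  ofLabels_side (pexp_pos _) (div_pos (baseLabel_pos (abs_pos.2 hx)) (abs_sideWidth_pos i x))

/-- The leaf invariant over the base. -/
def baseInv (φ x : ℝ) : ℝ :=
  if 0 ≤ x then Real.exp φ * eplog (baseLabel φ |x|) else -(Real.exp φ * eplog (baseLabel φ |x|))

/-- Division of the second label by the width cancels the width in `leafInv`. The value is therefore
the same in both pieces, so entry and exit can carry the same radial coordinate. -/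
theorem leafInv_baseMap : leafInv i (baseMap i φ x) = baseInv φ x := by
  rw [baseMap, leafInv_ofLabels (pexp_pos _).le
    (div_nonneg (baseLabel_nonneg (abs_nonneg x)) (abs_nonneg _)), baseInv,
    eplog_of_pos (pexp_pos _), plog_pexp]
  unfold sideWidth
  split_ifs
  · rw [abs_of_pos (width_pos i), mul_div_cancel₀ _ (width_pos i).ne']
  · simp

theorem abs_baseInv : |baseInv φ x| = Real.exp φ * eplog (baseLabel φ |x|) := by
  have := mul_nonneg (Real.exp_pos φ).le (eplog_nonneg (baseLabel φ |x|))
  unfold baseInv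
  split_ifs
  · exact abs_of_nonneg this
  · rw [abs_neg, abs_of_nonneg this]

theorem abs_baseInv_one (φ : ℝ) (h : |x| = 1) : |baseInv φ x| = 1 := by
  rw [abs_baseInv, h, baseLabel_one, eplog_of_pos (pexp_pos _), plog_pexp, ← Real.exp_add]
  simp

theorem abs_baseInv_le (h : |x| ≤ 1) : |baseInv φ x| ≤ 1 := by
  rw [← abs_baseInv_one φ (x := 1) (by simp), abs_baseInv, abs_baseInv, abs_one]
  exact mul_le_mul_of_nonneg_left (eplog_mono (baseLabel_nonneg (abs_nonneg x))
    ((baseLabel_strictMono φ).monotone h)) (Real.exp_pos _).le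

theorem baseInv_pos_iff : 0 < baseInv φ x ↔ 0 < x := by
  rw [← leafInv_baseMap (i := false), leafInv_pos_iff]
  rcases eq_or_ne x 0 with rfl | hx
  · rw [baseMap_fst_eq_zero.2 rfl]
  · have h0 : (baseMap false φ x).1 ≠ 0 := by rwa [Ne, baseMap_fst_eq_zero]
    have := baseMap_side (i := false) (φ := φ) hx
    rw [le_iff_lt_or_eq, le_iff_lt_or_eq] at this
    simpa [h0.symm, hx.symm] using this

theorem baseInv_eq_zero_iff : baseInv φ x = 0 ↔ x = 0 := by
  rw [← leafInv_baseMap (i := false), leafInv_eq_zero_iff, baseMap_fst_eq_zero]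

theorem baseInv_injective (φ : ℝ) : Function.Injective (baseInv φ) := by
  intro x y h
  have h1 : |x| = |y| := by
    have := congrArg abs h
    rw [abs_baseInv, abs_baseInv] at this
    exact (baseLabel_strictMono φ).injective (eplog_inj (baseLabel_nonneg (abs_nonneg x))
      (baseLabel_nonneg (abs_nonneg y)) (mul_left_cancel₀ (Real.exp_pos φ).ne' this))
  have h2 : 0 < x ↔ 0 < y := by rw [← baseInv_pos_iff (φ := φ), h, baseInv_pos_iff]
  rcases abs_eq_abs.1 h1 with h3 | h3
  · exact h3
  · rcases lt_trichotomy 0 x with h4 | h4 | h4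
    · linarith [h2.1 h4]
    · linarith
    · have : ¬ 0 < y := fun h5 => by linarith [h2.2 h5]
      linarith

/-- This equivariance lets the coordinate `φ` descend from the line to the circle. -/
theorem baseMap_sub_int (i : Bool) (φ x : ℝ) (n : ℤ) :
    baseMap i (φ - n) x = returnMap i n (baseMap i φ x) := by
  apply eq_of_labels (j := i)
  · rw [labelA_baseMap, labelA_returnMap, labelA_baseMap, sub_eq_add_neg]
    have := pexp_add_int φ (-n)
    push_cast at this
    rw [this, zpow_neg, inv_mul_eq_div]
  · rw [labelB_baseMap, labelB_returnMap, labelB_baseMap, baseLabel_sub_int, mul_div_assoc]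
  · intro h
    have hx : x ≠ 0 := by rwa [Ne, baseMap_fst_eq_zero] at h
    rw [baseMap_side hx, returnMap_side (by rwa [Ne, baseMap_fst_eq_zero]), baseMap_side hx]

theorem baseInv_sub_int (φ x : ℝ) (n : ℤ) : baseInv (φ - n) x = baseInv φ x := by
  rw [← leafInv_baseMap (i := false), baseMap_sub_int, leafInv_returnMap, leafInv_baseMap]

theorem baseRadius_baseMap : baseRadius i (baseMap i φ x) = x := by
  unfold baseRadius
  rw [labelA_baseMap, labelB_baseMap, plog_pexp]
  rcases eq_or_ne x 0 with rfl | hx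
  · rw [if_pos (baseMap_fst_eq_zero.2 rfl).ge, abs_zero, baseLabel_zero, zero_div, mul_zero,
      baseLabelInv_zero]
  · simp only [baseMap_side hx]
    unfold sideWidth
    split_ifs with h
    · rw [abs_of_pos (width_pos i), mul_div_cancel₀ _ (width_pos i).ne', baseLabelInv_baseLabel,
        abs_of_nonneg h]
    · rw [abs_neg, abs_one, div_one, baseLabelInv_baseLabel, abs_of_neg (not_le.1 h), neg_neg]

theorem label_le_of_leafInv {q : ℝ × ℝ} (hA : 0 < labelA i q) (h : |leafInv i q| ≤ 1) :
    |sideWidth i q.1| * labelB i q ≤ pexp (-plog (labelA i q)) := by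
  by_cases h0 : q.1 = 0
  · rw [(labels_eq_zero_of_fst h0).resolve_left hA.ne', mul_zero]
    exact (pexp_pos _).le
  · have hB := mul_pos (abs_sideWidth_pos i q.1) (labels_pos_of_fst (i := i) h0).2
    rw [abs_leafInv h0, Real.exp_le_one_iff] at h
    rw [← plog_le_iff hB (pexp_pos _), plog_pexp]
    linarith

theorem baseRadius_eq (i : Bool) (q : ℝ × ℝ) : baseRadius i q =
    if 0 ≤ q.1 then baseLabelInv (plog (labelA i q)) (|sideWidth i q.1| * labelB i q)
    else -baseLabelInv (plog (labelA i q)) (|sideWidth i q.1| * labelB i q) := by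
  unfold baseRadius sideWidth
  split_ifs
  · rw [abs_of_pos (width_pos i)]
  · rw [abs_neg, abs_one, one_mul]

theorem abs_baseRadius {q : ℝ × ℝ} (hA : 0 < labelA i q) (h : |leafInv i q| ≤ 1) :
    |baseRadius i q| = baseLabelInv (plog (labelA i q)) (|sideWidth i q.1| * labelB i q) := by
  have := baseLabelInv_mem (mul_nonneg (abs_sideWidth_pos i q.1).le (labelB_nonneg i q))
    (label_le_of_leafInv hA h)
  rw [baseRadius_eq]
  split_ifs
  · rw [abs_of_nonneg this.1]
  · rw [abs_neg, abs_of_nonneg this.1]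

theorem abs_baseRadius_le {q : ℝ × ℝ} (hA : 0 < labelA i q) (h : |leafInv i q| ≤ 1) :
    |baseRadius i q| ≤ 1 := by
  rw [abs_baseRadius hA h]
  exact (baseLabelInv_mem (mul_nonneg (abs_sideWidth_pos i q.1).le (labelB_nonneg i q))
    (label_le_of_leafInv hA h)).2

theorem baseMap_baseRadius {q : ℝ × ℝ} (hA : 0 < labelA i q) (h : |leafInv i q| ≤ 1) :
    baseMap i (plog (labelA i q)) (baseRadius i q) = q := by
  have hrad := abs_baseRadius hA h
  have key : baseLabel (plog (labelA i q)) |baseRadius i q| = |sideWidth i q.1| * labelB i q := by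
    rw [hrad, baseLabel_baseLabelInv]
  have hzero : baseRadius i q = 0 ↔ labelB i q = 0 := by
    constructor
    · intro h'
      rw [h', abs_zero, baseLabel_zero] at key
      exact (mul_eq_zero.1 key.symm).resolve_left (abs_sideWidth_pos _ _).ne'
    · intro h'
      rw [h', mul_zero] at hrad
      rw [← abs_eq_zero, hrad, baseLabelInv_zero]
  have hside : q.1 ≠ 0 → (0 ≤ baseRadius i q ↔ 0 ≤ q.1) := by
    intro hq
    have hne : baseRadius i q ≠ 0 := by
      rw [Ne, hzero]
      exact (labels_pos_of_fst (i := i) hq).2.ne'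
    have hpos : 0 ≤ baseLabelInv (plog (labelA i q)) (|sideWidth i q.1| * labelB i q) :=
      hrad ▸ abs_nonneg _
    rw [baseRadius_eq] at hne ⊢
    split_ifs at hne ⊢ with h1
    · simp [hpos, h1]
    · simp only [h1, iff_false, not_le]
      exact lt_of_le_of_ne (by linarith) hne
  apply eq_of_labels (j := i)
  · rw [labelA_baseMap, pexp_plog hA]
  · rw [labelB_baseMap, key]
    by_cases hq : q.1 = 0
    · rw [(labels_eq_zero_of_fst hq).resolve_left hA.ne', mul_zero, zero_div]
    · have : sideWidth i (baseRadius i q) = sideWidth i q.1 := by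
        simp only [sideWidth, hside hq]
      rw [this, mul_div_cancel_left₀ _ (abs_sideWidth_pos i q.1).ne']
  · intro h0
    have hx : baseRadius i q ≠ 0 := by rwa [Ne, baseMap_fst_eq_zero] at h0
    have hq : q.1 ≠ 0 := by
      intro hq
      exact hx (hzero.2 ((labels_eq_zero_of_fst hq).resolve_left hA.ne'))
    rw [baseMap_side hx, hside hq]

theorem pl_baseMap {X E : Type*} [TopologicalSpace X] [AddCommGroup E] [Module ℝ E] {c : X → E}
    {f g : X → ℝ} {x : X} (i : Bool) (hf : PL c f x) (hg : PL c g x) (hfc : ContinuousAt f x)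
    (hg0 : ∀ᶠ y in 𝓝 x, |g y| ≤ 1) :
    PL c (fun y => baseMap i (f y) (g y)) x := by
  have hw := width_pos i
  have hA : PL c (fun y => PLPlug.pexp (f y)) x := hf.pexp hfc
  have habs : PL c (fun y => |g y|) x := hg.max hg.neg
  have hB : PL c (fun y => PLPlug.baseLabel (f y) |g y|) x :=
    PL.baseLabel hf habs hfc (hg0.mono fun y hy => ⟨abs_nonneg _, hy⟩)
  have hside : ∀ w w' : ℝ, PL c (fun y => (w * min (PLPlug.pexp (f y))
      (w' * PLPlug.baseLabel (f y) |g y|), w' * PLPlug.baseLabel (f y) |g y| -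
        PLPlug.pexp (f y))) x := fun w w' =>
    ((hA.min (hB.mul w')).mul w).pair ((hB.mul w').sub hA)
  refine PL.comp (f := fun y => (g y, ((width i * min (PLPlug.pexp (f y))
      ((width i)⁻¹ * PLPlug.baseLabel (f y) |g y|), (width i)⁻¹ * PLPlug.baseLabel (f y) |g y| -
        PLPlug.pexp (f y)), (-1 * min (PLPlug.pexp (f y))
      (1 * PLPlug.baseLabel (f y) |g y|), 1 * PLPlug.baseLabel (f y) |g y| -
        PLPlug.pexp (f y))))) (hg.pair ((hside _ _).pair (hside _ _))) ?_
  refine PLWith.piecewise (LinearMap.fst ℝ ℝ ((ℝ × ℝ) × (ℝ × ℝ))).toAffineMap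
    PL.refl.snd.fst PL.refl.snd.snd ?_ ?_
  · refine .of_forall fun y hy => ?_
    have hy' : 0 ≤ g y := hy
    simp only [PLPlug.baseMap, ofLabels, sideWidth, if_pos hy', abs_of_pos hw, div_eq_inv_mul]
  · refine .of_forall fun y hy => ?_
    have hy' : g y ≤ 0 := hy
    simp only [PLPlug.baseMap, one_mul]
    rcases hy'.eq_or_lt with h | h
    · rw [h, abs_zero, baseLabel_zero, zero_div, ofLabels_congr_of_min (by
        exact min_eq_right (pexp_pos _).le) 0 (-1)]
      simp [ofLabels]
    · simp only [ofLabels, sideWidth, if_neg h.not_ge, abs_neg, abs_one, div_one, neg_one_mul]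

theorem ContinuousAt.baseMap {X : Type*} [TopologicalSpace X] {f g : X → ℝ} {x : X} (i : Bool)
    (hf : ContinuousAt f x) (hg : ContinuousAt g x) (hg0 : ∀ᶠ y in 𝓝 x, |g y| ≤ 1) :
    ContinuousAt (fun y => baseMap i (f y) (g y)) x :=
  (pl_baseMap (c := fun y => (f y, g y)) i PL.refl.fst PL.refl.snd hf hg0).continuousAt
    (hf.prodMk hg)

theorem continuousOn_baseRadius (i : Bool) :
    ContinuousOn (baseRadius i) {q | 0 < labelA i q ∧ |leafInv i q| ≤ 1} := by
  rw [continuousOn_iff_continuous_domRestrict]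
  have hv : Continuous (Subtype.val : {q | 0 < labelA i q ∧ |leafInv i q| ≤ 1} → ℝ × ℝ) :=
    continuous_subtype_val
  have hA : Continuous fun q : {q | 0 < labelA i q ∧ |leafInv i q| ≤ 1} => plog (labelA i q) := by
    rw [continuous_iff_continuousAt]
    intro q
    exact ContinuousAt.comp (g := plog) (continuousAt_plog q.2.1)
      ((continuous_labelA i).comp hv).continuousAt
  -- The formula for each side is to be continuous on the whole domain, not just on its own side,
  -- where the bound on `b` is automatic. Capping by `pexp (-plog A)` enforces the bound everywhere
  -- and changes nothing on the relevant side.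
  have hinv : ∀ b : {q | 0 < labelA i q ∧ |leafInv i q| ≤ 1} → ℝ, Continuous b →
      (∀ q, 0 ≤ b q) → Continuous fun q : {q | 0 < labelA i q ∧ |leafInv i q| ≤ 1} => baseLabelInv
          (plog (labelA i q))
        (min (b q) (pexp (-plog (labelA i q)))) := by
    intro b hb hb0
    have hb' : Continuous fun q : {q | 0 < labelA i q ∧ |leafInv i q| ≤ 1} =>
        min (b q) (pexp (-plog (labelA i q))) := hb.min (continuous_pexp.comp hA.neg)
    rw [continuous_iff_continuousAt]
    intro q
    set n := round (plog (labelA i q))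
    have h1 : ContinuousAt (fun q : {q | 0 < labelA i q ∧ |leafInv i q| ≤ 1} =>
        baseLocalInv (plog (labelA i q) - n) (2 ^ n * min (b q) (pexp (-plog (labelA i q))))) q :=
            by
      unfold baseLocalInv
      have := hA.continuousAt (x := q)
      have := hb'.continuousAt (x := q)
      fun_prop
    refine h1.congr ?_
    filter_upwards [eventually_near_round hA.continuousAt] with q' hq'
    exact (baseLabelInv_eq hq'.1 hq'.2 (le_min (hb0 q') (pexp_pos _).le) (min_le_right _ _)).symm
  have hle : ∀ q : {q | 0 < labelA i q ∧ |leafInv i q| ≤ 1}, _ := fun q =>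
    label_le_of_leafInv q.2.1 q.2.2
  have heq : {q | 0 < labelA i q ∧ |leafInv i q| ≤ 1}.domRestrict (baseRadius i) = fun q =>
      if 0 ≤ q.1.1 then baseLabelInv (plog (labelA i q.1))
        (min (width i * labelB i q.1) (pexp (-plog (labelA i q.1))))
      else -baseLabelInv (plog (labelA i q.1))
        (min (labelB i q.1) (pexp (-plog (labelA i q.1)))) := by
    ext1 q
    have := hle q
    rw [domRestrict_apply, baseRadius]
    unfold sideWidth at this
    split_ifs at this ⊢ with h
    · rw [abs_of_pos (width_pos i)] at this
      rw [min_eq_left this]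
    · rw [abs_neg, abs_one, one_mul] at this
      rw [min_eq_left this]
  rw [heq]
  refine Continuous.if_le ?_ ?_ continuous_const (continuous_fst.comp hv) ?_
  · exact hinv _ (continuous_const.mul ((continuous_labelB i).comp hv)) fun q =>
      mul_nonneg (width_pos i).le (labelB_nonneg i q)
  · exact (hinv _ ((continuous_labelB i).comp hv) fun q => labelB_nonneg i q).neg
  · intro q hq
    have h0 : labelB i q.1 = 0 := (labels_eq_zero_of_fst hq.symm).resolve_left q.2.1.ne'
    rw [h0, mul_zero, min_eq_left (pexp_pos _).le, baseLabelInv_zero, neg_zero]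

end

section

/-! ### The ends -/

variable {i : Bool} {φ x : ℝ}

theorem exists_int_of_coe_eq {s t : ℝ} (h : (s : UnitAddCircle) = t) : ∃ n : ℤ, t = s - n := by
  have h0 : ((s - t : ℝ) : UnitAddCircle) = 0 := by rw [AddCircle.coe_sub, h, sub_self]
  obtain ⟨n, hn⟩ := (AddCircle.coe_eq_zero_iff (1 : ℝ)).1 h0
  refine ⟨n, ?_⟩
  simp only [zsmul_eq_mul, mul_one] at hn
  linarith

/-- The representative of an angle in `[0, 1)`. -/
def angleRep (θ : UnitAddCircle) : ℝ := AddCircle.equivIco 1 0 θ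

theorem coe_angleRep (θ : UnitAddCircle) : (angleRep θ : UnitAddCircle) = θ :=
  AddCircle.coe_equivIco

theorem exists_angleRep_coe (φ : ℝ) : ∃ n : ℤ, angleRep φ = φ - n :=
  exists_int_of_coe_eq (coe_angleRep _).symm

/-- The radial coordinate on the annulus, normalised to `[-1, 1]`. -/
def radial (y : unitInterval) : ℝ := 2 * y - 1

theorem abs_radial_le (y : unitInterval) : |radial y| ≤ 1 := by
  have h0 := y.2.1
  have h1 := y.2.2
  rw [radial, abs_le]
  constructor <;> linarith

theorem continuous_radial : Continuous radial := by
  unfold radial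
  fun_prop

theorem radial_injective : Function.Injective radial := fun y y' h => by
  have : (y : ℝ) = y' := by
    simp only [radial] at h
    linarith
  exact Subtype.ext this

/-- The inverse of `radial`. -/
def ofRadial (x : ℝ) : unitInterval := projIcc 0 1 zero_le_one ((x + 1) / 2)

theorem continuous_ofRadial : Continuous ofRadial := continuous_projIcc.comp (by fun_prop)

theorem radial_ofRadial (h : |x| ≤ 1) : radial (ofRadial x) = x := by
  rw [abs_le] at h
  rw [radial, ofRadial, projIcc_of_mem _ (show (x + 1) / 2 ∈ Icc (0 : ℝ) 1 from
    ⟨by linarith, by linarith⟩)]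
  simp only
  ring

theorem ofRadial_radial (y : unitInterval) : ofRadial (radial y) = y :=
  radial_injective (radial_ofRadial (abs_radial_le y))

/-- A point of the transverse boundary of the piece `i`. -/
def endPoint (i : Bool) (φ x : ℝ) : Coord := (φ, baseMap i φ x)

theorem nearEnd_shift (i : Bool) (φ x a : ℝ) :
    nearEnd i (φ + a, baseMap i φ x) = Real.exp (-a) := by
  rw [nearEnd_eq (by rw [labelA_baseMap]; exact pexp_pos φ), labelA_baseMap, plog_pexp]
  congr 1
  ring

theorem nearEnd_endPoint : nearEnd i (endPoint i φ x) = 1 := by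
  have := nearEnd_shift i φ x 0
  rw [add_zero, neg_zero, Real.exp_zero] at this
  exact this

theorem endPoint_mem (h : |x| ≤ 1) : endPoint i φ x ∈ halfPiece i := by
  have h1 : |leafInv i (baseMap i φ x)| ≤ 1 := by
    rw [leafInv_baseMap]
    exact abs_baseInv_le h
  refine ⟨nearEnd_endPoint.le, ?_, h1⟩
  have h2 := nearEnd_mul_nearMid_lt (i := i) (p := endPoint i φ x) h1
  rw [nearEnd_endPoint, one_mul] at h2
  exact h2.le

theorem endPoint_sub_int (n : ℤ) : endPoint i (φ - n) x = deck i n (endPoint i φ x) := by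
  simp only [endPoint, deck, baseMap_sub_int]

/-- The identification of the base with the transverse boundary of the piece `i`. -/
def endMap (i : Bool) (w : Annulus) : Support :=
  pieceMap i (endPoint i (angleRep w.1) (radial w.2))

theorem endMap_coe (i : Bool) (φ : ℝ) (y : unitInterval) :
    endMap i ((φ : UnitAddCircle), y) = pieceMap i (endPoint i φ (radial y)) := by
  obtain ⟨n, hn⟩ := exists_angleRep_coe φ
  rw [endMap, hn, endPoint_sub_int, pieceMap_deck]

theorem isOpenQuotientMap_coe : IsOpenQuotientMap ((↑) : ℝ → UnitAddCircle) :=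
  QuotientAddGroup.isOpenQuotientMap_mk

theorem continuous_endMap (i : Bool) : Continuous (endMap i) := by
  have hq : IsOpenQuotientMap (Prod.map ((↑) : ℝ → UnitAddCircle) (id : unitInterval → _)) :=
    isOpenQuotientMap_coe.prodMap .id
  rw [hq.isQuotientMap.continuous_iff]
  have : endMap i ∘ Prod.map ((↑) : ℝ → UnitAddCircle) id =
      fun v => pieceMap i (endPoint i v.1 (radial v.2)) := by
    ext1 v
    exact endMap_coe i v.1 v.2
  rw [this]
  refine (continuousOn_pieceMap i).comp_continuous ?_ fun v =>
    halfPiece_subset (endPoint_mem (abs_radial_le v.2))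
  refine continuous_fst.prodMk (continuous_iff_continuousAt.2 fun v => ?_)
  exact ContinuousAt.baseMap i continuousAt_fst
    (continuous_radial.comp continuous_snd).continuousAt (.of_forall fun v => abs_radial_le v.2)

theorem endMap_injective (i : Bool) : Function.Injective (endMap i) := by
  rintro ⟨θ, y⟩ ⟨θ', y'⟩ h
  rw [← coe_angleRep θ, ← coe_angleRep θ'] at h ⊢
  set φ := angleRep θ
  set φ' := angleRep θ'
  rw [endMap_coe, endMap_coe] at h
  obtain ⟨n, hn⟩ := deck_of_pieceMap_eq (halfPiece_subset (endPoint_mem (abs_radial_le y)))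
    (halfPiece_subset (endPoint_mem (abs_radial_le y'))) h
  rw [← endPoint_sub_int] at hn
  have h1 : φ' = φ - n := congrArg Prod.fst hn
  have h2 : baseMap i φ' (radial y') = baseMap i (φ - n) (radial y) := congrArg Prod.snd hn
  have h3 : radial y' = radial y := by
    rw [← baseRadius_baseMap (i := i) (φ := φ') (x := radial y'), h2, baseRadius_baseMap]
  rw [h1, coe_sub_intCast, radial_injective h3]

theorem exists_endPoint_eq {p : Coord} (hp : p ∈ piece i) (h : nearEnd i p = 1) :
    ∃ y : unitInterval, p = endPoint i p.1 (radial y) := by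
  have hA : 0 < labelA i p.2 := eplog_pos_iff.1
    (pos_of_mul_pos_left (by rw [← nearEnd, h]; exact one_pos) (Real.exp_pos _).le)
  have h1 : p.1 = plog (labelA i p.2) := by
    have : nearEnd i p = Real.exp (plog (labelA i p.2) - p.1) := nearEnd_eq (t := p.1) hA
    rw [h, eq_comm, Real.exp_eq_one_iff] at this
    linarith
  refine ⟨ofRadial (baseRadius i p.2), ?_⟩
  rw [radial_ofRadial (abs_baseRadius_le hA hp.2.2)]
  refine Prod.ext rfl ?_
  rw [endPoint, h1, baseMap_baseRadius hA hp.2.2]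

theorem mem_range_endMap {P : Support} :
    P ∈ range (endMap i) ↔ (P.2.2 : ℝ) = if i then 1 else -1 := by
  constructor
  · rintro ⟨⟨θ, y⟩, rfl⟩
    have h1 := halfPiece_subset (endPoint_mem (i := i) (φ := angleRep θ) (abs_radial_le y))
    cases i
    · exact (pieceMap_level_eq_neg_one h1).2 ⟨rfl, nearEnd_endPoint⟩
    · exact (pieceMap_level_eq_one h1).2 ⟨rfl, nearEnd_endPoint⟩
  · intro h
    obtain ⟨j, p, hp, rfl⟩ := exists_pieceMap_eq P
    obtain ⟨rfl, h1⟩ : j = i ∧ nearEnd j p = 1 := by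
      cases i
      · exact (pieceMap_level_eq_neg_one hp).1 h
      · exact (pieceMap_level_eq_one hp).1 h
    obtain ⟨y, hy⟩ := exists_endPoint_eq hp h1
    exact ⟨((p.1 : UnitAddCircle), y), by rw [endMap_coe, ← hy]⟩

/-- The identification of the base with one of the ends, as a homeomorphism. -/
def endHomeo (i : Bool) {S : Set Support} (hS : ∀ P, P ∈ S ↔ P ∈ range (endMap i)) :
    Annulus ≃ₜ S :=
  Continuous.homeoOfEquivCompactToT2
    (f := Equiv.ofBijective (fun w => (⟨endMap i w, (hS _).2 ⟨w, rfl⟩⟩ : S))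
      ⟨fun _ _ h => endMap_injective i (congrArg Subtype.val h), fun P => by
        obtain ⟨w, hw⟩ := (hS P).1 P.2
        exact ⟨w, Subtype.ext hw⟩⟩)
    ((continuous_endMap i).subtype_mk _)

/-- The entry point is off the axis because the leaf exits. Then the angle class fixes the circle
coordinate, and `leafInv` fixes the radius because it is injective in `x` at a fixed angle. -/
theorem sameLeaf_endMap {w w' : Annulus}
    (h : plugFoliation.SameLeaf (endMap true w) (endMap false w')) : w = w' := by
  obtain ⟨θ, y⟩ := w
  obtain ⟨θ', y'⟩ := w'
  have hp := halfPiece_subset (endPoint_mem (i := true) (φ := angleRep θ) (abs_radial_le y))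
  have hp' := halfPiece_subset (endPoint_mem (i := false) (φ := angleRep θ') (abs_radial_le y'))
  have key : ∀ {R : Bool → ℝ × ℝ → Prop}, IsLeafwise R →
      (R true (baseMap true (angleRep θ) (radial y)) ↔
        R false (baseMap false (angleRep θ') (radial y'))) := fun hR =>
    ((hR.mem_iff hp).symm.trans (hR.mem_iff_of_sameLeaf h)).trans (hR.mem_iff hp')
  have hx' : radial y' ≠ 0 := by
    intro h0
    refine absurd ((key isLeafwise_entryAxis).2 ⟨rfl, ?_, ?_⟩).1 (by simp)
    · rw [labelB_baseMap, h0, abs_zero, baseLabel_zero, zero_div]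
    · rw [labelA_baseMap]
      exact pexp_pos _
  have hinv : baseInv (angleRep θ) (radial y) = baseInv (angleRep θ') (radial y') := by
    have := (key (isLeafwise_leafInv _)).2 rfl
    rwa [leafInv_baseMap, leafInv_baseMap] at this
  have hang := ((key (isLeafwise_angle _)).2 ⟨by rwa [Ne, baseMap_fst_eq_zero], rfl⟩).2
  rw [labelA_baseMap, labelA_baseMap, plog_pexp, plog_pexp] at hang
  obtain ⟨n, hn⟩ := exists_int_of_coe_eq hang
  rw [coe_angleRep, coe_angleRep] at hang
  rw [← baseInv_sub_int _ _ n, ← hn] at hinv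
  rw [hang, radial_injective (baseInv_injective _ hinv)]

/-- The plug. -/
def plug : plugFoliation.Plug Annulus where
  toEntry := endHomeo false fun P => by rw [mem_entry, mem_range_endMap]; simp
  toExit := endHomeo true fun P => by rw [mem_exit, mem_range_endMap]; simp
  matched := fun _ _ h => sameLeaf_endMap h
  flowBordism := isFlowBordism_plugFoliation
  infinite := exists_infinite_leaf

end

section

/-! ### A neighbourhood of the boundary -/

/-- The covering of the thickened base. -/
abbrev Thick : Type := unitInterval × (unitInterval × ℝ)

/-- The radial coordinate on the covering of the thickened base. -/
def Thick.x (y : Thick) : ℝ := radial y.2.1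

/-- The length of the leaf with a given invariant. -/
def leafLength (ξ : ℝ) : ℝ := (if 0 ≤ ξ then 3 else 2) - 2 * Real.log |ξ|

/-- The leaf invariant over the thickened base. -/
def Thick.inv (y : Thick) : ℝ := baseInv y.2.2 y.x

theorem Thick.abs_x_le (y : Thick) : |y.x| ≤ 1 := abs_radial_le _

theorem Thick.continuous_x : Continuous Thick.x := continuous_radial.comp (by fun_prop)

theorem continuous_baseMap_thick (i : Bool) :
    Continuous fun y : Thick => baseMap i y.2.2 y.x :=
  continuous_iff_continuousAt.2 fun y => ContinuousAt.baseMap i (by fun_prop)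
    Thick.continuous_x.continuousAt (.of_forall fun y => y.abs_x_le)

theorem Thick.continuous_inv : Continuous Thick.inv := by
  have : Thick.inv = fun y => leafInv true (baseMap true y.2.2 y.x) := by
    ext1 y
    exact leafInv_baseMap.symm
  rw [this]
  exact (continuous_leafInv true).comp (continuous_baseMap_thick true)

/-- The point at time `a` after the end of the piece `i`, over the base. -/
def timePoint (i : Bool) (φ x a : ℝ) : Coord := (φ + a, baseMap i φ x)

variable {i : Bool} {φ φ' x x' a a' : ℝ} {n : ℤ}

theorem timePoint_sub_int : timePoint i (φ - n) x a = deck i n (timePoint i φ x a) := by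
  simp only [timePoint, deck, baseMap_sub_int, Prod.mk.injEq, and_true]
  ring

theorem timePoint_inj (h : timePoint i φ x a = timePoint i φ' x' a') :
    φ = φ' ∧ x = x' ∧ a = a' := by
  have h1 : baseMap i φ x = baseMap i φ' x' := congrArg Prod.snd h
  have h2 : φ + a = φ' + a' := congrArg Prod.fst h
  have h3 : φ = φ' := by
    rw [← plog_pexp φ, ← labelA_baseMap (i := i) (φ := φ) (x := x), h1, labelA_baseMap, plog_pexp]
  have h4 : x = x' := by
    rw [← baseRadius_baseMap (i := i) (φ := φ) (x := x), h1, baseRadius_baseMap]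
  exact ⟨h3, h4, by linarith⟩

theorem timePoint_mem (hx : |x| ≤ 1) (ha : 0 ≤ a) (ha' : a ≤ 1) : timePoint i φ x a ∈ piece i := by
  have h1 : |leafInv i (baseMap i φ x)| ≤ 1 := by
    rw [leafInv_baseMap]
    exact abs_baseInv_le hx
  have h2 := nearEnd_mul_nearMid_lt (i := i) (p := timePoint i φ x a) h1
  have h3 : nearEnd i (timePoint i φ x a) = Real.exp (-a) := nearEnd_shift i φ x a
  refine ⟨?_, ?_, h1⟩
  · rw [h3, Real.exp_le_one_iff]
    linarith
  · rw [h3, Real.exp_neg, inv_mul_lt_one₀ (Real.exp_pos a)] at h2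
    exact h2.trans_le (Real.exp_le_exp.2 ha')

theorem log_abs_baseInv (hx : x ≠ 0) :
    Real.log |baseInv φ x| = φ + plog (baseLabel φ |x|) := by
  rw [abs_baseInv, eplog_of_pos (baseLabel_pos (abs_pos.2 hx)), ← Real.exp_add, Real.log_exp]

theorem baseInv_nonneg_iff : 0 ≤ baseInv φ x ↔ 0 ≤ x := by
  rw [le_iff_lt_or_eq, le_iff_lt_or_eq, baseInv_pos_iff, eq_comm, baseInv_eq_zero_iff]
  simp [eq_comm]

theorem nearMid_timePoint_false (hx : x ≠ 0) :
    nearMid false (timePoint false φ x a) = Real.exp (Real.log |baseInv φ x| + a - 1) := by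
  have hB : labelB false (baseMap false φ x) = baseLabel φ |x| := by
    rw [labelB_baseMap]
    unfold sideWidth
    split_ifs <;> simp [width]
  have hB' : 0 < labelB false (baseMap false φ x) := hB ▸ baseLabel_pos (abs_pos.2 hx)
  rw [timePoint, nearMid_eq hB', hB, log_abs_baseInv hx]
  congr 1
  ring

theorem plog_labelB_baseMap_true (hx : x ≠ 0) :
    plog (labelB true (baseMap true φ x)) = plog (baseLabel φ |x|) - if 0 ≤ x then 1 else 0 := by
  rw [labelB_baseMap]
  unfold sideWidth
  split_ifs
  · simp only [width, if_true, abs_two]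
    exact plog_half (baseLabel_pos (abs_pos.2 hx))
  · simp

theorem nearMid_timePoint_true (hx : x ≠ 0) :
    nearMid true (timePoint true φ x a) =
      Real.exp (a + 1 - leafLength (baseInv φ x) - Real.log |baseInv φ x|) := by
  have h0 : (baseMap true φ x).1 ≠ 0 := by rwa [Ne, baseMap_fst_eq_zero]
  rw [timePoint, nearMid_eq (labels_pos_of_fst h0).2, plog_labelB_baseMap_true hx, leafLength,
    log_abs_baseInv hx]
  simp only [baseInv_nonneg_iff]
  congr 1
  split_ifs <;> ring

/-- On the right, halving `A` and doubling the width have the same effect as one return in the exit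
piece; on the left nothing happens. This single extra return is the source of the Dehn twist. -/
theorem switchMap_baseMap (hx : x ≠ 0) :
    switchMap false (baseMap false φ x) =
      returnMap true (if 0 ≤ x then 1 else 0) (baseMap true φ x) := by
  have h0 : ∀ i, (baseMap i φ x).1 ≠ 0 := fun i => by rwa [Ne, baseMap_fst_eq_zero]
  apply eq_of_labels (j := true)
  · have : labelA true (switchMap false (baseMap false φ x)) = _ :=
      labelA_switchMap (i := false) (q := baseMap false φ x)
    rw [this, labelA_returnMap, labelA_baseMap, labelA_baseMap, sideScale]
    simp only [baseMap_side hx]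
    split_ifs
    · simp only [width, Bool.not_false, if_true, Bool.false_eq_true, if_false, zpow_one]
      ring
    · simp
  · have : labelB true (switchMap false (baseMap false φ x)) = _ :=
      labelB_switchMap (i := false) (q := baseMap false φ x)
    rw [this, labelB_returnMap, labelB_baseMap, labelB_baseMap]
    unfold sideWidth
    split_ifs
    · simp only [width, if_true, Bool.false_eq_true, if_false, zpow_one, abs_one, abs_two]
      ring
    · simp
  · intro _
    rw [switchMap_side (i := false) (h0 false), baseMap_side hx, returnMap_side (h0 true),
      baseMap_side hx]

/-- The time from the other end, after crossing the interface. -/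
theorem switch_timePoint (hx : x ≠ 0) :
    switch false (timePoint false φ x a) = deck true (if 0 ≤ x then 1 else 0)
      (timePoint true φ x (leafLength (baseInv φ x) - a)) := by
  refine Prod.ext ?_ (switchMap_baseMap hx)
  have hB : labelB false (baseMap false φ x) = baseLabel φ |x| := by
    rw [labelB_baseMap]
    unfold sideWidth
    split_ifs <;> simp [width]
  simp only [switch, deck, timePoint, hB, leafLength, baseInv_nonneg_iff, log_abs_baseInv hx]
  split_ifs <;> push_cast <;> ring

theorem pieceMap_timePoint_switch (hx : x ≠ 0) (hx1 : |x| ≤ 1) (ha : 0 ≤ a) (ha' : a ≤ 1)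
    (h : -a < Real.log |baseInv φ x|) :
    pieceMap false (timePoint false φ x a) =
      pieceMap true (timePoint true φ x (leafLength (baseInv φ x) - a)) := by
  rw [← pieceMap_switch (timePoint_mem hx1 ha ha'), switch_timePoint hx]
  · exact pieceMap_deck
  · rw [nearMid_timePoint_false hx, Real.exp_lt_exp]
    linarith

theorem pieceMap_timePoint_inj (hp : timePoint i φ x a ∈ piece i)
    (hp' : timePoint i φ' x' a' ∈ piece i)
    (h : pieceMap i (timePoint i φ x a) = pieceMap i (timePoint i φ' x' a')) :
    (∃ n : ℤ, φ' = φ - n) ∧ x' = x ∧ a' = a := by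
  obtain ⟨n, hn⟩ := deck_of_pieceMap_eq hp hp' h
  rw [← timePoint_sub_int] at hn
  obtain ⟨h1, h2, h3⟩ := timePoint_inj hn
  exact ⟨⟨n, h1⟩, h2, h3⟩

theorem pieceMap_timePoint_inj_switch (hp : timePoint false φ x a ∈ piece false)
    (hp' : timePoint true φ' x' a' ∈ piece true)
    (h : pieceMap false (timePoint false φ x a) = pieceMap true (timePoint true φ' x' a')) :
    (∃ n : ℤ, φ' = φ - n) ∧ x' = x ∧ a' = leafLength (baseInv φ x) - a := by
  obtain ⟨hm, n, hn⟩ := deck_switch_of_halfMap_eq (i := false) hp hp' h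
  have hx : x ≠ 0 := by
    rintro rfl
    have := labelB_pos_of_nearMid ((Real.exp_pos _).trans hm)
    simp [timePoint, baseLabel_zero] at this
  rw [switch_timePoint hx, Bool.not_false, deck_add, ← timePoint_sub_int] at hn
  obtain ⟨h1, h2, h3⟩ := timePoint_inj hn
  exact ⟨⟨_, h1⟩, h2, h3⟩

theorem two_le_leafLength {ξ : ℝ} (h : |ξ| ≤ 1) : 2 ≤ leafLength ξ := by
  have := Real.log_nonpos (abs_nonneg ξ) h
  unfold leafLength
  split_ifs <;> linarith

/-- The threshold `exp (-1 / 2)` is chosen for this bound, which makes the slope 8 in `exitTime`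
steep enough. -/
theorem leafLength_lt {ξ : ℝ} (h : Real.exp (-1 / 2) < |ξ|) : leafLength ξ < 4 := by
  have : -1 / 2 < Real.log |ξ| := (Real.lt_log_iff_exp_lt ((Real.exp_pos _).trans h)).2 h
  unfold leafLength
  split_ifs <;> linarith

theorem continuousAt_leafLength {ξ : ℝ} (h : ξ ≠ 0) : ContinuousAt leafLength ξ := by
  have hlog : ContinuousAt (fun ξ => 2 * Real.log |ξ|) ξ :=
    continuousAt_const.mul ((Real.continuousAt_log (abs_ne_zero.2 h)).comp (f := abs)
      continuous_abs.continuousAt)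
  rcases lt_or_gt_of_ne h with h | h
  · refine (continuousAt_const.sub hlog).congr (f := fun ξ => 2 - 2 * Real.log |ξ|) ?_
    filter_upwards [gt_mem_nhds h] with y hy
    rw [leafLength, if_neg hy.not_ge]
  · refine (continuousAt_const.sub hlog).congr (f := fun ξ => 3 - 2 * Real.log |ξ|) ?_
    filter_upwards [lt_mem_nhds h] with y hy
    rw [leafLength, if_pos hy.le]

/-- The time before the exit at which a fiber passes through height `s`. -/
def exitTime (L s : ℝ) : ℝ := max (1 - s) (L - 8 * s)

/-- The inverse of `exitTime L`. -/
def exitTimeInv (L a : ℝ) : ℝ := max (1 - a) ((L - a) / 8)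

theorem exitTime_strictAnti (L : ℝ) : StrictAnti (exitTime L) := fun s t h =>
  max_lt_max (by linarith) (by linarith)

theorem exitTimeInv_exitTime (L s : ℝ) : exitTimeInv L (exitTime L s) = s := by
  unfold exitTime exitTimeInv
  apply le_antisymm
  · refine max_le ?_ ?_
    · linarith [le_max_left (1 - s) (L - 8 * s)]
    · linarith [le_max_right (1 - s) (L - 8 * s)]
  · rcases max_choice (1 - s) (L - 8 * s) with h | h
    · rw [h]
      exact le_max_of_le_left (by linarith)
    · rw [h]
      exact le_max_of_le_right (by linarith)

theorem exitTime_exitTimeInv (L a : ℝ) : exitTime L (exitTimeInv L a) = a := by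
  unfold exitTime exitTimeInv
  apply le_antisymm
  · refine max_le ?_ ?_
    · linarith [le_max_left (1 - a) ((L - a) / 8)]
    · linarith [le_max_right (1 - a) ((L - a) / 8)]
  · rcases max_choice (1 - a) ((L - a) / 8) with h | h
    · rw [h]
      exact le_max_of_le_left (by linarith)
    · rw [h]
      exact le_max_of_le_right (by linarith)

/-- Here the time from the exit is the length minus the entry time `8 s`, as needed to agree with
the entry region. In `exitTime_eq_of_gt` the other branch takes over, as needed near the exit. -/
theorem exitTime_eq_of_lt {L s : ℝ} (hL : 2 ≤ L) (h : 8 * s ≤ 1) :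
    exitTime L s = L - 8 * s :=
  max_eq_right (by linarith)

theorem exitTime_eq_of_gt {L s : ℝ} (hL : L < 4) (h : 1 / 2 ≤ s) :
    exitTime L s = 1 - s :=
  max_eq_left (by linarith)

/-- The three regions that cover a neighbourhood of the boundary: near the entry region, near the
exit region, and near the parallel boundary. -/
inductive Region
  | entry
  | exit
  | side

namespace Region

/-- The piece that contains a region. -/
def piece : Region → Bool
  | entry => false
  | exit => true
  | side => true

/-- A region, in the covering of the thickened base. -/
def domain : Region → Set Thick
  | entry => {y | 8 * (y.1 : ℝ) < 1}
  | exit => {y | 1 / 2 < (y.1 : ℝ)}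
  | side => {y | Real.exp (-1 / 2) < |y.inv| ∧ 1 / 16 < (y.1 : ℝ)}

/-- The time after the end of the piece. -/
def time : Region → Thick → ℝ
  | entry, y => 8 * y.1
  | exit, y => 1 - y.1
  | side, y => exitTime (leafLength y.inv) y.1

/-- The coordinates of the points of a region in the piece that contains it. -/
def lift (k : Region) (y : Thick) : Coord := timePoint k.piece y.2.2 y.x (k.time y)

/-- The image of a region in the piece that contains it. -/
def image : Region → Set Coord
  | entry => {p | Real.exp (p.1 - 1) < eplog (labelA false p.2)}
  | exit => {p | Real.exp (p.1 - 1 / 2) < eplog (labelA true p.2)}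
  | side => {p | Real.exp (-1 / 2) < |leafInv true p.2|} ∩
      {p | 1 / 16 < exitTimeInv (leafLength (leafInv true p.2)) (p.1 - plog (labelA true p.2))}

/-- The height of a point of the image of a region. -/
def height : Region → Coord → ℝ
  | entry, p => (p.1 - plog (labelA false p.2)) / 8
  | exit, p => 1 - (p.1 - plog (labelA true p.2))
  | side, p => exitTimeInv (leafLength (leafInv true p.2)) (p.1 - plog (labelA true p.2))

/-- The inverse of `lift`. -/
def unlift (k : Region) (p : Coord) : Thick :=
  (projIcc 0 1 zero_le_one (k.height p),
    (ofRadial (baseRadius k.piece p.2), plog (labelA k.piece p.2)))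

end Region

/-! ### The three regions embed as open subsets of the pieces -/

theorem Thick.isOpen_inv : IsOpen {y : Thick | Real.exp (-1 / 2) < |y.inv|} :=
  isOpen_lt continuous_const Thick.continuous_inv.abs

theorem Region.isOpen_domain (k : Region) : IsOpen k.domain := by
  cases k
  · exact isOpen_lt (by fun_prop) continuous_const
  · exact isOpen_lt continuous_const (by fun_prop)
  · exact Thick.isOpen_inv.inter
      (isOpen_lt continuous_const (continuous_subtype_val.comp continuous_fst))

theorem Thick.x_ne_zero {y : Thick} (h : Real.exp (-1 / 2) < |y.inv|) : y.x ≠ 0 := by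
  intro h0
  have h1 : y.inv = 0 := baseInv_eq_zero_iff.2 h0
  rw [h1, abs_zero] at h
  exact absurd h (Real.exp_pos _).not_gt

theorem Thick.abs_inv_le (y : Thick) : |y.inv| ≤ 1 := abs_baseInv_le y.abs_x_le

theorem Region.lift_mem_piece {k : Region} {y : Thick} (hy : y ∈ k.domain) :
    k.lift y ∈ PLPlug.piece k.piece := by
  have h0 := y.1.2.1
  have h1 := y.1.2.2
  cases k
  · have : 8 * (y.1 : ℝ) < 1 := hy
    exact timePoint_mem y.abs_x_le (mul_nonneg (by norm_num) h0) this.le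
  · exact timePoint_mem y.abs_x_le (sub_nonneg.2 h1) (sub_le_self 1 h0)
  · obtain ⟨h2, h3⟩ := hy
    have hx := Thick.x_ne_zero h2
    have h4 : -1 / 2 < Real.log |y.inv| :=
      (Real.lt_log_iff_exp_lt ((Real.exp_pos _).trans h2)).2 h2
    have hL : leafLength y.inv + Real.log |y.inv| ≥ 2 := by
      have := Real.log_nonpos (abs_nonneg _) y.abs_inv_le
      unfold leafLength
      split_ifs <;> linarith
    refine ⟨?_, ?_, ?_⟩
    · have := nearEnd_shift true y.2.2 y.x (exitTime (leafLength y.inv) y.1)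
      refine this.le.trans ?_
      rw [Real.exp_le_one_iff, neg_nonpos]
      exact le_max_of_le_left (sub_nonneg.2 h1)
    · refine (nearMid_timePoint_true hx).trans_lt (Real.exp_lt_exp.2 ?_)
      change exitTime (leafLength y.inv) y.1 + 1 - leafLength y.inv - Real.log |y.inv| < 1
      -- Both bounds of the side region enter: `8 s > 1 / 2` and `log |inv| > -1 / 2` keep the point
      -- in the part of the exit piece that extends past the interface.
      have : exitTime (leafLength y.inv) y.1 < leafLength y.inv + Real.log |y.inv| :=
        max_lt (by linarith) (by linarith)
      linarith
    · exact leafInv_baseMap.symm ▸ y.abs_inv_le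

theorem labelA_lift (k : Region) (y : Thick) : plog (labelA k.piece (k.lift y).2) = y.2.2 := by
  simp only [Region.lift, timePoint, labelA_baseMap, plog_pexp]

theorem baseRadius_lift (k : Region) (y : Thick) : baseRadius k.piece (k.lift y).2 = y.x := by
  simp only [Region.lift, timePoint, baseRadius_baseMap]

theorem leafInv_lift (k : Region) (y : Thick) : leafInv k.piece (k.lift y).2 = y.inv :=
  leafInv_baseMap

theorem Region.height_lift (k : Region) (y : Thick) : k.height (k.lift y) = y.1 := by
  have h := labelA_lift k y
  have h' : (k.lift y).1 - y.2.2 = k.time y := by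
    simp only [Region.lift, timePoint]
    ring
  have h'' := leafInv_lift k y
  cases k <;> simp only [Region.height, Region.piece] at h h' h'' ⊢
  · rw [h, h', time]
    ring
  · rw [h, h', time]
    ring
  · rw [h, h', h'', time, exitTimeInv_exitTime]

theorem Region.unlift_lift (k : Region) (y : Thick) : k.unlift (k.lift y) = y := by
  rw [unlift, height_lift, labelA_lift, baseRadius_lift]
  refine Prod.ext ?_ (Prod.ext ?_ rfl)
  · exact projIcc_val zero_le_one y.1
  · exact ofRadial_radial _

theorem fst_ne_zero_of_leafInv {p : Coord} (h : Real.exp (-1 / 2) < |leafInv i p.2|) : p.2.1 ≠ 0 :=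
    by
  intro h0
  rw [leafInv_eq_zero_iff.2 h0, abs_zero] at h
  exact absurd h (Real.exp_pos _).not_gt

theorem Region.labelA_pos {k : Region} {p : Coord} (hp : p ∈ k.image) :
    0 < labelA k.piece p.2 := by
  cases k
  · exact eplog_pos_iff.1 ((Real.exp_pos _).trans hp)
  · exact eplog_pos_iff.1 ((Real.exp_pos _).trans hp)
  · exact (labels_pos_of_fst (fst_ne_zero_of_leafInv hp.1)).1

theorem Region.lift_mem_image {k : Region} {y : Thick} (hy : y ∈ k.domain) :
    k.lift y ∈ k.image := by
  have h := labelA_lift k y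
  have hh := Region.height_lift k y
  have hA : ∀ i, 0 < labelA i (baseMap i y.2.2 y.x) := fun i => by
    rw [labelA_baseMap]
    exact pexp_pos _
  have h' : (k.lift y).1 = y.2.2 + k.time y := rfl
  cases k
  · have hA' : 0 < labelA false (Region.lift .entry y).2 := hA false
    change Real.exp _ < _
    rw [eplog_of_pos hA', Real.exp_lt_exp, h']
    simp only [Region.piece] at h
    rw [h, time]
    have : 8 * (y.1 : ℝ) < 1 := hy
    linarith
  · have hA' : 0 < labelA true (Region.lift .exit y).2 := hA true
    change Real.exp _ < _
    rw [eplog_of_pos hA', Real.exp_lt_exp, h']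
    simp only [Region.piece] at h
    rw [h, time]
    have : 1 / 2 < (y.1 : ℝ) := hy
    linarith
  · refine ⟨?_, ?_⟩
    · change Real.exp (-1 / 2) < |leafInv true (Region.lift .side y).2|
      have := leafInv_lift .side y
      simp only [Region.piece] at this
      rw [this]
      exact hy.1
    · have h2 : Region.height .side (Region.lift .side y) = y.1 := hh
      change _ < Region.height .side (Region.lift .side y)
      rw [h2]
      exact hy.2

theorem Region.time_nonneg {k : Region} {p : Coord} (hp : p ∈ k.image)
    (hp' : p ∈ PLPlug.piece k.piece) : 0 ≤ p.1 - plog (labelA k.piece p.2) := by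
  have h1 : nearEnd k.piece p = _ := nearEnd_eq (t := p.1) (Region.labelA_pos hp)
  have h2 := hp'.1
  rw [h1, Real.exp_le_one_iff] at h2
  linarith

theorem Region.height_mem {k : Region} {p : Coord} (hp : p ∈ k.image)
    (hp' : p ∈ PLPlug.piece k.piece) : k.height p ∈ Icc (0 : ℝ) 1 := by
  have hA := Region.labelA_pos hp
  have h1 := Region.time_nonneg hp hp'
  cases k <;> simp only [Region.piece] at hA h1
  · have h2 : Real.exp _ < _ := hp
    rw [eplog_of_pos hA, Real.exp_lt_exp] at h2
    constructor <;> simp only [height] <;> linarith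
  · have h2 : Real.exp _ < _ := hp
    rw [eplog_of_pos hA, Real.exp_lt_exp] at h2
    constructor <;> simp only [height] <;> linarith
  · obtain ⟨h2, h3⟩ := hp
    have h4 := leafLength_lt h2
    refine ⟨?_, ?_⟩
    · have : 1 / 16 < height side p := h3
      linarith
    · exact max_le (by linarith) (by linarith)

theorem Region.lift_unlift {k : Region} {p : Coord} (hp : p ∈ k.image)
    (hp' : p ∈ PLPlug.piece k.piece) : k.unlift p ∈ k.domain ∧ k.lift (k.unlift p) = p := by
  have hA := Region.labelA_pos hp
  have hh := Region.height_mem hp hp'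
  have hs : (((k.unlift p).1 : unitInterval) : ℝ) = k.height p := by
    rw [unlift, projIcc_of_mem _ hh]
  have hx : (k.unlift p).x = baseRadius k.piece p.2 :=
    radial_ofRadial (abs_baseRadius_le hA hp'.2.2)
  have hb : baseMap k.piece (k.unlift p).2.2 (k.unlift p).x = p.2 := by
    rw [hx]
    exact baseMap_baseRadius hA hp'.2.2
  have hinv : (k.unlift p).inv = leafInv k.piece p.2 := by
    rw [← hb, leafInv_baseMap, Thick.inv]
  have htime : k.time (k.unlift p) = p.1 - plog (labelA k.piece p.2) := by
    cases k <;> simp only [time, hs, hinv]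
    · simp only [height, piece]
      ring
    · simp only [height, piece]
      ring
    · simp only [height, piece]
      exact exitTime_exitTimeInv _ _
  refine ⟨?_, ?_⟩
  · cases k
    · change 8 * (((unlift entry p).1 : unitInterval) : ℝ) < 1
      rw [hs]
      have h2 : Real.exp _ < _ := hp
      simp only [piece] at hA
      rw [eplog_of_pos hA, Real.exp_lt_exp] at h2
      simp only [height]
      linarith
    · change 1 / 2 < (((unlift exit p).1 : unitInterval) : ℝ)
      rw [hs]
      have h2 : Real.exp _ < _ := hp
      simp only [piece] at hA
      rw [eplog_of_pos hA, Real.exp_lt_exp] at h2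
      simp only [height]
      linarith
    · refine ⟨?_, ?_⟩
      · rw [hinv]
        exact hp.1
      · rw [hs]
        exact hp.2
  · rw [lift, timePoint, hb, htime]
    refine Prod.ext ?_ rfl
    simp only [unlift]
    ring

theorem continuousAt_plog_labelA {p : Coord} (h : 0 < labelA i p.2) :
    ContinuousAt (fun p : Coord => plog (labelA i p.2)) p :=
  ContinuousAt.comp (g := plog) (continuousAt_plog h)
    ((continuous_labelA i).comp continuous_snd).continuousAt

theorem continuousAt_exitTimeInv {p : Coord} (h : Real.exp (-1 / 2) < |leafInv true p.2|) :
    ContinuousAt (fun p : Coord =>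
      exitTimeInv (leafLength (leafInv true p.2)) (p.1 - plog (labelA true p.2))) p := by
  have h0 := fst_ne_zero_of_leafInv h
  have h1 : ContinuousAt (fun p : Coord => p.1 - plog (labelA true p.2)) p :=
    continuousAt_fst.sub (continuousAt_plog_labelA (labels_pos_of_fst h0).1)
  have h2 : ContinuousAt (fun p : Coord => leafLength (leafInv true p.2)) p :=
    ContinuousAt.comp (g := leafLength) (f := fun p : Coord => leafInv true p.2)
      (continuousAt_leafLength (leafInv_eq_zero_iff.not.2 h0))
      ((continuous_leafInv true).comp continuous_snd).continuousAt
  exact (continuousAt_const.sub h1).max ((h2.sub h1).div_const 8)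

theorem Region.isOpen_image (k : Region) : IsOpen k.image := by
  cases k
  · exact isOpen_lt (f := fun p : Coord => Real.exp (p.1 - 1)) (by fun_prop)
      (continuous_eplog.comp ((continuous_labelA false).comp continuous_snd))
  · exact isOpen_lt (f := fun p : Coord => Real.exp (p.1 - 1 / 2)) (by fun_prop)
      (continuous_eplog.comp ((continuous_labelA true).comp continuous_snd))
  · have hU : IsOpen {p : Coord | Real.exp (-1 / 2) < |leafInv true p.2|} :=
      isOpen_lt continuous_const ((continuous_leafInv true).comp continuous_snd).abs
    refine ContinuousOn.isOpen_inter_preimage (t := Ioi (1 / 16 : ℝ)) (fun p hp => ?_) hU isOpen_Ioi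
    exact (continuousAt_exitTimeInv hp).continuousWithinAt

theorem Region.continuousAt_height {k : Region} {p : Coord} (hp : p ∈ k.image) :
    ContinuousAt k.height p := by
  have hA := continuousAt_plog_labelA (Region.labelA_pos hp)
  cases k
  · exact (continuousAt_fst.sub hA).div_const 8
  · exact continuousAt_const.sub (continuousAt_fst.sub hA)
  · exact continuousAt_exitTimeInv hp.1

theorem Region.continuousOn_unlift (k : Region) :
    ContinuousOn k.unlift (k.image ∩ PLPlug.piece k.piece) := by
  refine ContinuousOn.prodMk ?_ (ContinuousOn.prodMk ?_ ?_)
  · exact continuous_projIcc.comp_continuousOn fun p hp =>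
      (Region.continuousAt_height hp.1).continuousWithinAt
  · refine continuous_ofRadial.comp_continuousOn ((continuousOn_baseRadius k.piece).comp
      continuous_snd.continuousOn fun p hp => ⟨Region.labelA_pos hp.1, hp.2.2.2⟩)
  · exact fun p hp => (continuousAt_plog_labelA (Region.labelA_pos hp.1)).continuousWithinAt

/-- The lift identifies the region with the trace of an open set on the piece, with continuous
inverse `unlift`, so openness passes to the support through `isOpen_image_pieceMap`. -/
theorem Region.isOpen_image_lift (k : Region) {V : Set Thick} (hV : IsOpen V)
    (hVD : V ⊆ k.domain) : IsOpen ((fun y => pieceMap k.piece (k.lift y)) '' V) := by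
  obtain ⟨U, hU, hUV⟩ := continuousOn_iff'.1 k.continuousOn_unlift V hV
  convert isOpen_image_pieceMap (i := k.piece) (hU.inter k.isOpen_image) using 1
  ext P
  constructor
  · rintro ⟨y, hy, rfl⟩
    have h1 : k.lift y ∈ k.image ∩ PLPlug.piece k.piece :=
      ⟨Region.lift_mem_image (hVD hy), Region.lift_mem_piece (hVD hy)⟩
    have h2 : k.lift y ∈ U ∩ (k.image ∩ PLPlug.piece k.piece) :=
      hUV ▸ ⟨by rwa [mem_preimage, k.unlift_lift], h1⟩
    exact ⟨k.lift y, ⟨⟨h2.1, h1.1⟩, h1.2⟩, rfl⟩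
  · rintro ⟨p, ⟨⟨hpU, hpi⟩, hp⟩, rfl⟩
    have h2 : p ∈ k.unlift ⁻¹' V ∩ (k.image ∩ PLPlug.piece k.piece) := hUV ▸ ⟨hpU, hpi, hp⟩
    refine ⟨k.unlift p, h2.1, ?_⟩
    simp only [(Region.lift_unlift hpi hp).2]

end

section

/-! ### The attaching map -/

theorem isOpenQuotientMap_thickCover : IsOpenQuotientMap thickCover := by
  have h1 : IsOpenQuotientMap (Prod.map id (Prod.map id ((↑) : ℝ → UnitAddCircle)) :
      Thick → unitInterval × (unitInterval × UnitAddCircle)) :=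
    IsOpenQuotientMap.id.prodMap (IsOpenQuotientMap.id.prodMap isOpenQuotientMap_coe)
  let e : unitInterval × (unitInterval × UnitAddCircle) ≃ₜ Annulus × unitInterval :=
    (Homeomorph.prodComm _ _).trans ((Homeomorph.prodComm _ _).prodCongr (Homeomorph.refl _))
  exact e.isOpenQuotientMap.comp h1

/-- A point of the thickened base, in the covering. -/
def thickRep (w : Annulus × unitInterval) : Thick := (w.2, (w.1.2, angleRep w.1.1))

theorem thickCover_thickRep (w : Annulus × unitInterval) : thickCover (thickRep w) = w := by
  obtain ⟨⟨θ, r⟩, s⟩ := w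
  simp only [thickCover, thickRep, coe_angleRep]

theorem thickCover_eq_iff {y y' : Thick} : thickCover y = thickCover y' ↔
    (∃ n : ℤ, y'.2.2 = y.2.2 - n) ∧ y'.x = y.x ∧ (y'.1 : ℝ) = y.1 := by
  constructor
  · intro h
    refine ⟨exists_int_of_coe_eq (congrArg (fun w => w.1.1) h), ?_, ?_⟩
    · exact congrArg (fun w => radial w.1.2) h.symm
    · exact congrArg (fun w => (w.2 : ℝ)) h.symm
  · rintro ⟨⟨n, hn⟩, hx, hs⟩
    simp only [thickCover, hn, coe_sub_intCast, radial_injective hx, Subtype.ext hs]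

theorem Thick.inv_congr {y y' : Thick} {n : ℤ} (hn : y'.2.2 = y.2.2 - n) (hx : y'.x = y.x) :
    y'.inv = y.inv := by
  rw [Thick.inv, hn, hx, baseInv_sub_int, ← Thick.inv]

/-! ### Agreement on overlaps and injectivity across regions -/

namespace Region

variable {k : Region} {y y' : Thick}

theorem mem_domain_congr (h : thickCover y = thickCover y') :
    y ∈ k.domain ↔ y' ∈ k.domain := by
  obtain ⟨⟨n, hn⟩, hx, hs⟩ := thickCover_eq_iff.1 h
  cases k <;> simp only [domain, mem_ofPred_eq, hs, Thick.inv_congr hn hx]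

theorem pieceMap_lift_congr (h : thickCover y = thickCover y') :
    pieceMap k.piece (k.lift y) = pieceMap k.piece (k.lift y') := by
  obtain ⟨⟨n, hn⟩, hx, hs⟩ := thickCover_eq_iff.1 h
  have ht : k.time y' = k.time y := by
    cases k <;> simp only [time, hs, Thick.inv_congr hn hx]
  rw [lift, lift, ht, hn, hx, timePoint_sub_int, pieceMap_deck]

theorem exitTime_of_exit (h : y ∈ exit.domain) (hL : Real.exp (-1 / 2) < |y.inv|) :
    exitTime (leafLength y.inv) y.1 = exit.time y :=
  exitTime_eq_of_gt (leafLength_lt hL) (le_of_lt h)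

theorem exitTime_of_entry (h : y ∈ entry.domain) :
    exitTime (leafLength y.inv) y.1 = leafLength y.inv - entry.time y :=
  exitTime_eq_of_lt (two_le_leafLength y.abs_inv_le) (le_of_lt h)

theorem not_mem_entry_exit (h : y ∈ entry.domain) (h' : y ∈ exit.domain) : False := by
  have h1 : 8 * (y.1 : ℝ) < 1 := h
  have h2 : 1 / 2 < (y.1 : ℝ) := h'
  linarith

theorem pieceMap_entry_side (h : y ∈ entry.domain) (h' : y ∈ side.domain) :
    pieceMap entry.piece (entry.lift y) = pieceMap side.piece (side.lift y) := by
  have h0 : 8 * (y.1 : ℝ) < 1 := h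
  have h1 : 1 / 16 < (y.1 : ℝ) := h'.2
  have h2 : -1 / 2 < Real.log |y.inv| :=
    (Real.lt_log_iff_exp_lt ((Real.exp_pos _).trans h'.1)).2 h'.1
  have h3 := pieceMap_timePoint_switch (φ := y.2.2) (x := y.x) (a := entry.time y)
    (Thick.x_ne_zero h'.1) y.abs_x_le (by simp only [time]; linarith)
    (by simp only [time]; linarith)
    (by change -(8 * (y.1 : ℝ)) < Real.log |y.inv|; linarith)
  refine h3.trans ?_
  have h4 : side.time y = leafLength (baseInv y.2.2 y.x) - entry.time y := exitTime_of_entry h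
  rw [← h4]
  rfl

theorem pieceMap_exit_side (h : y ∈ exit.domain) (h' : y ∈ side.domain) :
    pieceMap exit.piece (exit.lift y) = pieceMap side.piece (side.lift y) := by
  have h4 : side.time y = exit.time y := exitTime_of_exit h h'.1
  rw [lift, lift, h4]
  rfl

theorem pieceMap_lift_eq {k' : Region} (h : y ∈ k.domain) (h' : y ∈ k'.domain) :
    pieceMap k.piece (k.lift y) = pieceMap k'.piece (k'.lift y) := by
  cases k <;> cases k'
  · rfl
  · exact (not_mem_entry_exit h h').elim
  · exact pieceMap_entry_side h h'
  · exact (not_mem_entry_exit h' h).elim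
  · rfl
  · exact pieceMap_exit_side h h'
  · exact (pieceMap_entry_side h' h).symm
  · exact (pieceMap_exit_side h' h).symm
  · rfl

theorem time_inj (hn : y'.inv = y.inv) (h : k.time y' = k.time y) : (y'.1 : ℝ) = y.1 := by
  cases k
  · simp only [time] at h
    linarith
  · simp only [time] at h
    linarith
  · simp only [time, hn] at h
    exact (exitTime_strictAnti _).injective h

theorem thickCover_eq_of_lift (hy : y ∈ k.domain) (hy' : y' ∈ k.domain)
    (h : pieceMap k.piece (k.lift y) = pieceMap k.piece (k.lift y')) :
    thickCover y = thickCover y' := by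
  obtain ⟨⟨n, hn⟩, hx, ht⟩ := pieceMap_timePoint_inj (lift_mem_piece hy) (lift_mem_piece hy') h
  exact thickCover_eq_iff.2 ⟨⟨n, hn⟩, hx, time_inj (Thick.inv_congr hn hx) ht⟩

theorem thickCover_eq_exit_side (hy : y ∈ exit.domain) (hy' : y' ∈ side.domain)
    (h : pieceMap exit.piece (exit.lift y) = pieceMap side.piece (side.lift y')) :
    thickCover y = thickCover y' := by
  have hm := lift_mem_piece hy
  have hm' := lift_mem_piece hy'
  simp only [lift, piece] at h hm hm'
  obtain ⟨⟨n, hn⟩, hx, ht⟩ := pieceMap_timePoint_inj hm hm' h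
  have hi := Thick.inv_congr hn hx
  refine thickCover_eq_iff.2 ⟨⟨n, hn⟩, hx, time_inj (k := side) hi (ht.trans ?_)⟩
  exact (exitTime_of_exit hy (hi ▸ hy'.1)).symm

theorem thickCover_eq_entry_side (hy : y ∈ entry.domain) (hy' : y' ∈ side.domain)
    (h : pieceMap entry.piece (entry.lift y) = pieceMap side.piece (side.lift y')) :
    thickCover y = thickCover y' := by
  have hm := lift_mem_piece hy
  have hm' := lift_mem_piece hy'
  simp only [lift, piece] at h hm hm'
  obtain ⟨⟨n, hn⟩, hx, ht⟩ := pieceMap_timePoint_inj_switch hm hm' h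
  refine thickCover_eq_iff.2
    ⟨⟨n, hn⟩, hx, time_inj (k := side) (Thick.inv_congr hn hx) (ht.trans ?_)⟩
  exact (exitTime_of_entry hy).symm

/-- A common point would lie less than 1 after the entry and less than `1 / 2` before the exit, on a
leaf of length at least 2. -/
theorem not_pieceMap_entry_exit (hy : y ∈ entry.domain) (hy' : y' ∈ exit.domain)
    (h : pieceMap entry.piece (entry.lift y) = pieceMap exit.piece (exit.lift y')) : False := by
  have hm := lift_mem_piece hy
  have hm' := lift_mem_piece hy'
  simp only [lift, piece] at h hm hm'
  obtain ⟨-, -, ht⟩ := pieceMap_timePoint_inj_switch hm hm' h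
  have h0 : 8 * (y.1 : ℝ) < 1 := hy
  have h1 : 1 / 2 < (y'.1 : ℝ) := hy'
  have h2 : 2 ≤ leafLength (baseInv y.2.2 y.x) := two_le_leafLength y.abs_inv_le
  simp only [time] at ht
  linarith

theorem thickCover_eq_of_lift_eq {k' : Region} (hy : y ∈ k.domain) (hy' : y' ∈ k'.domain)
    (h : pieceMap k.piece (k.lift y) = pieceMap k'.piece (k'.lift y')) :
    thickCover y = thickCover y' := by
  cases k <;> cases k'
  · exact thickCover_eq_of_lift hy hy' h
  · exact (not_pieceMap_entry_exit hy hy' h).elim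
  · exact thickCover_eq_entry_side hy hy' h
  · exact (not_pieceMap_entry_exit hy' hy h.symm).elim
  · exact thickCover_eq_of_lift hy hy' h
  · exact thickCover_eq_exit_side hy hy' h
  · exact (thickCover_eq_entry_side hy' hy h.symm).symm
  · exact (thickCover_eq_exit_side hy' hy h.symm).symm
  · exact thickCover_eq_of_lift hy hy' h

end Region

open scoped Classical in
/-- The attaching map. -/
def attachFun (w : Annulus × unitInterval) : Support :=
  if thickRep w ∈ Region.entry.domain then pieceMap false (Region.entry.lift (thickRep w))
  else if thickRep w ∈ Region.exit.domain then pieceMap true (Region.exit.lift (thickRep w))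
  else pieceMap true (Region.side.lift (thickRep w))

/-- The domain of the attaching map. -/
def attachDomain : Set (Annulus × unitInterval) := ⋃ k : Region, thickCover '' k.domain

variable {k : Region} {y : Thick}

theorem mem_attachDomain : thickCover y ∈ attachDomain ↔ ∃ k : Region, y ∈ k.domain := by
  simp only [attachDomain, mem_iUnion]
  refine exists_congr fun k => ⟨?_, fun h => ⟨y, h, rfl⟩⟩
  rintro ⟨y', hy', h⟩
  exact (Region.mem_domain_congr h).1 hy'

theorem attachFun_thickCover (hy : y ∈ k.domain) :
    attachFun (thickCover y) = pieceMap k.piece (k.lift y) := by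
  have h := thickCover_thickRep (thickCover y)
  have hr := (Region.mem_domain_congr h).2 hy
  rw [← Region.pieceMap_lift_congr h, attachFun]
  split_ifs with h1 h2
  · exact Region.pieceMap_lift_eq (k := .entry) h1 hr
  · exact Region.pieceMap_lift_eq (k := .exit) h2 hr
  · cases k
    · exact absurd hr h1
    · exact absurd hr h2
    · rfl

/-! ### The attaching map is an open embedding near the boundary -/

theorem isOpen_attachDomain : IsOpen attachDomain :=
  isOpen_iUnion fun k => isOpenQuotientMap_thickCover.isOpenMap _ k.isOpen_domain

theorem injOn_attachFun : InjOn attachFun attachDomain := by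
  intro w hw w' hw' h
  rw [← thickCover_thickRep w] at hw h ⊢
  rw [← thickCover_thickRep w'] at hw' h ⊢
  obtain ⟨k, hk⟩ := mem_attachDomain.1 hw
  obtain ⟨k', hk'⟩ := mem_attachDomain.1 hw'
  rw [attachFun_thickCover hk, attachFun_thickCover hk'] at h
  exact Region.thickCover_eq_of_lift_eq hk hk' h

theorem attachFun_eventuallyEq (hy : y ∈ k.domain) :
    ∀ᶠ z in 𝓝 y, k.lift z ∈ piece k.piece ∧
      pieceMap k.piece (k.lift z) = attachFun (thickCover z) := by
  filter_upwards [k.isOpen_domain.mem_nhds hy] with z hz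
  exact ⟨Region.lift_mem_piece hz, (attachFun_thickCover hz).symm⟩

theorem Region.continuousAt_time (hy : y ∈ k.domain) : ContinuousAt k.time y := by
  cases k
  · exact (continuous_const.mul (continuous_subtype_val.comp continuous_fst)).continuousAt
  · exact (continuous_const.sub (continuous_subtype_val.comp continuous_fst)).continuousAt
  · have h1 : ContinuousAt (fun y : Thick => leafLength y.inv) y :=
      ContinuousAt.comp (g := leafLength) (f := Thick.inv)
        (continuousAt_leafLength (abs_pos.1 ((Real.exp_pos _).trans hy.1)))
        Thick.continuous_inv.continuousAt
    have h2 : ContinuousAt (fun y : Thick => (y.1 : ℝ)) y :=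
      (continuous_subtype_val.comp continuous_fst).continuousAt
    exact (continuousAt_const.sub h2).max (h1.sub (continuousAt_const.mul h2))

theorem Region.continuousAt_lift (hy : y ∈ k.domain) : ContinuousAt k.lift y := by
  have h : Continuous fun y : Thick => y.2.2 := by fun_prop
  exact (h.continuousAt.add (Region.continuousAt_time hy)).prodMk
    (continuous_baseMap_thick k.piece).continuousAt

theorem continuousAt_attachFun_thickCover (hy : y ∈ k.domain) :
    ContinuousAt (fun z => attachFun (thickCover z)) y := by
  have h := attachFun_eventuallyEq hy
  have h1 : ContinuousAt (fun z => pieceMap k.piece (k.lift z)) y :=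
    ((continuousOn_pieceMap k.piece) _ (Region.lift_mem_piece hy)).tendsto.comp
      (tendsto_nhdsWithin_iff.2 ⟨Region.continuousAt_lift hy, h.mono fun _ hz => hz.1⟩)
  exact h1.congr (h.mono fun _ hz => hz.2)

theorem continuousOn_attachFun : ContinuousOn attachFun attachDomain := by
  intro w hw
  rw [← thickCover_thickRep w] at hw ⊢
  obtain ⟨k, hk⟩ := mem_attachDomain.1 hw
  exact ((isOpenQuotientMap_thickCover.continuousAt_comp_iff (g := attachFun)).1
    (continuousAt_attachFun_thickCover hk)).continuousWithinAt

theorem isOpen_image_attachFun {V : Set (Annulus × unitInterval)} (hV : IsOpen V)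
    (hVU : V ⊆ attachDomain) : IsOpen (attachFun '' V) := by
  have : attachFun '' V = ⋃ k : Region,
      (fun y => pieceMap k.piece (k.lift y)) '' (thickCover ⁻¹' V ∩ k.domain) := by
    ext P
    simp only [mem_iUnion]
    constructor
    · rintro ⟨w, hw, rfl⟩
      rw [← thickCover_thickRep w] at hw ⊢
      obtain ⟨k, hk⟩ := mem_attachDomain.1 (hVU hw)
      exact ⟨k, thickRep w, ⟨hw, hk⟩, (attachFun_thickCover hk).symm⟩
    · rintro ⟨k, y, ⟨hy, hk⟩, rfl⟩
      exact ⟨thickCover y, hy, attachFun_thickCover hk⟩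
  rw [this]
  exact isOpen_iUnion fun k => k.isOpen_image_lift
    ((hV.preimage isOpenQuotientMap_thickCover.continuous).inter k.isOpen_domain) inter_subset_right

/-- The attaching map, as a partial homeomorphism. -/
def attach : OpenPartialHomeomorph (Annulus × unitInterval) Support :=
  OpenPartialHomeomorph.ofContinuousOpenRestrict injOn_attachFun.toPartialEquiv
    continuousOn_attachFun (by
      intro V hV
      obtain ⟨W, hW, rfl⟩ := isOpen_induced_iff.1 hV
      have : attachDomain.domRestrict attachFun '' (Subtype.val ⁻¹' W) =
          attachFun '' (W ∩ attachDomain) := by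
        ext P
        constructor
        · rintro ⟨⟨w, hw⟩, hw', rfl⟩
          exact ⟨w, ⟨hw', hw⟩, rfl⟩
        · rintro ⟨w, ⟨hw', hw⟩, rfl⟩
          exact ⟨⟨w, hw⟩, hw', rfl⟩
      exact this ▸ isOpen_image_attachFun (hW.inter isOpen_attachDomain) inter_subset_right)
    isOpen_attachDomain

theorem thickBoundary_subset : thickBoundary ⊆ attachDomain := by
  intro w hw
  rw [← thickCover_thickRep w, mem_attachDomain]
  have hx : ∀ h : |(thickRep w).x| = 1, ∃ k : Region, thickRep w ∈ k.domain := by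
    intro h
    have h1 : |(thickRep w).inv| = 1 := abs_baseInv_one _ h
    by_cases hs : 8 * (w.2 : ℝ) < 1
    · exact ⟨.entry, hs⟩
    · refine ⟨.side, ?_, ?_⟩
      · rw [h1, Real.exp_lt_one_iff]
        norm_num
      · change 1 / 16 < (w.2 : ℝ)
        linarith
  rcases hw with h | h | h | h <;> simp only at h
  · exact hx (by simp [thickRep, Thick.x, radial, h])
  · refine hx ?_
    simp only [thickRep, Thick.x, radial, h]
    norm_num
  · refine ⟨.entry, ?_⟩
    simp [Region.domain, thickRep, h]
  · refine ⟨.exit, ?_⟩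
    simp only [Region.domain, thickRep, h, mem_ofPred_eq]
    norm_num

theorem attachFun_zero (w : Annulus) : attachFun (w, 0) = endMap false w := by
  have h : thickRep (w, 0) ∈ Region.entry.domain := by simp [Region.domain, thickRep]
  have h1 := attachFun_thickCover h
  rw [thickCover_thickRep] at h1
  rw [h1, endMap]
  simp [Region.lift, Region.time, Region.piece, timePoint, endPoint, thickRep, Thick.x]

theorem attachFun_one (w : Annulus) : attachFun (w, 1) = endMap true w := by
  have h : thickRep (w, 1) ∈ Region.exit.domain := by
    simp only [Region.domain, thickRep, mem_ofPred_eq]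
    norm_num
  have h1 := attachFun_thickCover h
  rw [thickCover_thickRep] at h1
  rw [h1, endMap]
  simp [Region.lift, Region.time, Region.piece, timePoint, endPoint, thickRep, Thick.x]

theorem pieceMap_mem_target {p : Coord} (hp : p ∈ k.image) (hp' : p ∈ piece k.piece) :
    pieceMap k.piece p ∈ attach.target := by
  obtain ⟨h1, h2⟩ := Region.lift_unlift hp hp'
  refine ⟨thickCover (k.unlift p), mem_attachDomain.2 ⟨k, h1⟩, ?_⟩
  rw [attachFun_thickCover h1, h2]

theorem labelA_pos_of_abs_leafInv {i : Bool} {q : ℝ × ℝ} (h : |leafInv i q| = 1) :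
    0 < labelA i q := by
  refine (labels_pos_of_fst fun h0 => ?_).1
  rw [leafInv_eq_zero_iff.2 h0, abs_zero] at h
  exact zero_ne_one h

theorem exists_timePoint_eq {i : Bool} {p : Coord} (h : |leafInv i p.2| = 1) :
    ∃ x, x ≠ 0 ∧ leafInv i p.2 = baseInv (plog (labelA i p.2)) x ∧
      p = timePoint i (plog (labelA i p.2)) x (p.1 - plog (labelA i p.2)) := by
  have hb := baseMap_baseRadius (labelA_pos_of_abs_leafInv h) h.le
  refine ⟨baseRadius i p.2, fun h0 => ?_, ?_, Prod.ext ?_ hb.symm⟩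
  · rw [← hb, leafInv_baseMap, baseInv_eq_zero_iff.2 h0, abs_zero] at h
    exact zero_ne_one h
  · rw [← leafInv_baseMap, hb]
  · simp [timePoint]

theorem pieceMap_mem_target_of_parallel {p : Coord} (hp : p ∈ halfPiece true)
    (h : |leafInv true p.2| = 1) : pieceMap true p ∈ attach.target := by
  obtain ⟨x, hx, hi, hpt⟩ := exists_timePoint_eq h
  have h1 := hp.2.1
  rw [hpt, nearMid_timePoint_true hx, Real.exp_le_one_iff, ← hi, h, Real.log_one] at h1
  refine pieceMap_mem_target (k := .side) ⟨?_, ?_⟩ (halfPiece_subset hp)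
  · rw [mem_ofPred_eq, h, Real.exp_lt_one_iff]
    norm_num
  -- Before the interface the time from the exit is at most the length minus 1, so the second branch
  -- gives height at least `1 / 8`.
  · change 1 / 16 < max _ ((leafLength (leafInv true p.2) - (p.1 - plog (labelA true p.2))) / 8)
    exact lt_max_of_lt_right (by linarith)

theorem boundary_subset_target : plugFoliation.boundary ⊆ attach.target := by
  intro P hP
  rcases mem_boundary.1 hP with h | h | h
  · obtain ⟨w, rfl⟩ := (mem_range_endMap (i := false)).2 (by simpa using h)
    exact ⟨(w, 0), thickBoundary_subset (.inr (.inr (.inl rfl))), attachFun_zero w⟩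
  · obtain ⟨w, rfl⟩ := (mem_range_endMap (i := true)).2 (by simpa using h)
    exact ⟨(w, 1), thickBoundary_subset (.inr (.inr (.inr rfl))), attachFun_one w⟩
  · obtain ⟨i, p, hp, -, rfl⟩ := exists_halfMap_eq P
    rw [coe_halfMap_inv hp.2.2] at h
    rw [← pieceMap_of_le hp.2.1]
    cases i
    · have hA := labelA_pos_of_abs_leafInv h
      obtain ⟨x, hx, hi, hpt⟩ := exists_timePoint_eq h
      rcases hp.2.1.lt_or_eq with h1 | h1
      · refine pieceMap_mem_target (k := .entry) ?_ (halfPiece_subset hp)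
        change Real.exp (p.1 - 1) < eplog (labelA false p.2)
        rw [hpt, nearMid_timePoint_false hx, Real.exp_lt_one_iff, ← hi, h, Real.log_one] at h1
        rw [eplog_of_pos hA, Real.exp_lt_exp]
        linarith
      -- The entry region stops just short of the interface, so a point on the interface is moved to
      -- the exit piece and caught by the side region.
      · rw [← pieceMap_switch (halfPiece_subset hp) (by rw [h1, Real.exp_lt_one_iff]; norm_num)]
        refine pieceMap_mem_target_of_parallel
          (switch_mem_halfPiece (halfPiece_subset hp) h1.ge) ?_
        have := leafInv_switchMap (i := false) (q := p.2)
        exact (congrArg abs this).trans h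
    · exact pieceMap_mem_target_of_parallel hp h

/-! ### The attaching map is foliated -/

section foliated

theorem pl_x : PL thickCoords Thick.x y :=
  (PL.refl.snd.fst.mul 2).sub (PL.const 1)

theorem pl_angle : PL thickCoords (fun y : Thick => y.2.2) y := PL.refl.snd.snd

theorem pl_height : PL thickCoords (fun y : Thick => (y.1 : ℝ)) y := PL.refl.fst

/-- The logarithm undoes the exponentials in the invariant and leaves `φ + plog (baseLabel φ |x|)`,
which is PL off the axis. -/
theorem pl_leafLength (h : y.x ≠ 0) : PL thickCoords (fun y : Thick => leafLength y.inv) y := by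
  have hb : PL thickCoords (fun y : Thick => baseLabel y.2.2 |y.x|) y :=
    PL.baseLabel pl_angle (pl_x.max pl_x.neg) (by fun_prop)
      (.of_forall fun y => ⟨abs_nonneg _, Thick.abs_x_le y⟩)
  have hcb : ContinuousAt (fun y : Thick => baseLabel y.2.2 |y.x|) y :=
    hb.continuousAt (by unfold thickCoords; fun_prop)
  have hl : PL thickCoords (fun y : Thick => 2 * (y.2.2 + plog (baseLabel y.2.2 |y.x|))) y :=
    (pl_angle.add (hb.plog hcb (baseLabel_pos (abs_pos.2 h)))).mul 2
  have hc := Thick.continuous_x.continuousAt (x := y)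
  rcases lt_or_gt_of_ne h with h | h
  · refine ((PL.const 2).sub hl).congr ?_
    filter_upwards [hc.eventually (gt_mem_nhds h)] with z hz
    simp only [Thick.inv]
    rw [leafLength, log_abs_baseInv hz.ne, if_neg (baseInv_nonneg_iff.not.2 hz.not_ge)]
  · refine ((PL.const 3).sub hl).congr ?_
    filter_upwards [hc.eventually (lt_mem_nhds h)] with z hz
    simp only [Thick.inv]
    rw [leafLength, log_abs_baseInv hz.ne', if_pos (baseInv_nonneg_iff.2 hz.le)]

theorem Region.pl_time (hy : y ∈ k.domain) : PL thickCoords k.time y := by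
  cases k
  · exact pl_height.mul 8
  · exact (PL.const 1).sub pl_height
  · exact ((PL.const 1).sub pl_height).max
      ((pl_leafLength (Thick.x_ne_zero hy.1)).sub (pl_height.mul 8))

/-- Times in the exit piece are measured back from the exit, and `orient` compensates for the sign.
-/
theorem Region.oriented_time {y z : Thick} (h : y.2 = z.2) (h' : (y.1 : ℝ) < z.1) :
    orient k.piece * k.time y < orient k.piece * k.time z := by
  have hi : y.inv = z.inv := by simp only [Thick.inv, Thick.x, h]
  cases k <;> simp only [orient, piece, time, hi, if_true, Bool.false_eq_true, if_false]
  · linarith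
  · linarith
  · have := exitTime_strictAnti (leafLength z.inv) h'
    linarith

theorem Region.foliatedPLAt_lift (hy : y ∈ k.domain) :
    FoliatedPLAt thickCoords (oriented k.piece ∘ k.lift) y := by
  refine ⟨PLWith.plAt (Q := fun _ => True) (PL.pair ((pl_angle.add (Region.pl_time hy)).mul _)
    (pl_baseMap k.piece pl_angle pl_x (by fun_prop) (.of_forall Thick.abs_x_le))),
    ⟨fun q => baseMap k.piece q.2 (2 * q.1 - 1), .of_forall fun z => rfl⟩, univ, univ_mem, ?_⟩
  intro z _ z' _ h h'
  have h2 : z.2 = z'.2 := Prod.ext (Subtype.ext (congrArg (fun q : ℝ × ℝ => q.1) h)) (congrArg (fun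
      q : ℝ × ℝ => q.2) h)
  have h3 := Region.oriented_time (k := k) h2 h'
  change orient k.piece * (z.2.2 + k.time z) < orient k.piece * (z'.2.2 + k.time z')
  rw [h2]
  linarith

end foliated

/-- The attaching map of the plug. -/
def attachingMap : AttachingMap plugFoliation plug where
  toMap := attach
  boundary_source := thickBoundary_subset
  boundary_target := boundary_subset_target
  map_zero := attachFun_zero
  map_one := attachFun_one
  foliated := by
    rintro y hy e ⟨d⟩ he
    obtain ⟨k, hk⟩ := mem_attachDomain.1 hy
    have h := attachFun_eventuallyEq hk
    exact (Region.foliatedPLAt_lift hk).trans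
      (d.transition_of_lift he (continuousAt_attachFun_thickCover hk) rfl
        (Region.continuousAt_lift hk) (h.mono fun _ h => h.1)
        (h.mono fun _ h => h.2)).1.foliatedPLAt

end

section

/-! ### Curves on the boundary of the square -/

theorem angleRep_mem (θ : UnitAddCircle) : angleRep θ ∈ Ico (0 : ℝ) 1 := by
  obtain ⟨h1, h2⟩ := (AddCircle.equivIco (1 : ℝ) 0 θ).2
  exact ⟨h1, h2.trans_eq (zero_add 1)⟩

theorem apply_angleRep {X : Type*} {f : ℝ → X} (h : f 0 = f 1) {t : ℝ} (ht : t ∈ Icc (0 : ℝ) 1) :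
    f (angleRep t) = f t := by
  obtain ⟨n, hn⟩ := exists_angleRep_coe t
  have h1 := angleRep_mem t
  rw [hn] at h1 ⊢
  have h2 : (n : ℝ) < 2 := by linarith [h1.1, ht.2]
  have h3 : (-1 : ℝ) < n := by linarith [h1.2, ht.1]
  have h4 : n < 2 := by exact_mod_cast h2
  have h5 : -1 < n := by exact_mod_cast h3
  obtain rfl | rfl : n = 0 ∨ n = 1 := by omega
  · simp
  · have : t = 1 := by
      have := h1.1
      push_cast at this
      linarith [ht.2]
    simp [this, h]

theorem continuous_apply_angleRep {X : Type*} [TopologicalSpace X] {f : ℝ → X} (h : f 0 = f 1)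
    (hf : Continuous f) : Continuous fun θ : UnitAddCircle => f (angleRep θ) :=
  AddCircle.liftIco_continuous (p := (1 : ℝ)) (a := 0) (f := f) (by simpa using h)
    hf.continuousOn

theorem coe_projIcc_of_mem {x : ℝ} (h : x ∈ Icc (0 : ℝ) 1) :
    ((projIcc 0 1 zero_le_one x : unitInterval) : ℝ) = x := by
  rw [projIcc_of_mem _ h]

theorem coe_projIcc_of_le {x : ℝ} (h : x ≤ 0) :
    ((projIcc 0 1 zero_le_one x : unitInterval) : ℝ) = 0 := by
  rw [projIcc_of_le_left _ h]

theorem coe_projIcc_of_ge {x : ℝ} (h : 1 ≤ x) :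
    ((projIcc 0 1 zero_le_one x : unitInterval) : ℝ) = 1 := by
  rw [projIcc_of_right_le _ h]

/-- The loop around the boundary of the square. -/
def squareLoop (t : ℝ) : unitInterval × unitInterval :=
  (projIcc 0 1 zero_le_one (min (4 * t - 1) (4 - 4 * t)),
    projIcc 0 1 zero_le_one (max (1 - 4 * t) (4 * t - 2)))

theorem continuous_squareLoop : Continuous squareLoop :=
  (continuous_projIcc.comp (by fun_prop)).prodMk (continuous_projIcc.comp (by fun_prop))

variable {t : ℝ}

theorem squareLoop_left (h : 0 ≤ t) (h' : t ≤ 1 / 4) :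
    (squareLoop t).1 = 0 ∧ ((squareLoop t).2 : ℝ) = 1 - 4 * t := by
  rw [squareLoop, min_eq_left (by linarith), max_eq_left (by linarith)]
  exact ⟨projIcc_of_le_left zero_le_one (by linarith),
    coe_projIcc_of_mem ⟨by linarith, by linarith⟩⟩

theorem squareLoop_bottom (h : 1 / 4 ≤ t) (h' : t ≤ 1 / 2) :
    ((squareLoop t).1 : ℝ) = 4 * t - 1 ∧ (squareLoop t).2 = 0 := by
  rw [squareLoop, min_eq_left (by linarith)]
  exact ⟨coe_projIcc_of_mem ⟨by linarith, by linarith⟩,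
    projIcc_of_le_left zero_le_one (max_le (by linarith) (by linarith))⟩

theorem squareLoop_right (h : 1 / 2 ≤ t) (h' : t ≤ 3 / 4) :
    (squareLoop t).1 = 1 ∧ ((squareLoop t).2 : ℝ) = 4 * t - 2 := by
  rw [squareLoop, max_eq_right (by linarith)]
  exact ⟨projIcc_of_right_le zero_le_one (le_min (by linarith) (by linarith)),
    coe_projIcc_of_mem ⟨by linarith, by linarith⟩⟩

theorem squareLoop_top (h : 3 / 4 ≤ t) (h' : t ≤ 1) :
    ((squareLoop t).1 : ℝ) = 4 - 4 * t ∧ (squareLoop t).2 = 1 := by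
  rw [squareLoop, min_eq_right (by linarith), max_eq_right (by linarith)]
  exact ⟨coe_projIcc_of_mem ⟨by linarith, by linarith⟩,
    projIcc_of_right_le zero_le_one (by linarith)⟩

theorem squareLoop_cases (h : t ∈ Icc (0 : ℝ) 1) :
    (t ≤ 1 / 4 ∧ ((squareLoop t).1 : ℝ) = 0 ∧ ((squareLoop t).2 : ℝ) = 1 - 4 * t) ∨
    ((1 / 4 ≤ t ∧ t ≤ 1 / 2) ∧ ((squareLoop t).1 : ℝ) = 4 * t - 1 ∧ ((squareLoop t).2 : ℝ) = 0) ∨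
    ((1 / 2 ≤ t ∧ t ≤ 3 / 4) ∧ ((squareLoop t).1 : ℝ) = 1 ∧ ((squareLoop t).2 : ℝ) = 4 * t - 2) ∨
    (3 / 4 ≤ t ∧ ((squareLoop t).1 : ℝ) = 4 - 4 * t ∧ ((squareLoop t).2 : ℝ) = 1) := by
  rcases le_total t (1 / 2) with h1 | h1
  · rcases le_total t (1 / 4) with h2 | h2
    · have := squareLoop_left h.1 h2
      exact .inl ⟨h2, congrArg Subtype.val this.1, this.2⟩
    · have := squareLoop_bottom h2 h1
      exact .inr (.inl ⟨⟨h2, h1⟩, this.1, congrArg Subtype.val this.2⟩)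
  · rcases le_total t (3 / 4) with h2 | h2
    · have := squareLoop_right h1 h2
      exact .inr (.inr (.inl ⟨⟨h1, h2⟩, congrArg Subtype.val this.1, this.2⟩))
    · have := squareLoop_top h2 h.2
      exact .inr (.inr (.inr ⟨h2, this.1, congrArg Subtype.val this.2⟩))

theorem squareLoop_zero_eq_one : squareLoop 0 = squareLoop 1 := by
  have h0 := squareLoop_left (t := 0) le_rfl (by norm_num)
  have h1 := squareLoop_top (t := 1) (by norm_num) le_rfl
  refine Prod.ext ?_ ?_
  · rw [h0.1]
    refine Subtype.ext (Eq.symm (h1.1.trans ?_))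
    norm_num
  · rw [h1.2]
    refine Subtype.ext (h0.2.trans ?_)
    norm_num

theorem squareLoop_injOn : InjOn squareLoop (Ico 0 1) := by
  intro t ht t' ht' h
  have h1 : ((squareLoop t).1 : ℝ) = (squareLoop t').1 := by rw [h]
  have h2 : ((squareLoop t).2 : ℝ) = (squareLoop t').2 := by rw [h]
  have h3 := ht.2
  have h4 := ht'.2
  rcases squareLoop_cases ⟨ht.1, ht.2.le⟩ with ⟨a, b, c⟩ | ⟨a, b, c⟩ | ⟨a, b, c⟩ | ⟨a, b, c⟩ <;>
  rcases squareLoop_cases ⟨ht'.1, ht'.2.le⟩ with ⟨a', b', c'⟩ | ⟨a', b', c'⟩ | ⟨a', b', c'⟩ |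
    ⟨a', b', c'⟩ <;> linarith

theorem squareLoop_mem (h : t ∈ Icc (0 : ℝ) 1) : squareLoop t ∈ squareBoundary := by
  rcases squareLoop_cases h with ⟨-, b, c⟩ | ⟨-, b, c⟩ | ⟨-, b, c⟩ | ⟨-, b, c⟩
  · exact .inl (Subtype.ext b)
  · exact .inr (.inr (.inl (Subtype.ext c)))
  · exact .inr (.inl (Subtype.ext b))
  · exact .inr (.inr (.inr (Subtype.ext c)))

theorem exists_squareLoop_eq {w : unitInterval × unitInterval} (hw : w ∈ squareBoundary) :
    ∃ t ∈ Icc (0 : ℝ) 1, squareLoop t = w := by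
  obtain ⟨r, s⟩ := w
  have hr := r.2
  have hs := s.2
  rcases hw with h | h | h | h <;> simp only at h <;> subst h
  · have := squareLoop_left (t := (1 - s) / 4) (by linarith [hs.2]) (by linarith [hs.1])
    exact ⟨(1 - s) / 4, ⟨by linarith [hs.2], by linarith [hs.1]⟩,
      Prod.ext this.1 (Subtype.ext (this.2.trans (by ring)))⟩
  · have := squareLoop_right (t := (s + 2) / 4) (by linarith [hs.1]) (by linarith [hs.2])
    exact ⟨(s + 2) / 4, ⟨by linarith [hs.1], by linarith [hs.2]⟩,
      Prod.ext this.1 (Subtype.ext (this.2.trans (by ring)))⟩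
  · have := squareLoop_bottom (t := (r + 1) / 4) (by linarith [hr.1]) (by linarith [hr.2])
    exact ⟨(r + 1) / 4, ⟨by linarith [hr.1], by linarith [hr.2]⟩,
      Prod.ext (Subtype.ext (this.1.trans (by ring))) this.2⟩
  · have := squareLoop_top (t := (4 - r) / 4) (by linarith [hr.2]) (by linarith [hr.1])
    exact ⟨(4 - r) / 4, ⟨by linarith [hr.2], by linarith [hr.1]⟩,
      Prod.ext (Subtype.ext (this.1.trans (by ring))) this.2⟩

/-- The parametrisation of the boundary of the square. -/
def squareCurve : UnitAddCircle ≃ₜ squareBoundary :=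
  Continuous.homeoOfEquivCompactToT2
    (f := Equiv.ofBijective
      (fun θ => (⟨squareLoop (angleRep θ), squareLoop_mem (Ico_subset_Icc_self (angleRep_mem θ))⟩ :
        squareBoundary)) ⟨by
          intro θ θ' h
          have := squareLoop_injOn (angleRep_mem θ) (angleRep_mem θ') (congrArg Subtype.val h)
          rw [← coe_angleRep θ, this, coe_angleRep], by
          rintro ⟨w, hw⟩
          obtain ⟨t, ht, rfl⟩ := exists_squareLoop_eq hw
          exact ⟨t, Subtype.ext (apply_angleRep squareLoop_zero_eq_one ht)⟩⟩)
    ((continuous_apply_angleRep squareLoop_zero_eq_one continuous_squareLoop).subtype_mk _)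

/-! ### The disk and the square -/

section cone

variable {T E E' : Type*} [TopologicalSpace T]
  [NormedAddCommGroup E] [NormedSpace ℝ E] [NormedAddCommGroup E'] [NormedSpace ℝ E']

/-- A parametrisation of the unit sphere. -/
structure IsSphereParam (A : T → E) : Prop where
  continuous : Continuous A
  injective : Function.Injective A
  norm : ∀ t, ‖A t‖ = 1
  surj : ∀ v, ‖v‖ = 1 → ∃ t, A t = v

/-- The cone over a parametrised unit sphere. -/
def cone (A : T → E) (hA : IsSphereParam A) : C(unitInterval × T, Metric.closedBall (0 : E) 1) where
  toFun p := ⟨(p.1 : ℝ) • A p.2, by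
    rw [mem_closedBall_zero_iff, norm_smul, hA.norm, mul_one, Real.norm_of_nonneg p.1.2.1]
    exact p.1.2.2⟩
  continuous_toFun := by
    have := hA.continuous
    fun_prop

theorem cone_eq_iff {A : T → E} (hA : IsSphereParam A) {p p' : unitInterval × T} :
    cone A hA p = cone A hA p' ↔ p.1 = p'.1 ∧ (p.1 = 0 ∨ p.2 = p'.2) := by
  obtain ⟨r, t⟩ := p
  obtain ⟨r', t'⟩ := p'
  simp only [cone, ContinuousMap.coe_mk, Subtype.mk.injEq]
  constructor
  · intro h
    have hr : r = r' := by
      have := congrArg norm h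
      rw [norm_smul, norm_smul, hA.norm, hA.norm, Real.norm_of_nonneg r.2.1,
        Real.norm_of_nonneg r'.2.1, mul_one, mul_one] at this
      exact Subtype.ext this
    subst hr
    refine ⟨rfl, or_iff_not_imp_left.2 fun h0 => hA.injective ?_⟩
    have h0' : (r : ℝ) ≠ 0 := fun h1 => h0 (Subtype.ext h1)
    exact smul_right_injective _ h0' h
  · rintro ⟨rfl, rfl | rfl⟩
    · simp
    · rfl

theorem cone_surjective [Nonempty T] {A : T → E} (hA : IsSphereParam A) :
    Function.Surjective (cone A hA) := by
  rintro ⟨v, hv⟩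
  rw [mem_closedBall_zero_iff] at hv
  rcases eq_or_ne v 0 with rfl | h0
  · refine ⟨(0, Classical.arbitrary T), Subtype.ext ?_⟩
    simp [cone]
  · have hn := norm_ne_zero_iff.2 h0
    obtain ⟨t, ht⟩ := hA.surj (‖v‖⁻¹ • v) (by rw [norm_smul, norm_inv, norm_norm, inv_mul_cancel₀
        hn])
    refine ⟨(⟨‖v‖, norm_nonneg v, hv⟩, t), Subtype.ext ?_⟩
    simp only [cone, ContinuousMap.coe_mk, ht, smul_inv_smul₀ hn]

theorem isQuotientMap_cone [CompactSpace T] [Nonempty T] {A : T → E} (hA : IsSphereParam A) :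
    IsQuotientMap (cone A hA) :=
  IsQuotientMap.of_surjective_continuous (cone_surjective hA) (cone A hA).continuous

theorem cone_factorsThrough {A : T → E} {B : T → E'} (hA : IsSphereParam A)
    (hB : IsSphereParam B) : Function.FactorsThrough (cone B hB) (cone A hA) :=
  fun _ _ h => (cone_eq_iff hB).2 ((cone_eq_iff hA).1 h)

theorem lift_cone_apply [CompactSpace T] [Nonempty T] {A : T → E} {B : T → E'}
    (hA : IsSphereParam A) (hB : IsSphereParam B) (p : unitInterval × T) :
    (isQuotientMap_cone hA).lift (cone B hB) (cone_factorsThrough hA hB) (cone A hA p) =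
      cone B hB p :=
  DFunLike.congr_fun ((isQuotientMap_cone hA).lift_comp (cone B hB) (cone_factorsThrough hA hB)) p

/-- Parametrised spheres extend to the balls. -/
def coneHomeo [CompactSpace T] [Nonempty T] {A : T → E} {B : T → E'} (hA : IsSphereParam A)
    (hB : IsSphereParam B) : Metric.closedBall (0 : E) 1 ≃ₜ Metric.closedBall (0 : E') 1 where
  toFun := (isQuotientMap_cone hA).lift (cone B hB) (cone_factorsThrough hA hB)
  invFun := (isQuotientMap_cone hB).lift (cone A hA) (cone_factorsThrough hB hA)
  left_inv v := by
    obtain ⟨p, rfl⟩ := cone_surjective hA v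
    rw [lift_cone_apply, lift_cone_apply]
  right_inv v := by
    obtain ⟨p, rfl⟩ := cone_surjective hB v
    rw [lift_cone_apply, lift_cone_apply]
  continuous_toFun := ContinuousMap.continuous _
  continuous_invFun := ContinuousMap.continuous _

theorem coneHomeo_apply [CompactSpace T] [Nonempty T] {A : T → E} {B : T → E'}
    (hA : IsSphereParam A) (hB : IsSphereParam B) {v : Metric.closedBall (0 : E) 1} {t : T}
    (h : (v : E) = A t) : (coneHomeo hA hB v : E') = B t := by
  have hv : v = cone A hA (1, t) := Subtype.ext (by simp [cone, h])
  have : coneHomeo hA hB (cone A hA (1, t)) = cone B hB (1, t) := lift_cone_apply hA hB _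
  rw [hv, this]
  simp [cone]

end cone

theorem isSphereParam_toCircle :
    IsSphereParam fun t : UnitAddCircle => (AddCircle.toCircle t : ℂ) where
  continuous := continuous_subtype_val.comp AddCircle.continuous_toCircle
  injective := Circle.coe_injective.comp (AddCircle.injective_toCircle one_ne_zero)
  norm _ := Circle.norm_coe _
  surj v hv := by
    obtain ⟨t, ht⟩ := (AddCircle.homeomorphCircle one_ne_zero).surjective
      (⟨v, mem_sphere_zero_iff_norm.2 hv⟩ : Circle)
    exact ⟨t, by rw [← AddCircle.homeomorphCircle_apply one_ne_zero, ht]⟩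

theorem abs_radial_eq_one {r : unitInterval} : |radial r| = 1 ↔ r = 0 ∨ r = 1 := by
  rw [radial, abs_eq zero_le_one, or_comm]
  refine or_congr ⟨fun h => Subtype.ext ?_, fun h => ?_⟩ ⟨fun h => Subtype.ext ?_, fun h => ?_⟩
  · change (r : ℝ) = 0
    linarith
  · simp [h]
  · change (r : ℝ) = 1
    linarith
  · rw [h]
    norm_num

/-- The boundary of the square, centred at the origin. -/
def centredCurve (t : UnitAddCircle) : ℝ × ℝ :=
  (radial (squareCurve t).1.1, radial (squareCurve t).1.2)

theorem isSphereParam_centredCurve : IsSphereParam centredCurve where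
  continuous := by
    have h : Continuous fun t => (squareCurve t : unitInterval × unitInterval) :=
      continuous_subtype_val.comp squareCurve.continuous
    exact (continuous_radial.comp h.fst).prodMk (continuous_radial.comp h.snd)
  injective t t' h := squareCurve.injective (Subtype.ext (Prod.ext
    (radial_injective (congrArg Prod.fst h)) (radial_injective (congrArg Prod.snd h))))
  norm t := by
    have h := (squareCurve t).2
    have h1 := abs_radial_le (squareCurve t).1.1
    have h2 := abs_radial_le (squareCurve t).1.2
    rw [centredCurve, Prod.norm_mk, Real.norm_eq_abs, Real.norm_eq_abs]
    refine le_antisymm (max_le h1 h2) ?_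
    rw [le_max_iff]
    rcases h with h | h | h | h
    · exact .inl (abs_radial_eq_one.2 (.inl h)).ge
    · exact .inl (abs_radial_eq_one.2 (.inr h)).ge
    · exact .inr (abs_radial_eq_one.2 (.inl h)).ge
    · exact .inr (abs_radial_eq_one.2 (.inr h)).ge
  surj v hv := by
    have h1 : |v.1| ≤ 1 := (norm_fst_le v).trans hv.le
    have h2 : |v.2| ≤ 1 := (norm_snd_le v).trans hv.le
    have hw : (ofRadial v.1, ofRadial v.2) ∈ squareBoundary := by
      rw [Prod.norm_def, Real.norm_eq_abs, Real.norm_eq_abs] at hv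
      rcases max_choice |v.1| |v.2| with h | h
      · rw [h, ← radial_ofRadial h1, abs_radial_eq_one] at hv
        exact hv.elim .inl fun h => .inr (.inl h)
      · rw [h, ← radial_ofRadial h2, abs_radial_eq_one] at hv
        exact hv.elim (fun h => .inr (.inr (.inl h))) fun h => .inr (.inr (.inr h))
    obtain ⟨t, ht⟩ := squareCurve.surjective ⟨_, hw⟩
    refine ⟨t, ?_⟩
    rw [centredCurve, ht]
    exact Prod.ext (radial_ofRadial h1) (radial_ofRadial h2)

/-- The square as a ball. -/
def squareHomeo : Icc (-1 : ℝ) 1 × Icc (-1 : ℝ) 1 ≃ₜ Metric.closedBall (0 : ℝ × ℝ) 1 where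
  toFun p := ⟨(p.1, p.2), by
    rw [mem_closedBall_zero_iff, Prod.norm_mk, Real.norm_eq_abs, Real.norm_eq_abs]
    exact max_le (abs_le.2 p.1.2) (abs_le.2 p.2.2)⟩
  invFun v := (⟨v.1.1, abs_le.1 ((norm_fst_le v.1).trans (mem_closedBall_zero_iff.1 v.2))⟩,
    ⟨v.1.2, abs_le.1 ((norm_snd_le v.1).trans (mem_closedBall_zero_iff.1 v.2))⟩)
  left_inv _ := rfl
  right_inv _ := rfl
  continuous_toFun := by fun_prop
  continuous_invFun := by fun_prop

/-- The support is a solid torus. -/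
def supportHomeo : Support ≃ₜ SolidTorus :=
  (Homeomorph.refl _).prodCongr
    (squareHomeo.trans (coneHomeo isSphereParam_centredCurve isSphereParam_toCircle))

theorem supportHomeo_apply {P : Support} {t : UnitAddCircle} (h : (P.2.1 : ℝ) = (centredCurve t).1)
    (h' : (P.2.2 : ℝ) = (centredCurve t).2) :
    (supportHomeo P).1 = P.1 ∧ ((supportHomeo P).2 : ℂ) = AddCircle.toCircle t :=
  ⟨rfl, coneHomeo_apply isSphereParam_centredCurve isSphereParam_toCircle
    (v := squareHomeo P.2) (Prod.ext h h')⟩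

/-! ### The meridian -/

theorem endMap_fst (i : Bool) (w : Annulus) : (endMap i w).1 = w.1 := by
  have h := endPoint_mem (i := i) (φ := angleRep w.1) (abs_radial_le w.2)
  rw [endMap, pieceMap_of_le h.2.1]
  exact coe_angleRep _

theorem coe_attachFun_inv {k : Region} {y : Thick} (hy : y ∈ k.domain) :
    ((attachFun (thickCover y)).2.1 : ℝ) = y.inv := by
  rw [attachFun_thickCover hy, coe_pieceMap_inv (Region.lift_mem_piece hy), leafInv_lift]

theorem mem_domain_of_parallel {y : Thick} (h : |y.x| = 1) :
    y ∈ Region.entry.domain ∨ 1 / 8 ≤ (y.1 : ℝ) ∧ y ∈ Region.side.domain := by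
  by_cases hs : 8 * (y.1 : ℝ) < 1
  · exact .inl hs
  · refine .inr ⟨by linarith, ?_, ?_⟩
    · rw [Thick.inv, abs_baseInv_one _ h, Real.exp_lt_one_iff]
      norm_num
    · change 1 / 16 < (y.1 : ℝ)
      linarith

/-- The rotation of the angle along a fiber in the parallel boundary. -/
def rotation (m s : ℝ) : ℝ := min (8 * s) (max (1 - s) (2 + m - 8 * s) - m)

/-- The angle grows with the time after entry until the interface at time 1, and beyond it follows
the time left before exit. Subtracting the integer `m` from the second expression makes the two
agree at the interface and does not change the point of the circle. -/
theorem attachFun_fst {y : Thick} {m : ℕ} (h : |y.x| = 1) (hm : leafLength y.inv = 2 + m) :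
    (attachFun (thickCover y)).1 = ((y.2.2 + rotation m y.1 : ℝ) : UnitAddCircle) := by
  have hx : y.x ≠ 0 := by
    intro h0
    rw [h0, abs_zero] at h
    exact zero_ne_one h
  have hl : Real.log |baseInv y.2.2 y.x| = 0 := by rw [abs_baseInv_one _ h, Real.log_one]
  have hm0 : (0 : ℝ) ≤ m := m.cast_nonneg
  have hs0 := y.1.2.1
  rcases mem_domain_of_parallel h with h1 | ⟨h1, h2⟩
  · have h2 : 8 * (y.1 : ℝ) < 1 := h1
    have h3 : nearMid false (timePoint false y.2.2 y.x (8 * y.1)) ≤ 1 := by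
      rw [nearMid_timePoint_false hx, Real.exp_le_one_iff, hl]
      linarith
    have h4 : rotation m y.1 = 8 * y.1 :=
      min_eq_left (le_sub_iff_add_le.2 (le_max_of_le_right (by linarith)))
    rw [attachFun_thickCover h1, h4]
    simp only [Region.piece, Region.lift, Region.time]
    rw [pieceMap_of_le h3]
    rfl
  · have h3 : exitTime (leafLength y.inv) y.1 ≤ 1 + m := by
      rw [hm]
      exact max_le (by linarith) (by linarith)
    have h4 : nearMid true (timePoint true y.2.2 y.x (exitTime (leafLength y.inv) y.1)) ≤ 1 := by
      rw [nearMid_timePoint_true hx, Real.exp_le_one_iff, hl]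
      change exitTime (leafLength y.inv) y.1 + 1 - leafLength y.inv - 0 ≤ 0
      linarith
    have h5 : rotation m y.1 = exitTime (leafLength y.inv) y.1 - (m : ℤ) := by
      rw [rotation, min_eq_right, exitTime, hm]
      · simp
      · rw [exitTime, hm] at h3
        linarith
    rw [attachFun_thickCover h2, h5, ← add_sub_assoc, coe_sub_intCast]
    simp only [Region.piece, Region.lift, Region.time]
    rw [pieceMap_of_le h4]
    rfl

theorem baseInv_one (φ : ℝ) : baseInv φ 1 = 1 := by
  have h := abs_baseInv_one φ (x := 1) (by simp)
  rwa [abs_of_pos (baseInv_pos_iff.2 one_pos)] at h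

theorem baseInv_neg_one (φ : ℝ) : baseInv φ (-1) = -1 := by
  have h := abs_baseInv_one φ (x := -1) (by simp)
  have h1 : baseInv φ (-1) < 0 := not_le.1 (baseInv_nonneg_iff.not.2 (by norm_num))
  rw [abs_of_neg h1] at h
  linarith

theorem leafLength_one : leafLength 1 = 2 + (1 : ℕ) := by
  simp only [leafLength, zero_le_one, if_true, abs_one, Real.log_one]
  norm_num

theorem leafLength_neg_one : leafLength (-1) = 2 + (0 : ℕ) := by
  rw [leafLength, if_neg (by norm_num)]
  simp

theorem rotation_zero {m : ℝ} : rotation m 0 = 0 := by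
  refine (min_eq_left (le_sub_iff_add_le.2 (le_max_of_le_right ?_))).trans (by ring)
  linarith

/-- The continuous lift of the angle comes back shifted by `-m`: no net turn for the fibers at `x =
-1`, one full turn for those at `x = 1`. -/
theorem rotation_one {m : ℝ} (h0 : 0 ≤ m) (h : m ≤ 6) : rotation m 1 = -m := by
  rw [rotation, max_eq_left (by linarith), min_eq_right (by linarith)]
  ring

/-- The twisted curve. -/
def twistedCurve (t : UnitAddCircle) : Support :=
  attachFun ((t, (squareCurve t).1.1), (squareCurve t).1.2)

/-- The angle of the twisted curve. -/
def twistedAngle (t : ℝ) : ℝ :=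
  t + rotation 0 (projIcc 0 1 zero_le_one (1 - 4 * t)) +
    rotation 1 (projIcc 0 1 zero_le_one (4 * t - 2))

theorem continuous_twistedAngle : Continuous twistedAngle := by
  have h : ∀ m, Continuous (rotation m) := fun m => by
    unfold rotation
    fun_prop
  have h' : Continuous fun x : ℝ => ((projIcc 0 1 zero_le_one x : unitInterval) : ℝ) :=
    continuous_subtype_val.comp continuous_projIcc
  unfold twistedAngle
  exact (continuous_id.add ((h 0).comp (h'.comp (by fun_prop)))).add
    ((h 1).comp (h'.comp (by fun_prop)))

theorem twistedAngle_eq {a b : ℝ} (t : ℝ)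
    (ha : ((projIcc 0 1 zero_le_one (1 - 4 * t) : unitInterval) : ℝ) = a)
    (hb : ((projIcc 0 1 zero_le_one (4 * t - 2) : unitInterval) : ℝ) = b) :
    twistedAngle t = t + rotation 0 a + rotation 1 b := by
  rw [twistedAngle, ha, hb]

/-- The turn `+1` of the longitude is cancelled by the turn `-1` along the fiber at `x = 1`. The
angle thus lifts to a closed loop in `ℝ`, which can be contracted linearly. -/
theorem twistedAngle_zero_eq_one : twistedAngle 0 = twistedAngle 1 := by
  rw [twistedAngle_eq 0 (coe_projIcc_of_ge (by norm_num)) (coe_projIcc_of_le (by norm_num)),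
    twistedAngle_eq 1 (coe_projIcc_of_le (by norm_num)) (coe_projIcc_of_ge (by norm_num)),
    rotation_one le_rfl (by norm_num), rotation_one zero_le_one (by norm_num), rotation_zero,
    rotation_zero]
  norm_num

theorem twistedCurve_fst (t : UnitAddCircle) :
    (twistedCurve t).1 = (twistedAngle (angleRep t) : ℝ) := by
  have ht := angleRep_mem t
  have hc : twistedCurve t = attachFun (thickCover
      ((squareLoop (angleRep t)).2, ((squareLoop (angleRep t)).1, angleRep t))) := by
    rw [thickCover, coe_angleRep]
    rfl
  set τ := angleRep t with hτ
  rw [hc]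
  rcases le_total τ (1 / 2) with h1 | h1
  · rcases le_total τ (1 / 4) with h2 | h2
    · obtain ⟨h3, h4⟩ := squareLoop_left ht.1 h2
      have hx : Thick.x ((squareLoop τ).2, ((squareLoop τ).1, τ)) = -1 := by
        simp [Thick.x, radial, h3]
      rw [attachFun_fst (m := 0) (by rw [hx]; simp)
        (by rw [Thick.inv, hx, baseInv_neg_one, leafLength_neg_one])]
      rw [twistedAngle_eq τ (coe_projIcc_of_mem ⟨by linarith, by linarith [ht.1]⟩)
        (coe_projIcc_of_le (by linarith)), rotation_zero, add_zero, h4, Nat.cast_zero]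
    · obtain ⟨h3, h4⟩ := squareLoop_bottom h2 h1
      rw [h4, thickCover, attachFun_zero, endMap_fst,
        twistedAngle_eq τ (coe_projIcc_of_le (by linarith)) (coe_projIcc_of_le (by linarith)),
        rotation_zero, rotation_zero, add_zero, add_zero]
  · rcases le_total τ (3 / 4) with h2 | h2
    · obtain ⟨h3, h4⟩ := squareLoop_right h1 h2
      have hx : Thick.x ((squareLoop τ).2, ((squareLoop τ).1, τ)) = 1 := by
        simp only [Thick.x, radial, h3]
        norm_num
      rw [attachFun_fst (m := 1) (by rw [hx]; simp)
        (by rw [Thick.inv, hx, baseInv_one, leafLength_one])]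
      rw [twistedAngle_eq τ (coe_projIcc_of_le (by linarith))
        (coe_projIcc_of_mem ⟨by linarith, by linarith⟩), rotation_zero, add_zero, h4, Nat.cast_one]
    · obtain ⟨h3, h4⟩ := squareLoop_top h2 ht.2.le
      rw [h4, thickCover, attachFun_one, endMap_fst,
        twistedAngle_eq τ (coe_projIcc_of_le (by linarith)) (coe_projIcc_of_ge (by linarith)),
        rotation_zero, rotation_one zero_le_one (by norm_num), add_zero]
      -- On the exit side the lifted angle has already lost its full turn, which is invisible on the
      -- circle.
      have := coe_sub_intCast τ 1
      rw [Int.cast_one] at this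
      rw [← sub_eq_add_neg, this]

theorem thickBoundary_squareCurve (t : UnitAddCircle) :
    ((t, (squareCurve t).1.1), (squareCurve t).1.2) ∈ thickBoundary := (squareCurve t).2

theorem continuous_twistedCurve : Continuous twistedCurve := by
  have h : Continuous fun t => (squareCurve t : unitInterval × unitInterval) :=
    continuous_subtype_val.comp squareCurve.continuous
  exact continuousOn_attachFun.comp_continuous
    ((continuous_id.prodMk h.fst).prodMk h.snd)
    fun t => thickBoundary_subset (thickBoundary_squareCurve t)

theorem twistedCurve_inv {t : UnitAddCircle} (h : (squareCurve t).1.1 = 0 ∨ (squareCurve t).1.1 =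
    1) :
    ((twistedCurve t).2.1 : ℝ) = (centredCurve t).1 := by
  have hc : twistedCurve t = attachFun (thickCover
      ((squareCurve t).1.2, ((squareCurve t).1.1, angleRep t))) := by
    rw [thickCover, coe_angleRep]
    rfl
  obtain ⟨k, hk⟩ := mem_attachDomain.1 (show thickCover
      ((squareCurve t).1.2, ((squareCurve t).1.1, angleRep t)) ∈ attachDomain by
    rw [thickCover, coe_angleRep]
    exact thickBoundary_subset (thickBoundary_squareCurve t))
  rw [hc, coe_attachFun_inv hk]
  simp only [Thick.inv, Thick.x, centredCurve]
  rcases h with h | h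
  · have : radial 0 = -1 := by simp [radial]
    rw [h, this, baseInv_neg_one]
  · have : radial 1 = 1 := by
      simp only [radial, Icc.coe_one]
      norm_num
    rw [h, this, baseInv_one]

theorem twistedCurve_level_zero {t : UnitAddCircle} (h : (squareCurve t).1.2 = 0) :
    ((twistedCurve t).2.2 : ℝ) = -1 := by
  have := (mem_range_endMap (i := false) (P := twistedCurve t)).1
    ⟨(t, (squareCurve t).1.1), by rw [twistedCurve, h, attachFun_zero]⟩
  simpa using this

theorem twistedCurve_level_one {t : UnitAddCircle} (h : (squareCurve t).1.2 = 1) :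
    ((twistedCurve t).2.2 : ℝ) = 1 := by
  have := (mem_range_endMap (i := true) (P := twistedCurve t)).1
    ⟨(t, (squareCurve t).1.1), by rw [twistedCurve, h, attachFun_one]⟩
  simpa using this

theorem lerp_mem {a b : ℝ} (u : unitInterval) (ha : a ∈ Icc (-1 : ℝ) 1) (hb : b ∈ Icc (-1 : ℝ) 1) :
    (1 - u) * a + u * b ∈ Icc (-1 : ℝ) 1 :=
  convex_Icc (-1 : ℝ) 1 ha hb (sub_nonneg.2 u.2.2) u.2.1 (by ring)

/-- The homotopy from the twisted curve to the boundary of a disk. -/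
def meridianHomotopy : C(unitInterval × UnitAddCircle, Support) where
  toFun z := (((1 - z.1) * twistedAngle (angleRep z.2) : ℝ),
    (⟨(1 - z.1) * (twistedCurve z.2).2.1 + z.1 * (centredCurve z.2).1,
      lerp_mem z.1 (twistedCurve z.2).2.1.2 (abs_le.1 (abs_radial_le _))⟩,
    ⟨(1 - z.1) * (twistedCurve z.2).2.2 + z.1 * (centredCurve z.2).2,
      lerp_mem z.1 (twistedCurve z.2).2.2.2 (abs_le.1 (abs_radial_le _))⟩))
  continuous_toFun := by
    have h1 := continuous_apply_angleRep twistedAngle_zero_eq_one continuous_twistedAngle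
    have h2 := continuous_twistedCurve
    have h3 := isSphereParam_centredCurve.continuous
    have h4 : Continuous fun z : unitInterval × UnitAddCircle => (1 - (z.1 : ℝ)) := by fun_prop
    have h5 : Continuous fun z : unitInterval × UnitAddCircle => (z.1 : ℝ) := by fun_prop
    refine Continuous.prodMk ?_ (Continuous.prodMk ?_ ?_)
    · exact (AddCircle.continuous_mk' 1).comp (h4.mul (h1.comp continuous_snd))
    · exact ((h4.mul ((continuous_subtype_val.comp h2.snd.fst).comp continuous_snd)).add
        (h5.mul (h3.fst.comp continuous_snd))).subtype_mk _
    · exact ((h4.mul ((continuous_subtype_val.comp h2.snd.snd).comp continuous_snd)).add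
        (h5.mul (h3.snd.comp continuous_snd))).subtype_mk _

/-- At each parameter, the twisted curve and the boundary of the centred square lie on the same side
of the square. On that side one coordinate has the same constant value for both, and linear
interpolation keeps it. -/
theorem meridianHomotopy_mem (z : unitInterval × UnitAddCircle) :
    meridianHomotopy z ∈ plugFoliation.boundary := by
  obtain ⟨u, t⟩ := z
  have hx : ((meridianHomotopy (u, t)).2.1 : ℝ) =
      (1 - u) * (twistedCurve t).2.1 + u * (centredCurve t).1 := rfl
  have hy : ((meridianHomotopy (u, t)).2.2 : ℝ) =
      (1 - u) * (twistedCurve t).2.2 + u * (centredCurve t).2 := rfl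
  have key : ∀ h : (squareCurve t).1.1 = 0 ∨ (squareCurve t).1.1 = 1,
      |((meridianHomotopy (u, t)).2.1 : ℝ)| = 1 := by
    intro h
    have : (1 - (u : ℝ)) * (centredCurve t).1 + u * (centredCurve t).1 = (centredCurve t).1 := by
      ring
    rw [hx, twistedCurve_inv h, this]
    exact abs_radial_eq_one.2 h
  rw [mem_boundary]
  rcases (squareCurve t).2 with h | h | h | h
  · exact .inr (.inr (key (.inl h)))
  · exact .inr (.inr (key (.inr h)))
  · refine .inl ?_
    rw [hy, twistedCurve_level_zero h, centredCurve, h]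
    simp only [radial, Icc.coe_zero]
    ring
  · refine .inr (.inl ?_)
    rw [hy, twistedCurve_level_one h, centredCurve, h]
    simp only [radial, Icc.coe_one]
    ring

theorem isMeridian_twistedCurve : IsMeridian plugFoliation twistedCurve := by
  refine ⟨supportHomeo, meridianHomotopy, fun t => ?_, fun t => ?_, meridianHomotopy_mem⟩
  · refine Prod.ext ?_ (Prod.ext (Subtype.ext ?_) (Subtype.ext ?_))
    · rw [twistedCurve_fst]
      simp [meridianHomotopy]
    · simp [meridianHomotopy]
    · simp [meridianHomotopy]
  · have h := supportHomeo_apply (P := meridianHomotopy (1, t)) (t := t)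
      (by simp [meridianHomotopy]) (by simp [meridianHomotopy])
    refine ⟨h.1.trans ?_, h.2⟩
    simp [meridianHomotopy]

theorem isIntegrallyDehnTwisted_plug : IsIntegrallyDehnTwisted plugFoliation plug := by
  refine ⟨attachingMap, squareCurve, 1, .inl rfl, ?_⟩
  simp only [one_smul]
  exact isMeridian_twistedCurve

end

end PLPlug

end

theorem mainTheorem5 :
    ∃ (P : Type) (_ : TopologicalSpace P) (𝓕 : PLPlug.MeasuredPLFoliation P)
      (D : 𝓕.Plug PLPlug.Annulus),
      PLPlug.IsIntegrallyDehnTwisted 𝓕 D ∧ {L : Set P | 𝓕.IsClosedLeaf L}.ncard = 2 :=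
  ⟨PLPlug.Support, inferInstance, PLPlug.plugFoliation, PLPlug.plug,
    PLPlug.isIntegrallyDehnTwisted_plug, PLPlug.ncard_closedLeaves⟩
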